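/- Let $n\ge 1$, let $(\mathcal C,\Sigma,\Theta)$ be a Krull–Schmidt $(n+2)$-angulated category in the sense of Geiss–Keller–Oppermann (so $\mathcal C$ is an additive category in which every object is a finite direct sum of objects with local endomorphism rings, $\Sigma$ is an automorphism, or more generally an autoequivalence, of $\mathcal C$, and $\Theta$ is the class of $(n+2)$-angles), and let $\mathcal A$ be a full subcategory of $\mathcal C$ closed under isomorphisms, finite direct sums and direct summands. Assume that $\mathcal A$ is $n$-extension closed: for every morphism $f_{n+1}\colon A_{n+1}\to\Sigma A_0$ with $A_0,A_{n+1}\in\mathcal A$ there is an $(n+2)$-angle $$A_0\xrightarrow{f_0}A_1\xrightarrow{f_1}\cdots\xrightarrow{f_{n-1}}A_n\xrightarrow{f_n}A_{n+1}\xrightarrow{f_{n+1}}\Sigma A_0$$ with $A_1,\dots,A_n\in\mathcal A$. Let $\mathscr E_{\mathcal A}$ be the class of $\mathcal A$-conflations, that is, of the sequences $A_0\xrightarrow{f_0}A_1\to\cdots\to A_n\xrightarrow{f_n}A_{n+1}$ with all terms in $\mathcal A$ for which there is a morphism $f_{n+1}\colon A_{n+1}\to\Sigma A_0$ completing them to an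 $(n+2)$-angle. If $\mathcal C(\Sigma A,A')=0$ for all $A,A'\in\mathcal A$, then $(\mathcal A,\mathscr E_{\mathcal A})$ is an $n$-exact category in the sense of Jasso. Explicitly: $\mathcal A$ is additive; every sequence in $\mathscr E_{\mathcal A}$ is an $n$-exact sequence in $\mathcal A$; $\mathscr E_{\mathcal A}$ is closed under weak isomorphisms of $n$-exact sequences; the sequence $0\to 0\to\cdots\to 0$ belongs to $\mathscr E_{\mathcal A}$; the admissible monomorphisms (the first morphisms $f_0$ of sequences in $\mathscr E_{\mathcal A}$) and the admissible epimorphisms (the last morphisms $f_n$) are each closed under composition; for every sequence $A_0\to\cdots\to A_{n+1}$ in $\mathscr E_{\mathcal A}$ and every morphism $A_0\to B_0$ in $\mathcal A$ there is an $n$-pushout diagram of $A_0\to\cdots\to A_n$ along it, to a sequence $B_0\to\cdots\to B_n$ whose first morphism is an admissible monomorphism; and dually, for every morphism $B_{n+1}\to A_{n+1}$ in $\mathcal A$ there is an $n$-pullback diagram of $A_1\to\cdots\to A_{n+1}$ along it, from a sequence $B_1\to\cdots\to B_{n+1}$ whose last morphism is an admissible epimorphism. -/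

import Mathlib

open CategoryTheory CategoryTheory.Limits

open CategoryTheory.ComposableArrows (app')

universe v u

namespace HigherAngulated

section General

variable {M : Type u} [Category.{v} M] [Preadditive M]

/-- `Z` is the direct sum of `A` and `B`, with injections `i₁` and `i₂`. -/
def IsDirectSum {A B Z : M} (i₁ : A ⟶ Z) (i₂ : B ⟶ Z) : Prop :=
  ∃ (p₁ : Z ⟶ A) (p₂ : Z ⟶ B),
    i₁ ≫ p₁ = 𝟙 A ∧ i₂ ≫ p₂ = 𝟙 B ∧ i₁ ≫ p₂ = 0 ∧ i₂ ≫ p₁ = 0 ∧ p₁ ≫ i₁ + p₂ ≫ i₂ = 𝟙 Z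

variable (M) in
/-- An additive category is Krull-Schmidt if every object is a finite direct sum of objects
with local endomorphism rings. -/
def IsKrullSchmidt [HasFiniteBiproducts M] : Prop :=
  ∀ X : M, ∃ (k : ℕ) (Y : Fin k → M),
    (∀ i, IsLocalRing (End (Y i))) ∧ Nonempty (X ≅ ⨁ Y)

/-- The full subcategory spanned by `A` is closed under isomorphisms, (finite) direct sums and
direct summands. -/
structure IsAdditiveSubcategory (A : ObjectProperty M) : Prop where
  of_iso : ∀ {X Y : M}, (X ≅ Y) → A X → A Y
  of_isZero : ∀ {X : M}, IsZero X → A X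
  sum : ∀ {X Y Z : M} (i₁ : X ⟶ Z) (i₂ : Y ⟶ Z), IsDirectSum i₁ i₂ → A X → A Y → A Z
  summand : ∀ {X Y Z : M} (i₁ : X ⟶ Z) (i₂ : Y ⟶ Z), IsDirectSum i₁ i₂ → A Z → A X

end General

/-! ### `(n+2)`-angulated categories -/

section Angulated

variable {C : Type u} [Category.{v} C]

/-- An `(n+2)`-`S`-sequence `X₀ ⟶ X₁ ⟶ ⋯ ⟶ Xₙ₊₁ ⟶ S X₀`. -/
structure SigmaSeq (S : C ⥤ C) (n : ℕ) where
  /-- the part `X₀ ⟶ X₁ ⟶ ⋯ ⟶ Xₙ₊₁` -/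
  seq : ComposableArrows C (n + 1)
  /-- the last morphism `Xₙ₊₁ ⟶ S X₀` -/
  δ : seq.right ⟶ S.obj seq.left

variable {S : C ⥤ C} {n : ℕ}

/-- A morphism of `(n+2)`-`S`-sequences. -/
structure SigmaSeq.Hom (X Y : SigmaSeq S n) where
  /-- the components `Xᵢ ⟶ Yᵢ` -/
  hom : X.seq ⟶ Y.seq
  comm : X.δ ≫ S.map (app' hom 0) = app' hom (n + 1) ≫ Y.δ

variable [Preadditive C]

/-- `Z` is a direct sum of the sequences `X` and `Y`. -/
def SigmaSeq.IsSum (X Y Z : SigmaSeq S n) : Prop :=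
  ∃ (a : X.Hom Z) (b : Y.Hom Z), ∀ i, IsDirectSum (a.hom.app i) (b.hom.app i)

/-- `X` is (isomorphic to) a trivial sequence `T = T ⟶ 0 ⟶ ⋯ ⟶ 0 ⟶ S T`. -/
def SigmaSeq.IsTrivial (X : SigmaSeq S n) : Prop :=
  IsIso (X.seq.map' 0 1) ∧ ∀ (i : ℕ) (_ : 2 ≤ i) (_ : i ≤ n + 1), IsZero (X.seq.obj' i)

/-- An identification of `Y` with the left rotation
`X₁ ⟶ X₂ ⟶ ⋯ ⟶ Xₙ₊₁ ⟶ S X₀ ⟶ S X₁` of `X`, whose last two morphisms are `X.δ` and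
`(-1)ⁿ⁺² S d₀ = (-1)ⁿ S d₀`. -/
structure SigmaSeq.LeftRotation (X Y : SigmaSeq S n) where
  /-- identifies `X₁ ⟶ ⋯ ⟶ Xₙ₊₁` with `Y₀ ⟶ ⋯ ⟶ Yₙ` -/
  iso : X.seq.δ₀ ≅ Y.seq.δlast
  /-- identifies `S X₀` with `Yₙ₊₁` -/
  isoLast : S.obj X.seq.left ≅ Y.seq.right
  comm : X.δ ≫ isoLast.hom = app' iso.hom n ≫ Y.seq.map' n (n + 1)
  comm_δ : isoLast.hom ≫ Y.δ =
    (-1 : ℤ) ^ n • (S.map (X.seq.map' 0 1) ≫ S.map (app' iso.hom 0))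

/-- An identification of `Z` with the mapping cone of `φ : X ⟶ Y`: this is the sequence with terms
`X₁ ⊕ Y₀, X₂ ⊕ Y₁, …, Xₙ₊₁ ⊕ Yₙ, S X₀ ⊕ Yₙ₊₁` and `S (X₁ ⊕ Y₀) = S X₁ ⊕ S Y₀`, and with
differentials `(-d_X, 0; φ, d_Y)`. The identification is given by the injections `inX i` of
`Xᵢ₊₁`, `inXlast` of `S X₀`, and `inY i` of `Yᵢ`. -/
structure SigmaSeq.Cone {X Y : SigmaSeq S n} (φ : X.Hom Y) (Z : SigmaSeq S n) where
  /-- the injection of `Xᵢ₊₁` -/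
  inX (i : ℕ) (hi : i ≤ n) : X.seq.obj' (i + 1) ⟶ Z.seq.obj' i
  /-- the injection of `S X₀` -/
  inXlast : S.obj X.seq.left ⟶ Z.seq.right
  /-- the injection of `Yᵢ` -/
  inY (i : ℕ) (hi : i ≤ n + 1) : Y.seq.obj' i ⟶ Z.seq.obj' i
  isDirectSum (i : ℕ) (hi : i ≤ n) : IsDirectSum (inX i hi) (inY i (by omega))
  isDirectSum_last : IsDirectSum inXlast (inY (n + 1) le_rfl)
  inX_d (i : ℕ) (hi : i < n) : inX i hi.le ≫ Z.seq.map' i (i + 1) =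
    -(X.seq.map' (i + 1) (i + 2) ≫ inX (i + 1) hi) + app' φ.hom (i + 1) (Nat.le_succ_of_le hi) ≫
      inY (i + 1) (Nat.le_succ_of_le hi)
  inX_d_last : inX n le_rfl ≫ Z.seq.map' n (n + 1) =
    -(X.δ ≫ inXlast) + app' φ.hom (n + 1) le_rfl ≫ inY (n + 1) le_rfl
  inX_δ : inXlast ≫ Z.δ =
    -(S.map (X.seq.map' 0 1) ≫ S.map (inX 0 (Nat.zero_le n))) +
      S.map (app' φ.hom 0) ≫ S.map (inY 0 (Nat.zero_le (n + 1)))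
  inY_d (i : ℕ) (hi : i < n + 1) : inY i hi.le ≫ Z.seq.map' i (i + 1) =
    Y.seq.map' i (i + 1) ≫ inY (i + 1) hi
  inY_δ : inY (n + 1) le_rfl ≫ Z.δ = Y.δ ≫ S.map (inY 0 (Nat.zero_le (n + 1)))

/-- `Θ` is an `(n+2)`-angulation of `(C, S)` in the sense of Geiss, Keller and Oppermann.
The members of `Θ` are the `(n+2)`-angles. -/
structure IsAngulation (Θ : Set (SigmaSeq S n)) : Prop where
  /-- `Θ` is closed under direct sums -/
  sum : ∀ {X Y Z : SigmaSeq S n}, X.IsSum Y Z → X ∈ Θ → Y ∈ Θ → Z ∈ Θ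
  /-- `Θ` is closed under direct summands -/
  summand : ∀ {X Y Z : SigmaSeq S n}, X.IsSum Y Z → Z ∈ Θ → X ∈ Θ
  /-- `Θ` contains the trivial sequences -/
  trivial : ∀ {X : SigmaSeq S n}, X.IsTrivial → X ∈ Θ
  /-- every morphism is the first morphism of an `(n+2)`-angle -/
  exists_angle : ∀ {A B : C} (f : A ⟶ B), ∃ X ∈ Θ,
    Nonempty (Arrow.mk (X.seq.map' 0 1) ≅ Arrow.mk f)
  /-- a sequence is an `(n+2)`-angle if and only if its left rotation is one -/
  rotate_iff : ∀ {X Y : SigmaSeq S n}, X.LeftRotation Y → (X ∈ Θ ↔ Y ∈ Θ)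
  /-- a commutative square between the first morphisms of two `(n+2)`-angles extends to a
  morphism of sequences whose mapping cone is an `(n+2)`-angle -/
  exists_hom : ∀ {X Y : SigmaSeq S n}, X ∈ Θ → Y ∈ Θ →
    ∀ (f₀ : X.seq.obj' 0 ⟶ Y.seq.obj' 0) (f₁ : X.seq.obj' 1 ⟶ Y.seq.obj' 1),
      X.seq.map' 0 1 ≫ f₁ = f₀ ≫ Y.seq.map' 0 1 →
      ∃ φ : X.Hom Y, app' φ.hom 0 = f₀ ∧ app' φ.hom 1 = f₁ ∧
        ∃ Z ∈ Θ, Nonempty (SigmaSeq.Cone φ Z)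

/-- `A` is `n`-extension closed: each `f : A'' ⟶ S A'` with `A'`, `A''` in `A` is the last
morphism of an `(n+2)`-angle `A' ⟶ X₁ ⟶ ⋯ ⟶ Xₙ ⟶ A'' ⟶ S A'` with all terms in `A`. -/
def IsExtensionClosed (Θ : Set (SigmaSeq S n)) (A : ObjectProperty C) : Prop :=
  ∀ {A' A'' : C} (f : A'' ⟶ S.obj A'), A A' → A A'' →
    ∃ X ∈ Θ, (∀ i, A (X.seq.obj i)) ∧
      ∃ (a : X.seq.left ≅ A') (c : X.seq.right ≅ A''), X.δ ≫ S.map a.hom = c.hom ≫ f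

/-- The class of `A`-conflations: the sequences `A₀ ⟶ A₁ ⟶ ⋯ ⟶ Aₙ₊₁` in the full subcategory
`A` which can be completed to an `(n+2)`-angle by some morphism `Aₙ₊₁ ⟶ S A₀`. -/
def conflations (Θ : Set (SigmaSeq S n)) (A : ObjectProperty C) :
    ObjectProperty (ComposableArrows A.FullSubcategory (n + 1)) := fun X =>
  ∃ δ : ((A.ι.mapComposableArrows (n + 1)).obj X).right ⟶
      S.obj ((A.ι.mapComposableArrows (n + 1)).obj X).left,
    SigmaSeq.mk ((A.ι.mapComposableArrows (n + 1)).obj X) δ ∈ Θ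

end Angulated

/-! ### `n`-exact categories -/

section NExact

variable {M : Type u} [Category.{v} M] [Preadditive M] {n : ℕ}

/-- `Z₁ ⟶ ⋯ ⟶ Zₙ₊₁` is an `n`-cokernel of `Z₀ ⟶ Z₁`: for all `T`, the sequence
`0 ⟶ M(Zₙ₊₁, T) ⟶ ⋯ ⟶ M(Z₁, T) ⟶ M(Z₀, T)` is exact. -/
structure IsNCokernel (Z : ComposableArrows M (n + 1)) : Prop where
  zero : ∀ (i : ℕ) (_ : i + 2 ≤ n + 1), Z.map' i (i + 1) ≫ Z.map' (i + 1) (i + 2) = 0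
  exact : ∀ (i : ℕ) (_ : i + 2 ≤ n + 1) {T : M} (g : Z.obj' (i + 1) ⟶ T),
    Z.map' i (i + 1) ≫ g = 0 → ∃ h : Z.obj' (i + 2) ⟶ T, Z.map' (i + 1) (i + 2) ≫ h = g
  injective : ∀ {T : M} (g : Z.obj' (n + 1) ⟶ T), Z.map' n (n + 1) ≫ g = 0 → g = 0

/-- `Z₀ ⟶ ⋯ ⟶ Zₙ` is an `n`-kernel of `Zₙ ⟶ Zₙ₊₁`: for all `T`, the sequence
`0 ⟶ M(T, Z₀) ⟶ ⋯ ⟶ M(T, Zₙ) ⟶ M(T, Zₙ₊₁)` is exact. -/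
structure IsNKernel (Z : ComposableArrows M (n + 1)) : Prop where
  zero : ∀ (i : ℕ) (_ : i + 2 ≤ n + 1), Z.map' i (i + 1) ≫ Z.map' (i + 1) (i + 2) = 0
  exact : ∀ (i : ℕ) (_ : i + 2 ≤ n + 1) {T : M} (g : T ⟶ Z.obj' (i + 1)),
    g ≫ Z.map' (i + 1) (i + 2) = 0 → ∃ h : T ⟶ Z.obj' i, h ≫ Z.map' i (i + 1) = g
  injective : ∀ {T : M} (g : T ⟶ Z.obj' 0), g ≫ Z.map' 0 1 = 0 → g = 0

/-- An `n`-exact sequence `Z₀ ⟶ Z₁ ⟶ ⋯ ⟶ Zₙ₊₁`. -/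
structure IsNExact (Z : ComposableArrows M (n + 1)) : Prop where
  isNKernel : IsNKernel Z
  isNCokernel : IsNCokernel Z

/-- A weak isomorphism: two consecutive components are isomorphisms, where the first component
is considered to follow the last one. -/
def IsWeakIso {X Y : ComposableArrows M (n + 1)} (f : X ⟶ Y) : Prop :=
  (∃ (k : ℕ) (_ : k ≤ n), IsIso (app' f k) ∧ IsIso (app' f (k + 1))) ∨
    (IsIso (app' f (n + 1)) ∧ IsIso (app' f 0))

/-- An identification of `Z` with the mapping cone
`X₀ ⟶ X₁ ⊕ Y₀ ⟶ X₂ ⊕ Y₁ ⟶ ⋯ ⟶ Xₙ ⊕ Yₙ₋₁ ⟶ Yₙ` of `φ : X ⟶ Y`, with differentials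
`(-d_X, 0; φ, d_Y)`. The identification is given by the injections `inX i` of `Xᵢ` and `inY i`
of `Yᵢ`. -/
structure Cone {X Y : ComposableArrows M n} (φ : X ⟶ Y) (Z : ComposableArrows M (n + 1)) where
  /-- the injection of `Xᵢ` -/
  inX (i : ℕ) (hi : i ≤ n) : X.obj' i ⟶ Z.obj' i
  /-- the injection of `Yᵢ` -/
  inY (i : ℕ) (hi : i ≤ n) : Y.obj' i ⟶ Z.obj' (i + 1)
  isIso_first : IsIso (inX 0 (Nat.zero_le n))
  isDirectSum (i : ℕ) (hi : i < n) : IsDirectSum (inX (i + 1) hi) (inY i hi.le)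
  isIso_last : IsIso (inY n le_rfl)
  inX_d (i : ℕ) (hi : i < n) : inX i hi.le ≫ Z.map' i (i + 1) =
    -(X.map' i (i + 1) ≫ inX (i + 1) hi) + app' φ i ≫ inY i hi.le
  inX_d_last : inX n le_rfl ≫ Z.map' n (n + 1) = app' φ n ≫ inY n le_rfl
  inY_d (i : ℕ) (hi : i < n) : inY i hi.le ≫ Z.map' (i + 1) (i + 2) =
    Y.map' i (i + 1) ≫ inY (i + 1) hi

/-- `φ : X ⟶ Y` is an `n`-pushout diagram (of `X` along `X₀ ⟶ Y₀`): the mapping cone is an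
`n`-cokernel of its first morphism. In particular `X₀ ⟶ X₁ ⊕ Y₀ ⟶ ⋯` is a complex. -/
def IsNPushout {X Y : ComposableArrows M n} (φ : X ⟶ Y) : Prop :=
  ∃ Z : ComposableArrows M (n + 1), Nonempty (Cone φ Z) ∧ IsNCokernel Z

/-- `φ : X ⟶ Y` is an `n`-pullback diagram (of `Y` along the last component of `φ`): the mapping
cone is an `n`-kernel of its last morphism. -/
def IsNPullback {X Y : ComposableArrows M n} (φ : X ⟶ Y) : Prop :=
  ∃ Z : ComposableArrows M (n + 1), Nonempty (Cone φ Z) ∧ IsNKernel Z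

/-- `f` is an `E`-admissible monomorphism: the first morphism of a member of `E`. -/
def IsAdmissibleMono (E : ObjectProperty (ComposableArrows M (n + 1))) {A B : M} (f : A ⟶ B) :
    Prop :=
  ∃ X, E X ∧ Nonempty (Arrow.mk (X.map' 0 1) ≅ Arrow.mk f)

/-- `f` is an `E`-admissible epimorphism: the last morphism of a member of `E`. -/
def IsAdmissibleEpi (E : ObjectProperty (ComposableArrows M (n + 1))) {A B : M} (f : A ⟶ B) :
    Prop :=
  ∃ X, E X ∧ Nonempty (Arrow.mk (X.map' n (n + 1)) ≅ Arrow.mk f)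

/-- `(M, E)` is an `n`-exact category in the sense of Jasso, where `n` is a positive integer. -/
structure IsNExactCategory (hn : 1 ≤ n) (E : ObjectProperty (ComposableArrows M (n + 1))) :
    Prop where
  /-- `M` is an additive category -/
  hasFiniteBiproducts : HasFiniteBiproducts M
  /-- `E` consists of `n`-exact sequences -/
  isNExact : ∀ {X}, E X → IsNExact X
  /-- `E` is closed under weak isomorphisms of `n`-exact sequences -/
  weakIso : ∀ {X Y : ComposableArrows M (n + 1)} (f : X ⟶ Y),
    IsNExact X → IsNExact Y → IsWeakIso f → (E X ↔ E Y)
  /-- the sequence `0 ⟶ 0 ⟶ ⋯ ⟶ 0` is in `E` -/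
  zero : ∀ {X : ComposableArrows M (n + 1)}, (∀ i, IsZero (X.obj i)) → E X
  mono_comp : ∀ {A B D : M} (f : A ⟶ B) (g : B ⟶ D),
    IsAdmissibleMono E f → IsAdmissibleMono E g → IsAdmissibleMono E (f ≫ g)
  epi_comp : ∀ {A B D : M} (f : A ⟶ B) (g : B ⟶ D),
    IsAdmissibleEpi E f → IsAdmissibleEpi E g → IsAdmissibleEpi E (f ≫ g)
  /-- `X₀ ⟶ ⋯ ⟶ Xₙ` has an `n`-pushout along every `f : X₀ ⟶ B`, with admissible first
  morphism -/
  pushout : ∀ {X : ComposableArrows M (n + 1)}, E X → ∀ {B : M} (f : X.obj' 0 ⟶ B),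
    ∃ (Y : ComposableArrows M n) (φ : X.δlast ⟶ Y) (e : Y.obj' 0 ≅ B),
      app' φ 0 ≫ e.hom = f ∧ IsNPushout φ ∧ IsAdmissibleMono E (Y.map' 0 1)
  /-- `X₁ ⟶ ⋯ ⟶ Xₙ₊₁` has an `n`-pullback along every `g : B ⟶ Xₙ₊₁`, with admissible last
  morphism -/
  pullback : ∀ {X : ComposableArrows M (n + 1)}, E X → ∀ {B : M} (g : B ⟶ X.obj' (n + 1)),
    ∃ (Y : ComposableArrows M n) (φ : Y ⟶ X.δ₀) (e : B ≅ Y.obj' n),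
      e.hom ≫ app' φ n = g ∧ IsNPullback φ ∧ IsAdmissibleEpi E (Y.map' (n - 1) n)

end NExact

end HigherAngulated

/-! An angle induces exact sequences under `Hom(T, -)` and `Hom(-, T)`. For terms and test objects
in `A`, the defects of exactness at the two ends come from morphisms `S A ⟶ A'`, which vanish by
assumption; hence conflations are `n`-exact (`isNExactIn`). Pushouts and pullbacks come from
extension closure: composing the last morphism of an angle with `S.map f` or with `g` and realising
the result by an angle in `A` gives a morphism of `n`-exact sequences that is invertible at one end.
Its truncated mapping cone is exact as required (`isNCokernel_cone`, `isNKernel_cone`).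

For weak isomorphisms, the tool is that a morphism of `n`-exact sequences with one zero component is
null-homotopic (`mem_nullHomotopic`). Null-homotopic morphisms factor through sums of disks, and
disks are angles. A homotopy retract of an angle is thus a strict retract of a larger angle, hence
an angle (`of_homotopy_retract`). If the isomorphisms sit at the two ends, an inverse up to homotopy
exists once a certain obstruction vanishes. Realising that obstruction by an angle in `A` shows that
it is zero (`exists_of_ends_iso_target`, `exists_of_ends_iso_source`).

Composition is the hard axiom, and no octahedron is at hand. Complete the composite of two
admissible monomorphisms to an angle `X` in `C`. The identity of `Xₙ₊₁` is a morphism through `A`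
plus a morphism through `Xₙ` (`exists_factor_last`). In a Krull-Schmidt category, local summands on
which the second part is invertible lie in disks and can be removed, until the last term is in `A`
(`IsKrullSchmidt.exists_mem`). The middle terms are then replaced: take an angle `E` in `A` with the
same last morphism and exchange `E₁` for `X₁` by adding one disk and splitting off another
(`exists_mem_of_left`). Admissible epimorphisms are dual. -/

namespace HigherAngulated

/-! ### Disks and null-homotopic morphisms. -/

section Pick

variable {C : Type u} [Category.{v} C] [HasZeroObject C]

open scoped ZeroObject in
open Classical in
/-- The object `N` if `P` holds, and the zero object otherwise. -/
noncomputable def pick (P : Prop) (N : C) : C := if P then N else 0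

/-- `pick P N` is `N` if `P` holds. -/
noncomputable def pickIso {P : Prop} (h : P) (N : C) : pick P N ≅ N := eqToIso (if_pos h)

lemma isZero_pick {P : Prop} (h : ¬P) (N : C) : IsZero (pick P N) := by
  unfold pick
  rw [if_neg h]
  exact isZero_zero C

end Pick

section Complexes

variable {C : Type u} [Category.{v} C] [Preadditive C] {m : ℕ}

/-- Consecutive morphisms of `X` compose to zero. -/
def IsComplex (X : ComposableArrows C m) : Prop :=
  ∀ (i : ℕ) (_ : i + 2 ≤ m), X.map' i (i + 1) ≫ X.map' (i + 1) (i + 2) = 0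

/-- Naturality of morphisms to and from disks is tested on all arrows of the index category, so
composites over longer distances are needed as well. -/
lemma IsComplex.map_eq_zero {X : ComposableArrows C m} (hX : IsComplex X) {a b : Fin (m + 1)}
    (f : a ⟶ b) (h : a.val + 2 ≤ b.val) : X.map f = 0 := by
  obtain ⟨a, ha⟩ := a
  obtain ⟨b, hb⟩ := b
  simp only at h
  have : X.map' a b = X.map' a (a + 1) ≫ X.map' (a + 1) (a + 2) ≫ X.map' (a + 2) b := by
    rw [← X.map'_comp (a + 1) (a + 2) b, ← X.map'_comp a (a + 1) b]
  rw [← Category.assoc, hX a (by omega), zero_comp] at this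
  exact this

variable [HasZeroObject C]

/-- The position `i` belongs to the support of the disk at `j`. -/
def InDisk (j i : ℕ) : Prop := j ≤ i ∧ i ≤ j + 1

open Classical in
/-- The contractible complex `⋯ ⟶ 0 ⟶ N = N ⟶ 0 ⟶ ⋯` with `N` at the positions `j` and `j + 1`. -/
noncomputable def disk (m j : ℕ) (N : C) : ComposableArrows C m where
  obj i := pick (InDisk j i.val) N
  map {a b} _ := if h : InDisk j a.val ∧ InDisk j b.val then
    (pickIso h.1 N).hom ≫ (pickIso h.2 N).inv else 0
  map_id a := by
    by_cases h : InDisk j a.val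
    · rw [dif_pos ⟨h, h⟩, Iso.hom_inv_id]
    · exact (isZero_pick h N).eq_of_src _ _
  map_comp {a b c} f g := by
    by_cases ha : InDisk j a.val
    · by_cases hc : InDisk j c.val
      · have h₁ := leOfHom f
        have h₂ := leOfHom g
        have hb : InDisk j b.val := by
          simp only [InDisk] at ha hc ⊢
          simp only [Fin.le_def] at h₁ h₂
          omega
        rw [dif_pos ⟨ha, hc⟩, dif_pos ⟨ha, hb⟩, dif_pos ⟨hb, hc⟩]
        simp
      · exact (isZero_pick hc N).eq_of_tgt _ _
    · exact (isZero_pick ha N).eq_of_src _ _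

/-- The disk at `j` on `N` is `N` in its support. -/
noncomputable def diskIso {j : ℕ} {a : Fin (m + 1)} (ha : InDisk j a.val) (N : C) :
    (disk m j N).obj a ≅ N := pickIso ha N

lemma disk_map {j : ℕ} {N : C} {a b : Fin (m + 1)} (f : a ⟶ b) (ha : InDisk j a.val)
    (hb : InDisk j b.val) :
    (disk m j N).map f = (diskIso ha N).hom ≫ (diskIso hb N).inv := dif_pos ⟨ha, hb⟩

lemma isZero_disk_obj {j : ℕ} {N : C} {a : Fin (m + 1)} (ha : ¬InDisk j a.val) :
    IsZero ((disk m j N).obj a) := isZero_pick ha N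

lemma le_of_inDisk {j : ℕ} (hj : j + 1 ≤ m) {a : Fin (m + 1)} (h : InDisk j a.val) :
    a ≤ (⟨j + 1, by omega⟩ : Fin (m + 1)) := h.2

lemma ge_of_inDisk {j : ℕ} (hj : j + 1 ≤ m) {a : Fin (m + 1)} (h : InDisk j a.val) :
    (⟨j, by omega⟩ : Fin (m + 1)) ≤ a := h.1

open Classical in
/-- The morphism to the disk at `j` given by a morphism from the object at `j + 1`. -/
noncomputable def toDisk {X : ComposableArrows C m} (hX : IsComplex X) {j : ℕ} (hj : j + 1 ≤ m)
    {N : C} (g : X.obj' (j + 1) ⟶ N) : X ⟶ disk m j N where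
  app a := if h : InDisk j a.val then
    X.map (homOfLE (le_of_inDisk hj h)) ≫ g ≫ (diskIso h N).inv else 0
  naturality {a b} f := by
    by_cases hb : InDisk j b.val
    · rw [dif_pos hb, ← Category.assoc, ← X.map_comp]
      by_cases ha : InDisk j a.val
      · rw [dif_pos ha, disk_map f ha hb]
        simp only [Category.assoc, Iso.inv_hom_id_assoc]
        rfl
      · rw [dif_neg ha, zero_comp, hX.map_eq_zero, zero_comp]
        have := leOfHom f
        simp only [InDisk, Fin.le_def] at ha hb this ⊢
        omega
    · exact (isZero_disk_obj hb).eq_of_tgt _ _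

lemma toDisk_app {X : ComposableArrows C m} (hX : IsComplex X) {j : ℕ} (hj : j + 1 ≤ m)
    {N : C} (g : X.obj' (j + 1) ⟶ N) {a : Fin (m + 1)} (h : InDisk j a.val) :
    (toDisk hX hj g).app a =
      X.map (homOfLE (le_of_inDisk hj h)) ≫ g ≫ (diskIso h N).inv := dif_pos h

open Classical in
/-- The morphism from the disk at `j` given by a morphism to the object at `j`. -/
noncomputable def fromDisk {X : ComposableArrows C m} (hX : IsComplex X) {j : ℕ} (hj : j + 1 ≤ m)
    {N : C} (g : N ⟶ X.obj' j) : disk m j N ⟶ X where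
  app a := if h : InDisk j a.val then
    (diskIso h N).hom ≫ g ≫ X.map (homOfLE (ge_of_inDisk hj h)) else 0
  naturality {a b} f := by
    by_cases ha : InDisk j a.val
    · rw [dif_pos ha]
      simp only [Category.assoc]
      rw [← X.map_comp]
      by_cases hb : InDisk j b.val
      · rw [dif_pos hb, disk_map f ha hb]
        simp only [Category.assoc, Iso.inv_hom_id_assoc]
        rfl
      · rw [dif_neg hb, comp_zero, hX.map_eq_zero, comp_zero, comp_zero]
        have := leOfHom f
        simp only [InDisk, Fin.le_def] at ha hb this ⊢
        omega
    · exact (isZero_disk_obj ha).eq_of_src _ _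

lemma fromDisk_app {X : ComposableArrows C m} (hX : IsComplex X) {j : ℕ} (hj : j + 1 ≤ m)
    {N : C} (g : N ⟶ X.obj' j) {a : Fin (m + 1)} (h : InDisk j a.val) :
    (fromDisk hX hj g).app a =
      (diskIso h N).hom ≫ g ≫ X.map (homOfLE (ge_of_inDisk hj h)) := dif_pos h

variable {X Y : ComposableArrows C m} (hX : IsComplex X) (hY : IsComplex Y)

/-- The null-homotopic morphism given by `h : Xⱼ₊₁ ⟶ Yⱼ`. -/
noncomputable def nullMap {j : ℕ} (hj : j + 1 ≤ m) (h : X.obj' (j + 1) ⟶ Y.obj' j) : X ⟶ Y :=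
  -- Passing through the disk on `Yⱼ` by definition makes it visible that null-homotopic morphisms
  -- factor through contractible sequences.
  toDisk hX hj h ≫ fromDisk hY hj (𝟙 _)

lemma nullMap_app_left {j : ℕ} (hj : j + 1 ≤ m) (h : X.obj' (j + 1) ⟶ Y.obj' j) :
    app' (nullMap hX hY hj h) j = X.map' j (j + 1) ≫ h := by
  have hd : InDisk j j := ⟨le_rfl, by omega⟩
  simp only [nullMap, app', NatTrans.comp_app]
  rw [toDisk_app _ _ _ (by exact hd), fromDisk_app _ _ _ (by exact hd)]
  have : Y.map (homOfLE (ge_of_inDisk hj (a := ⟨j, by omega⟩) hd)) = 𝟙 _ := Y.map_id _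
  simp only [this, Category.assoc, Iso.inv_hom_id, Category.comp_id]

lemma nullMap_app_right {j : ℕ} (hj : j + 1 ≤ m) (h : X.obj' (j + 1) ⟶ Y.obj' j) :
    app' (nullMap hX hY hj h) (j + 1) = h ≫ Y.map' j (j + 1) := by
  have hd : InDisk j (j + 1) := ⟨by omega, le_rfl⟩
  simp only [nullMap, app', NatTrans.comp_app]
  rw [toDisk_app _ _ _ (by exact hd), fromDisk_app _ _ _ (by exact hd)]
  have : X.map (homOfLE (le_of_inDisk hj (a := ⟨j + 1, by omega⟩) hd)) = 𝟙 _ := X.map_id _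
  simp only [this, Category.assoc, Iso.inv_hom_id_assoc, Category.id_comp]

lemma nullMap_app_of_not {j : ℕ} (hj : j + 1 ≤ m) (h : X.obj' (j + 1) ⟶ Y.obj' j)
    {a : Fin (m + 1)} (ha : ¬InDisk j a.val) : (nullMap hX hY hj h).app a = 0 := by
  simp only [nullMap, NatTrans.comp_app]
  rw [(isZero_disk_obj ha).eq_of_tgt ((toDisk hX hj h).app a) 0, zero_comp]

/-- The null-homotopic morphisms `X ⟶ Y`. -/
noncomputable def nullHomotopic : AddSubgroup (X ⟶ Y) :=
  AddSubgroup.closure {u | ∃ (j : ℕ) (hj : j + 1 ≤ m) (h : X.obj' (j + 1) ⟶ Y.obj' j),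
    u = nullMap hX hY hj h}

lemma nullMap_mem {j : ℕ} (hj : j + 1 ≤ m) (h : X.obj' (j + 1) ⟶ Y.obj' j) :
    nullMap hX hY hj h ∈ nullHomotopic hX hY :=
  AddSubgroup.subset_closure ⟨j, hj, h, rfl⟩

/-- The component at the left end of a null-homotopic morphism factors through the first
morphism. -/
lemma nullHomotopic.app_zero (hm : 1 ≤ m) {u : X ⟶ Y} (hu : u ∈ nullHomotopic hX hY) :
    ∃ h : X.obj' 1 ⟶ Y.obj' 0, app' u 0 = X.map' 0 1 ≫ h := by
  induction hu using AddSubgroup.closure_induction with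
  | mem u hu =>
    obtain ⟨j, hj, h, rfl⟩ := hu
    by_cases hj0 : j = 0
    · subst hj0
      exact ⟨h, nullMap_app_left _ _ _ _⟩
    · refine ⟨0, ?_⟩
      rw [comp_zero]
      exact nullMap_app_of_not _ _ _ _ (by simp [InDisk, hj0])
  | zero => exact ⟨0, by rw [comp_zero]; rfl⟩
  | add a b _ _ ha hb =>
    obtain ⟨p, hp⟩ := ha
    obtain ⟨q, hq⟩ := hb
    exact ⟨p + q, by rw [Preadditive.comp_add, ← hp, ← hq]; rfl⟩
  | neg a _ ha =>
    obtain ⟨p, hp⟩ := ha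
    exact ⟨-p, by rw [Preadditive.comp_neg, ← hp]; rfl⟩

/-- The component at the right end of a null-homotopic morphism factors through the last
morphism. -/
lemma nullHomotopic.app_last {X Y : ComposableArrows C (m + 1)} (hX : IsComplex X)
    (hY : IsComplex Y) {u : X ⟶ Y} (hu : u ∈ nullHomotopic hX hY) :
    ∃ h : X.obj' (m + 1) ⟶ Y.obj' m, app' u (m + 1) = h ≫ Y.map' m (m + 1) := by
  induction hu using AddSubgroup.closure_induction with
  | mem u hu =>
    obtain ⟨j, hj, h, rfl⟩ := hu
    by_cases hj0 : j = m
    · subst hj0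
      exact ⟨h, nullMap_app_right _ _ _ _⟩
    · refine ⟨0, ?_⟩
      rw [zero_comp]
      exact nullMap_app_of_not _ _ _ _ (by simp [InDisk]; omega)
  | zero => exact ⟨0, by rw [zero_comp]; rfl⟩
  | add a b _ _ ha hb =>
    obtain ⟨p, hp⟩ := ha
    obtain ⟨q, hq⟩ := hb
    exact ⟨p + q, by rw [Preadditive.add_comp, ← hp, ← hq]; rfl⟩
  | neg a _ ha =>
    obtain ⟨p, hp⟩ := ha
    exact ⟨-p, by rw [Preadditive.neg_comp, ← hp]; rfl⟩

end Complexes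

/-! ### Comparison of `n`-exact sequences up to homotopy. -/

section Relative

variable {C : Type u} [Category.{v} C] [Preadditive C] {n : ℕ}

/-- The sequence `Z` of objects in `A` is `n`-exact as a sequence in the full subcategory `A`. -/
structure IsNExactIn (A : ObjectProperty C) (Z : ComposableArrows C (n + 1)) : Prop where
  mem : ∀ i, A (Z.obj i)
  isComplex : IsComplex Z
  desc : ∀ (i : ℕ) (_ : i + 2 ≤ n + 1) {T : C} (_ : A T) (g : Z.obj' (i + 1) ⟶ T),
    Z.map' i (i + 1) ≫ g = 0 → ∃ h : Z.obj' (i + 2) ⟶ T, g = Z.map' (i + 1) (i + 2) ≫ h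
  desc_last : ∀ {T : C} (_ : A T) (g : Z.obj' (n + 1) ⟶ T), Z.map' n (n + 1) ≫ g = 0 → g = 0
  lift : ∀ (i : ℕ) (_ : i + 2 ≤ n + 1) {T : C} (_ : A T) (g : T ⟶ Z.obj' (i + 1)),
    g ≫ Z.map' (i + 1) (i + 2) = 0 → ∃ h : T ⟶ Z.obj' i, g = h ≫ Z.map' i (i + 1)
  lift_zero : ∀ {T : C} (_ : A T) (g : T ⟶ Z.obj' 0), g ≫ Z.map' 0 1 = 0 → g = 0

/-- Allows all arguments to run on sequences in `C`, with test objects restricted to `A`. -/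
lemma isNExact_iff {A : ObjectProperty C} {Z : ComposableArrows A.FullSubcategory (n + 1)} :
    IsNExact Z ↔ IsNExactIn A ((A.ι.mapComposableArrows (n + 1)).obj Z) := by
  constructor
  · intro h
    refine ⟨fun i => (Z.obj i).property, fun i hi => ?_, fun i hi T hT g hg => ?_,
      fun {T} hT g hg => ?_, fun i hi T hT g hg => ?_, fun {T} hT g hg => ?_⟩
    · exact (congrArg InducedCategory.Hom.hom (h.isNKernel.zero i hi) :)
    · obtain ⟨k, hk⟩ := h.isNCokernel.exact i hi (T := ⟨T, hT⟩) (ObjectProperty.homMk g)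
        (by ext; exact hg)
      exact ⟨k.hom, (congrArg InducedCategory.Hom.hom hk).symm⟩
    · exact congrArg InducedCategory.Hom.hom (h.isNCokernel.injective (T := ⟨T, hT⟩)
        (ObjectProperty.homMk g) (by ext; exact hg))
    · obtain ⟨k, hk⟩ := h.isNKernel.exact i hi (T := ⟨T, hT⟩) (ObjectProperty.homMk g)
        (by ext; exact hg)
      exact ⟨k.hom, (congrArg InducedCategory.Hom.hom hk).symm⟩
    · exact congrArg InducedCategory.Hom.hom (h.isNKernel.injective (T := ⟨T, hT⟩)
        (ObjectProperty.homMk g) (by ext; exact hg))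
  · intro h
    refine ⟨⟨fun i hi => ?_, fun i hi T g hg => ?_, fun {T} g hg => ?_⟩,
      ⟨fun i hi => ?_, fun i hi T g hg => ?_, fun {T} g hg => ?_⟩⟩
    · ext; exact h.isComplex i hi
    · obtain ⟨k, hk⟩ := h.lift i hi T.property g.hom (congrArg InducedCategory.Hom.hom hg)
      exact ⟨ObjectProperty.homMk k, by ext; exact hk.symm⟩
    · ext; exact h.lift_zero T.property g.hom (congrArg InducedCategory.Hom.hom hg)
    · ext; exact h.isComplex i hi
    · obtain ⟨k, hk⟩ := h.desc i hi T.property g.hom (congrArg InducedCategory.Hom.hom hg)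
      exact ⟨ObjectProperty.homMk k, by ext; exact hk.symm⟩
    · ext; exact h.desc_last T.property g.hom (congrArg InducedCategory.Hom.hom hg)

variable {A : ObjectProperty C} {X Y : ComposableArrows C (n + 1)}

section NullHomotopic

variable [HasZeroObject C] (hX : IsNExactIn A X) (hY : IsNExactIn A Y)

include hX hY

/-- The homotopy is built to the right of `k`. Once component `m` is zero, component `m + 1`
vanishes on the preceding differential, hence factors through the next one; the factor is the next
piece of the homotopy. The correction lives in degrees `m + 1` and `m + 2`, so the zeros already
obtained survive. -/
lemma exists_nullHomotopic_right (u : X ⟶ Y) (k : ℕ) (hk : k ≤ n + 1) (hu : app' u k = 0) (m : ℕ)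
    (hkm : k ≤ m) : m ≤ n + 1 → ∃ w ∈ nullHomotopic hX.isComplex hY.isComplex,
      ∀ (i : ℕ) (hi : i ≤ n + 1), k ≤ i → i ≤ m → app' (u - w) i = 0 := by
  induction m, hkm using Nat.le_induction with
  | base =>
    intro _
    refine ⟨0, AddSubgroup.zero_mem _, fun i hi h₁ h₂ => ?_⟩
    obtain rfl : i = k := by omega
    rw [sub_zero]
    exact hu
  | succ m hkm ih =>
    intro hm
    obtain ⟨w, hw, hz⟩ := ih (by omega)
    have h₀ : X.map' m (m + 1) ≫ app' (u - w) (m + 1) = 0 := by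
      rw [ComposableArrows.naturality' (u - w) m (m + 1), hz m (by omega) hkm le_rfl, zero_comp]
    by_cases hmn : m + 2 ≤ n + 1
    · obtain ⟨h, hh⟩ := hX.desc m hmn (hY.mem _) _ h₀
      refine ⟨w + nullMap hX.isComplex hY.isComplex hmn h,
        AddSubgroup.add_mem _ hw (nullMap_mem _ _ _ _), fun i hi h₁ h₂ => ?_⟩
      rw [← sub_sub]
      obtain rfl | h₃ : i = m + 1 ∨ i ≤ m := by omega
      · change app' u (m + 1) hm - app' w (m + 1) hm -
          app' (nullMap hX.isComplex hY.isComplex hmn h) (m + 1) hm = 0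
        rw [nullMap_app_left, sub_eq_zero]
        exact hh
      · have := nullMap_app_of_not hX.isComplex hY.isComplex hmn h (a := ⟨i, by omega⟩)
          (by simp only [InDisk]; omega)
        change app' (u - w) i hi - app' (nullMap hX.isComplex hY.isComplex hmn h) i hi = 0
        rw [hz i hi h₁ h₃, zero_sub, neg_eq_zero]
        exact this
    -- At the right end nothing is left to choose: the last differential is epic against objects of
    -- `A`.
    · obtain rfl : m = n := by omega
      refine ⟨w, hw, fun i hi h₁ h₂ => ?_⟩
      obtain rfl | h₃ : i = m + 1 ∨ i ≤ m := by omega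
      · exact hX.desc_last (hY.mem _) _ h₀
      · exact hz i hi h₁ h₃

/-- The dual sweep to the left, using lifts in `Y`. It stops in degree `0`, where the first
differential is monic against objects of `A`. -/
lemma nullHomotopic_of_right (k : ℕ) (hk : k ≤ n + 1) : ∀ (u : X ⟶ Y),
    (∀ (i : ℕ) (hi : i ≤ n + 1), k ≤ i → app' u i = 0) →
      u ∈ nullHomotopic hX.isComplex hY.isComplex := by
  induction k with
  | zero =>
    intro u hu
    have : u = 0 := by
      ext i
      exact hu i.val (by omega) (Nat.zero_le _)
    rw [this]
    exact AddSubgroup.zero_mem _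
  | succ k ih =>
    intro u hu
    have h₀ : app' u k ≫ Y.map' k (k + 1) = 0 := by
      rw [← ComposableArrows.naturality' u k (k + 1), hu (k + 1) hk le_rfl, comp_zero]
    cases k with
    | zero =>
      refine ih (by omega) u fun i hi _ => ?_
      cases i with
      | zero => exact hY.lift_zero (hX.mem _) _ h₀
      | succ i => exact hu (i + 1) hi (by omega)
    | succ k =>
      obtain ⟨h, hh⟩ := hY.lift k (by omega) (hX.mem _) _ h₀
      have hd : k + 1 ≤ n + 1 := by omega
      rw [← sub_add_cancel u (nullMap hX.isComplex hY.isComplex hd h)]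
      refine AddSubgroup.add_mem _ (ih (by omega) _ fun i hi h₁ => ?_) (nullMap_mem _ _ _ _)
      change app' u i hi - app' (nullMap hX.isComplex hY.isComplex hd h) i hi = 0
      obtain rfl | h₃ : i = k + 1 ∨ k + 2 ≤ i := by omega
      · rw [nullMap_app_right, sub_eq_zero]
        exact hh
      · have := nullMap_app_of_not hX.isComplex hY.isComplex hd h (a := ⟨i, by omega⟩)
          (by simp only [InDisk]; omega)
        rw [hu i hi h₃, zero_sub, neg_eq_zero]
        exact this

/-- A morphism of `n`-exact sequences one of whose components is zero is null-homotopic. -/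
lemma mem_nullHomotopic (u : X ⟶ Y) (k : ℕ) (hk : k ≤ n + 1) (hu : app' u k = 0) :
    u ∈ nullHomotopic hX.isComplex hY.isComplex := by
  obtain ⟨w, hw, hz⟩ := exists_nullHomotopic_right hX hY u k hk hu (n + 1) hk le_rfl
  rw [← sub_add_cancel u w]
  exact AddSubgroup.add_mem _
    (nullHomotopic_of_right hX hY k hk _ fun i hi h => hz i hi h hi) hw

end NullHomotopic

section Extend

/-- The family `g` commutes with the `i`-th differential. -/
def CommutesAt (g : ∀ i, X.obj i ⟶ Y.obj i) (i : ℕ) : Prop :=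
  ∀ hi : i < n + 1, X.map' i (i + 1) ≫ g ⟨i + 1, by omega⟩ = g ⟨i, by omega⟩ ≫ Y.map' i (i + 1)

omit [Preadditive C] in
lemma CommutesAt.congr {g g' : ∀ i, X.obj i ⟶ Y.obj i} {i : ℕ} (h : CommutesAt g i)
    (h₀ : ∀ hi : i < n + 1, g' ⟨i, by omega⟩ = g ⟨i, by omega⟩)
    (h₁ : ∀ hi : i < n + 1, g' ⟨i + 1, by omega⟩ = g ⟨i + 1, by omega⟩) : CommutesAt g' i := by
  intro hi
  rw [h₀ hi, h₁ hi]
  exact h hi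

omit [Preadditive C] in
lemma update_ne (g : ∀ i, X.obj i ⟶ Y.obj i) {k : Fin (n + 2)} (a : X.obj k ⟶ Y.obj k) {i : ℕ}
    (hi : i < n + 2) (h : i ≠ k.val) : Function.update g k a ⟨i, hi⟩ = g ⟨i, hi⟩ :=
  Function.update_of_ne (fun e => h (congrArg Fin.val e)) _ _

variable (hX : IsNExactIn A X) (hY : IsNExactIn A Y)

include hX hY

/-- Components form a bare family instead of a morphism, since the squares to the left of `k` are
only repaired afterwards, by `exists_hom_left`. -/
lemma exists_family_right (g : ∀ i, X.obj i ⟶ Y.obj i) (k : ℕ) (hg : CommutesAt g k) (m : ℕ)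
    (hkm : k ≤ m) : ∃ g' : ∀ i, X.obj i ⟶ Y.obj i,
      (∀ (i : ℕ) (hi : i < n + 2), i ≤ k + 1 → g' ⟨i, hi⟩ = g ⟨i, hi⟩) ∧
        ∀ i, k ≤ i → i ≤ m → CommutesAt g' i := by
  induction m, hkm using Nat.le_induction with
  | base =>
    refine ⟨g, fun _ _ _ => rfl, fun i h₁ h₂ => ?_⟩
    obtain rfl : i = k := by omega
    exact hg
  | succ m hkm ih =>
    obtain ⟨g', h₀, hc⟩ := ih
    by_cases hm : m + 1 < n + 1
    · obtain ⟨h, hh⟩ := hX.desc m (by omega) (hY.mem _)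
        (g' ⟨m + 1, by omega⟩ ≫ Y.map' (m + 1) (m + 2)) (by
          rw [← Category.assoc, hc m hkm le_rfl (by omega), Category.assoc,
            hY.isComplex m (by omega), comp_zero])
      refine ⟨Function.update g' ⟨m + 2, by omega⟩ h, fun i hi hik => ?_, fun i h₁ h₂ => ?_⟩
      · rw [update_ne _ _ _ (by simp only; omega), h₀ i hi hik]
      · obtain rfl | h₃ : i = m + 1 ∨ i ≤ m := by omega
        · intro _
          rw [Function.update_self, update_ne _ _ _ (by simp only; omega)]
          exact hh.symm
        · exact (hc i h₁ h₃).congr (fun _ => update_ne _ _ _ (by simp only; omega))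
            (fun _ => update_ne _ _ _ (by simp only; omega))
    · refine ⟨g', h₀, fun i h₁ h₂ => ?_⟩
      obtain rfl | h₃ : i = m + 1 ∨ i ≤ m := by omega
      · exact fun hi => absurd hi hm
      · exact hc i h₁ h₃

/-- The components below `k` are discarded and replaced, one after the other, by lifts through the
differentials of `Y`. -/
lemma exists_hom_left (k : ℕ) (hk : k ≤ n) : ∀ (g : ∀ i, X.obj i ⟶ Y.obj i),
    (∀ i, k ≤ i → CommutesAt g i) →
      ∃ f : X ⟶ Y, ∀ (i : ℕ) (hi : i ≤ n + 1), k ≤ i → app' f i = g ⟨i, by omega⟩ := by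
  induction k with
  | zero =>
    intro g hg
    exact ⟨ComposableArrows.homMk g fun i hi => hg i (Nat.zero_le _) hi, fun _ _ _ => rfl⟩
  | succ k ih =>
    intro g hg
    obtain ⟨h, hh⟩ := hY.lift k (by omega) (hX.mem ⟨k, by omega⟩)
      (X.map' k (k + 1) ≫ g ⟨k + 1, by omega⟩) (by
        rw [Category.assoc, ← hg (k + 1) le_rfl (by omega), ← Category.assoc,
          hX.isComplex k (by omega), zero_comp])
    obtain ⟨f, hf⟩ := ih (by omega) (Function.update g ⟨k, by omega⟩ h) fun i hi => by
      obtain rfl | h₃ : i = k ∨ k + 1 ≤ i := by omega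
      · intro _
        rw [Function.update_self, update_ne _ _ _ (by simp only; omega)]
        exact hh
      · exact (hg i h₃).congr (fun _ => update_ne _ _ _ (by simp only; omega))
            (fun _ => update_ne _ _ _ (by simp only; omega))
    refine ⟨f, fun i hi hki => ?_⟩
    rw [hf i hi (by omega)]
    exact update_ne _ _ _ (by simp only; omega)

/-- Two consecutive components of a morphism of `n`-exact sequences can be prescribed. -/
lemma exists_hom_extending (k : ℕ) (hk : k ≤ n) (a : X.obj' k ⟶ Y.obj' k)
    (b : X.obj' (k + 1) ⟶ Y.obj' (k + 1)) (hab : X.map' k (k + 1) ≫ b = a ≫ Y.map' k (k + 1)) :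
    ∃ f : X ⟶ Y, app' f k = a ∧ app' f (k + 1) = b := by
  -- The bound `n + k` is at least `k`, as the lemma demands, and at least `n`, so that every square
  -- from `k` on is covered.
  obtain ⟨g, h₀, hc⟩ := exists_family_right hX hY
    (Function.update (Function.update (fun _ => 0) ⟨k, by omega⟩ a) ⟨k + 1, by omega⟩ b) k
    (by
      intro _
      rw [Function.update_self, update_ne _ _ _ (by simp only; omega), Function.update_self]
      exact hab) (n + k) (by omega)
  obtain ⟨f, hf⟩ := exists_hom_left hX hY k hk g fun i hi => by
    by_cases h : i ≤ n + k
    · exact hc i hi h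
    · exact fun _ => by omega
  refine ⟨f, ?_, ?_⟩
  · rw [hf k (by omega) le_rfl, h₀ _ _ (by omega), update_ne _ _ _ (by simp only; omega),
      Function.update_self]
  · rw [hf (k + 1) (by omega) (by omega), h₀ _ _ le_rfl, Function.update_self]

end Extend

end Relative

attribute [local instance] hasBinaryBiproducts_of_finite_biproducts

/-! ### Split idempotents and removal of local summands in Krull-Schmidt categories. -/

section KrullSchmidt

variable {C : Type u} [Category.{v} C] [Preadditive C]

/-- The endomorphism `e` is a split idempotent. -/
def SplitIdempotent {X : C} (e : X ⟶ X) : Prop :=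
  ∃ (W : C) (j : W ⟶ X) (q : X ⟶ W), j ≫ q = 𝟙 W ∧ q ≫ j = e

-- Between two copies of `g` the composite `b ≫ a` acts as the identity, so `X'` sees the whole
-- image of `g` and a splitting found on `X'` can be carried back.
omit [Preadditive C] in
lemma SplitIdempotent.of_retract {X X' : C} {a : X' ⟶ X} {b : X ⟶ X'} {g : X ⟶ X}
    (hg : g ≫ g = g) (hgb : g ≫ b ≫ a ≫ g = g) (h : SplitIdempotent (a ≫ g ≫ b)) :
    SplitIdempotent g := by
  obtain ⟨W, j, q, hjq, hqj⟩ := h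
  refine ⟨W, j ≫ a ≫ g, g ≫ b ≫ q, ?_, ?_⟩
  · have : (j ≫ a ≫ g) ≫ g ≫ b ≫ q = j ≫ (a ≫ g ≫ b) ≫ q := by
      simp only [Category.assoc, reassoc_of% hg]
    rw [this, ← hqj, Category.assoc, hjq, Category.comp_id, hjq]
  · have : (g ≫ b ≫ q) ≫ j ≫ a ≫ g = g ≫ b ≫ (q ≫ j) ≫ a ≫ g := by
      simp only [Category.assoc]
    rw [this, hqj]
    simp only [Category.assoc, reassoc_of% hgb]
    exact hgb

/-- Orthogonality passes from the idempotents to their splittings, so the image of the sum is the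
biproduct of the images. -/
lemma SplitIdempotent.add [HasBinaryBiproducts C] {X : C} {e f : X ⟶ X} (he : SplitIdempotent e)
    (hf : SplitIdempotent f) (hef : e ≫ f = 0) (hfe : f ≫ e = 0) : SplitIdempotent (e + f) := by
  obtain ⟨W, j, q, hjq, rfl⟩ := he
  obtain ⟨W', j', q', hjq', rfl⟩ := hf
  have h₁ : j ≫ q' = 0 := by
    have : j ≫ q' = j ≫ ((q ≫ j) ≫ q' ≫ j') ≫ q' := by
      simp only [Category.assoc, hjq', reassoc_of% hjq, Category.comp_id]
    rw [this, hef, zero_comp, comp_zero]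
  have h₂ : j' ≫ q = 0 := by
    have : j' ≫ q = j' ≫ ((q' ≫ j') ≫ q ≫ j) ≫ q := by
      simp only [Category.assoc, hjq, reassoc_of% hjq', Category.comp_id]
    rw [this, hfe, zero_comp, comp_zero]
  refine ⟨W ⊞ W', biprod.desc j j', biprod.lift q q', ?_, ?_⟩
  · ext <;> simp [h₁, h₂, hjq, hjq']
  · simp [biprod.lift_desc]

lemma isIso_or_isIso_of_add_eq_id {Y : C} [IsLocalRing (End Y)] {a b : Y ⟶ Y}
    (h : a + b = 𝟙 Y) : IsIso a ∨ IsIso b := by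
  rw [← isUnit_iff_isIso, ← isUnit_iff_isIso]
  exact IsLocalRing.isUnit_or_isUnit_of_add_one (R := End Y) h

/-- `X` is a direct sum of `k` objects with local endomorphism rings. -/
def IsSumOfLocals : ℕ → C → Prop
  | 0, X => IsZero X
  | k + 1, X => ∃ (Y X' : C) (i₁ : Y ⟶ X) (i₂ : X' ⟶ X), IsDirectSum i₁ i₂ ∧
      IsLocalRing (End Y) ∧ IsSumOfLocals k X'

/-- A decomposition of `X` transports a splitting property to an idempotent with a big enough
kernel. -/
lemma SplitIdempotent.of_isUnit [HasBinaryBiproducts C] {X Y X' : C} {i₁ : Y ⟶ X} {i₂ : X' ⟶ X}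
    (h : IsDirectSum i₁ i₂) (hX' : ∀ e : X' ⟶ X', e ≫ e = e → SplitIdempotent e)
    {e : X ⟶ X} (he : e ≫ e = e) {p₁ : X ⟶ Y} (hp₁ : i₁ ≫ p₁ = 𝟙 Y) (hp₂ : i₂ ≫ p₁ = 0)
    [hu : IsIso (i₁ ≫ e ≫ p₁)] : SplitIdempotent e ∧ SplitIdempotent (𝟙 X - e) := by
  obtain ⟨p₁', p₂, h₁, h₂, h₁₂, h₂₁, hsum⟩ := h
  obtain rfl : p₁' = p₁ := by
    rw [← Category.id_comp p₁, ← hsum, Preadditive.add_comp, Category.assoc, Category.assoc, hp₁,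
      hp₂, comp_zero, add_zero, Category.comp_id]
  let β := inv (i₁ ≫ e ≫ p₁')
  have hαβ : i₁ ≫ e ≫ p₁' ≫ β = 𝟙 Y := by
    have := IsIso.hom_inv_id (i₁ ≫ e ≫ p₁')
    simpa only [Category.assoc] using this
  have hβα : β ≫ i₁ ≫ e ≫ p₁' = 𝟙 Y := IsIso.inv_hom_id (i₁ ≫ e ≫ p₁')
  -- `s` and `r` exhibit a copy of `Y` as a summand inside the image of `e`.
  obtain ⟨s, hs⟩ : ∃ s, s = i₁ ≫ e := ⟨_, rfl⟩
  obtain ⟨r, hr⟩ : ∃ r, r = e ≫ p₁' ≫ β := ⟨_, rfl⟩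
  have hse : s ≫ e = s := by rw [hs, Category.assoc, he]
  have her : e ≫ r = r := by rw [hr, reassoc_of% he]
  have hsr : s ≫ r = 𝟙 Y := by
    rw [hs, hr, Category.assoc, reassoc_of% he]
    exact hαβ
  have hsp : β ≫ s ≫ p₁' = 𝟙 Y := by rw [hs, Category.assoc]; exact hβα
  have hsp' : s ≫ p₁' ≫ β = 𝟙 Y := by rw [hs, Category.assoc]; exact hαβ
  -- `a` and `b` factor the complementary idempotent `𝟙 X - r ≫ s` through `X'`.
  let a : X' ⟶ X := i₂ ≫ (𝟙 X - r ≫ s)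
  let b : X ⟶ X' := p₂ - p₁' ≫ β ≫ s ≫ p₂
  have hp₂i₂ : p₂ ≫ i₂ = 𝟙 X - p₁' ≫ i₁ := by rw [← hsum]; abel
  have hba : b ≫ a = 𝟙 X - r ≫ s := by
    have h₀ : s ≫ (𝟙 X - r ≫ s) = 0 := by
      rw [Preadditive.comp_sub, reassoc_of% hsr, Category.comp_id, sub_self]
    have h₃ : b ≫ i₂ = 𝟙 X - p₁' ≫ β ≫ s := by
      simp only [b, Preadditive.sub_comp, Category.assoc, hp₂i₂, Preadditive.comp_sub,
        Category.comp_id]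
      rw [reassoc_of% hsp]
      abel
    rw [← Category.assoc, h₃, Preadditive.sub_comp, Category.id_comp, Category.assoc,
      Category.assoc, h₀, comp_zero, comp_zero, sub_zero]
  -- Applied to `e - r ≫ s` and to `𝟙 X - e`; both are then governed by idempotents of `X'`.
  have key : ∀ g : X ⟶ X, g ≫ g = g → g ≫ r ≫ s = 0 → SplitIdempotent g := by
    intro g hg hgr
    have hgb : g ≫ b ≫ a ≫ g = g := by
      rw [reassoc_of% hba, Preadditive.sub_comp, Category.id_comp, Preadditive.comp_sub, hg,
        Category.assoc, ← Category.assoc r s, ← Category.assoc, hgr, zero_comp, sub_zero]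
    refine SplitIdempotent.of_retract (a := a) (b := b) hg hgb (hX' _ ?_)
    simp only [Category.assoc]
    rw [reassoc_of% hgb]
  have hrs : SplitIdempotent (r ≫ s) := ⟨Y, s, r, hsr, rfl⟩
  have hers : e ≫ r ≫ s = r ≫ s := by rw [← Category.assoc, her]
  have h₁ : (e - r ≫ s) ≫ r ≫ s = 0 := by
    rw [Preadditive.sub_comp, hers, Category.assoc, reassoc_of% hsr, sub_self]
  have h₂ : (r ≫ s) ≫ (e - r ≫ s) = 0 := by
    rw [Preadditive.comp_sub, Category.assoc, hse, Category.assoc, reassoc_of% hsr, sub_self]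
  constructor
  · rw [← sub_add_cancel e (r ≫ s)]
    refine SplitIdempotent.add (key _ ?_ h₁) hrs h₁ h₂
    rw [Preadditive.comp_sub, h₁, sub_zero, Preadditive.sub_comp, he, Category.assoc, hse]
  · refine key _ ?_ ?_
    · simp [he]
    · rw [Preadditive.sub_comp, Category.id_comp, hers, sub_self]

/-- Induction on the number of local summands. On a local summand the diagonal entries of `e` and `𝟙
X - e` add up to the identity, so one of them is invertible. Since `of_isUnit` splits an idempotent
together with its complement, either case suffices. -/
lemma IsSumOfLocals.splitIdempotent [HasBinaryBiproducts C] {k : ℕ} :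
    ∀ {X : C}, IsSumOfLocals k X → ∀ e : X ⟶ X, e ≫ e = e → SplitIdempotent e := by
  induction k with
  | zero =>
    intro X hX e _
    exact ⟨X, 𝟙 X, e, hX.eq_of_src _ _, hX.eq_of_src _ _⟩
  | succ k ih =>
    rintro X ⟨Y, X', i₁, i₂, h, hY, hX'⟩ e he
    obtain ⟨p₁, p₂, h₁, h₂, h₁₂, h₂₁, hsum⟩ := id h
    have hadd : i₁ ≫ e ≫ p₁ + i₁ ≫ (𝟙 X - e) ≫ p₁ = 𝟙 Y := by
      simp [h₁]
    rcases isIso_or_isIso_of_add_eq_id hadd with hu | hu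
    · exact (SplitIdempotent.of_isUnit h (fun e he => ih hX' e he) he h₁ h₂₁).1
    · have := (SplitIdempotent.of_isUnit h (fun e he => ih hX' e he) (e := 𝟙 X - e)
        (by simp [he]) h₁ h₂₁).2
      rwa [sub_sub_cancel] at this

lemma IsSumOfLocals.of_iso {k : ℕ} {X X' : C} (e : X ≅ X') (h : IsSumOfLocals k X) :
    IsSumOfLocals k X' := by
  cases k with
  | zero => exact IsZero.of_iso h e.symm
  | succ k =>
    obtain ⟨Y, Z, i₁, i₂, ⟨p₁, p₂, h₁, h₂, h₁₂, h₂₁, hsum⟩, hY, hZ⟩ := h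
    refine ⟨Y, Z, i₁ ≫ e.hom, i₂ ≫ e.hom, ⟨e.inv ≫ p₁, e.inv ≫ p₂, ?_⟩, hY, hZ⟩
    refine ⟨by simp [h₁], by simp [h₂], by simp [h₁₂], by simp [h₂₁], ?_⟩
    have : (e.inv ≫ p₁) ≫ i₁ ≫ e.hom + (e.inv ≫ p₂) ≫ i₂ ≫ e.hom =
        e.inv ≫ (p₁ ≫ i₁ + p₂ ≫ i₂) ≫ e.hom := by simp
    rw [this, hsum, Category.id_comp, Iso.inv_hom_id]

lemma isSumOfLocals_biproduct [HasFiniteBiproducts C] (k : ℕ) : ∀ (Y : Fin k → C),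
    (∀ i, IsLocalRing (End (Y i))) → IsSumOfLocals k (⨁ Y) := by
  induction k with
  | zero =>
    intro Y _
    rw [IsSumOfLocals, IsZero.iff_id_eq_zero]
    ext i
    exact i.elim0
  | succ k ih =>
    intro Y hY
    refine ⟨Y 0, ⨁ fun i : Fin k => Y i.succ, biproduct.ι Y 0,
      biproduct.desc fun i => biproduct.ι Y i.succ,
      ⟨biproduct.π Y 0, biproduct.lift fun i => biproduct.π Y i.succ, ?_, ?_, ?_, ?_, ?_⟩, hY 0,
      ih _ fun i => hY i.succ⟩
    · simp
    · ext i j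
      by_cases h : i = j
      · subst h
        simp
      · have h' : j ≠ i := fun e => h e.symm
        simp [biproduct.ι_π_ne _ h', biproduct.ι_π_ne Y (fun e => h' (Fin.succ_injective _ e))]
    · ext j
      simp [biproduct.ι_π_ne Y (Fin.succ_ne_zero j).symm]
    · ext j
      simp [biproduct.ι_π_ne Y (Fin.succ_ne_zero j)]
    · rw [biproduct.lift_desc, ← biproduct.total, Fin.sum_univ_succ]

lemma IsKrullSchmidt.exists_isSumOfLocals [HasFiniteBiproducts C] (hC : IsKrullSchmidt C) (X : C) :
    ∃ k, IsSumOfLocals k X := by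
  obtain ⟨k, Y, hY, ⟨e⟩⟩ := hC X
  exact ⟨k, (isSumOfLocals_biproduct k Y hY).of_iso e.symm⟩

/-- In a Krull-Schmidt category each split monomorphism has a complement. -/
lemma IsKrullSchmidt.exists_complement [HasFiniteBiproducts C] (hC : IsKrullSchmidt C) {N X : C}
    {s : N ⟶ X} {r : X ⟶ N} (h : s ≫ r = 𝟙 N) :
    ∃ (W : C) (j : W ⟶ X) (q : X ⟶ W),
      j ≫ q = 𝟙 W ∧ s ≫ q = 0 ∧ j ≫ r = 0 ∧ r ≫ s + q ≫ j = 𝟙 X := by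
  obtain ⟨k, hk⟩ := hC.exists_isSumOfLocals X
  obtain ⟨W, j, q, h₁, h₂⟩ := hk.splitIdempotent (𝟙 X - r ≫ s) (by simp [reassoc_of% h])
  refine ⟨W, j, q, h₁, ?_, ?_, by rw [h₂]; abel⟩
  · have : s ≫ (q ≫ j) ≫ q = 0 := by
      rw [h₂, Preadditive.sub_comp, Category.assoc, Preadditive.comp_sub, reassoc_of% h,
        Category.id_comp, sub_self]
    rwa [Category.assoc, h₁, Category.comp_id] at this
  · have : j ≫ (q ≫ j) ≫ r = 0 := by
      rw [h₂, Preadditive.sub_comp, Category.assoc, h, Category.comp_id, Category.id_comp,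
        sub_self, comp_zero]
    rwa [Category.assoc, reassoc_of% h₁] at this

variable {A : ObjectProperty C}

lemma IsAdditiveSubcategory.of_retract [HasFiniteBiproducts C] (hA : IsAdditiveSubcategory A)
    (hC : IsKrullSchmidt C) {N X : C} (s : N ⟶ X) (r : X ⟶ N) (h : s ≫ r = 𝟙 N) (hX : A X) :
    A N := by
  obtain ⟨W, j, q, h₁, h₂, h₃, h₄⟩ := hC.exists_complement h
  exact hA.summand s j ⟨r, q, h, h₁, h₂, h₃, h₄⟩ hX

lemma IsAdditiveSubcategory.biprod [HasFiniteBiproducts C] (hA : IsAdditiveSubcategory A)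
    {X Y : C} (hX : A X) (hY : A Y) : A (X ⊞ Y) :=
  hA.sum biprod.inl biprod.inr ⟨biprod.fst, biprod.snd, by simp, by simp, by simp, by simp,
    biprod.total⟩ hX hY

/-- Let `Φ` be a property of objects such that the identity of each `V` with `Φ V` is the sum of a
morphism which factors through `A` and a morphism `t` such that summands on which `t` is invertible
can be split off. If there is an object with `Φ`, there is one in `A`. -/
lemma IsKrullSchmidt.exists_mem [HasFiniteBiproducts C] (hC : IsKrullSchmidt C)
    (hA : IsAdditiveSubcategory A) {Φ : C → Prop}
    (hΦ : ∀ V, Φ V → ∃ (M : C) (_ : A M) (u : V ⟶ M) (w : M ⟶ V) (t : V ⟶ V), u ≫ w + t = 𝟙 V ∧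
      ∀ {N V' : C} (y : N ⟶ V) (y' : V' ⟶ V) (p : V ⟶ N) (p' : V ⟶ V'), y ≫ p = 𝟙 N →
        y' ≫ p' = 𝟙 V' → y ≫ p' = 0 → y' ≫ p = 0 → p ≫ y + p' ≫ y' = 𝟙 V →
        IsIso (y ≫ t ≫ p) → Φ V') (V : C) (hV : Φ V) :
    ∃ V, A V ∧ Φ V := by
  suffices H : ∀ (k : ℕ) (V : C), Φ V → ∀ (P Q : C) (a : P ⟶ V) (b : Q ⟶ V), IsDirectSum a b →
      A P → IsSumOfLocals k Q → ∃ V, A V ∧ Φ V by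
    obtain ⟨k, hk⟩ := hC.exists_isSumOfLocals V
    have hz := isZero_zero C
    exact H k V hV _ V 0 (𝟙 V) ⟨0, 𝟙 V, hz.eq_of_src _ _, by simp, by simp, by simp, by simp⟩
      (hA.of_isZero hz) hk
  intro k
  induction k with
  | zero =>
    rintro V hV P Q a b hab hP hQ
    exact ⟨V, hA.sum a b hab hP (hA.of_isZero hQ), hV⟩
  | succ k ih =>
    rintro V hV P Q a b ⟨a', b', h₁, h₂, h₃, h₄, h₅⟩ hP
      ⟨Y, Q', i₁, i₂, ⟨p₁, p₂, g₁, g₂, g₃, g₄, g₅⟩, hY, hQ'⟩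
    obtain ⟨M, hM, u, w, t, huw, hsplit⟩ := hΦ V hV
    let i : P ⊞ Q' ⟶ V := biprod.desc a (i₂ ≫ b)
    let p : V ⟶ P ⊞ Q' := biprod.lift a' (b' ≫ p₂)
    have hip : i ≫ p = 𝟙 _ := by
      ext <;> simp [i, p, h₁, reassoc_of% h₂, reassoc_of% h₃, g₂, h₄]
    have hy : (i₁ ≫ b) ≫ b' ≫ p₁ = 𝟙 Y := by simp [reassoc_of% h₂, g₁]
    have hyp : (i₁ ≫ b) ≫ p = 0 := by
      ext <;> simp [p, h₄, reassoc_of% h₂, g₃]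
    have hiy : i ≫ b' ≫ p₁ = 0 := by
      ext <;> simp [i, reassoc_of% h₃, reassoc_of% h₂, g₄]
    have htot : (b' ≫ p₁) ≫ i₁ ≫ b + p ≫ i = 𝟙 V := by
      have : (b' ≫ p₁) ≫ i₁ ≫ b + p ≫ i = a' ≫ a + b' ≫ (p₁ ≫ i₁ + p₂ ≫ i₂) ≫ b := by
        simp only [p, i, biprod.lift_desc, Preadditive.add_comp, Preadditive.comp_add,
          Category.assoc]
        abel
      rw [this, g₅, Category.id_comp, h₅]
    have hadd : (i₁ ≫ b) ≫ (u ≫ w) ≫ b' ≫ p₁ + (i₁ ≫ b) ≫ t ≫ b' ≫ p₁ = 𝟙 Y := by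
      rw [← Preadditive.comp_add, ← Preadditive.add_comp, huw, Category.id_comp, hy]
    -- If the part through `M` is invertible on `Y`, then `Y` is a retract of `M` and moves from `Q`
    -- to `P`; otherwise `t` is invertible on `Y`, which is split off from `V`. Both shrink `Q`.
    rcases isIso_or_isIso_of_add_eq_id hadd with hu | hu
    · have hYA : A Y := hA.of_retract hC ((i₁ ≫ b) ≫ u)
        (w ≫ b' ≫ p₁ ≫ inv ((i₁ ≫ b) ≫ (u ≫ w) ≫ b' ≫ p₁)) (by
          have := IsIso.hom_inv_id ((i₁ ≫ b) ≫ (u ≫ w) ≫ b' ≫ p₁)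
          simpa only [Category.assoc] using this) hM
      refine ih V hV (P ⊞ Y) Q' (biprod.desc a (i₁ ≫ b)) (i₂ ≫ b)
        ⟨biprod.lift a' (b' ≫ p₁), b' ≫ p₂, ?_, ?_, ?_, ?_, ?_⟩ (hA.biprod hP hYA) hQ'
      · ext <;> simp [h₁, reassoc_of% h₂, reassoc_of% h₃, g₁, h₄]
      · simp [reassoc_of% h₂, g₂]
      · ext <;> simp [reassoc_of% h₃, reassoc_of% h₂, g₃]
      · ext <;> simp [h₄, reassoc_of% h₂, g₄]
      · rw [← htot]
        simp only [p, i, biprod.lift_desc, Category.assoc]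
        abel
    · have hV' := hsplit (i₁ ≫ b) i (b' ≫ p₁) p hy hip hyp hiy htot
        hu
      exact ih (P ⊞ Q') hV' P Q' biprod.inl biprod.inr
        ⟨biprod.fst, biprod.snd, by simp, by simp, by simp, by simp, biprod.total⟩ hP hQ'

end KrullSchmidt

/-! ### Direct sums and complements of sequences with last morphism. -/

section Sequences

variable {C : Type u} [Category.{v} C] {S : C ⥤ C} {n : ℕ}

variable [Preadditive C] [HasFiniteBiproducts C]

/-- The direct sum of two sequences. -/
noncomputable def SigmaSeq.biprod (X Y : SigmaSeq S n) : SigmaSeq S n where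
  seq :=
    { obj := fun i => X.seq.obj i ⊞ Y.seq.obj i
      map := fun f => biprod.map (X.seq.map f) (Y.seq.map f) }
  δ := biprod.desc (X.δ ≫ S.map biprod.inl) (Y.δ ≫ S.map biprod.inr)

namespace SigmaSeq

variable (X Y : SigmaSeq S n)

/-- The first injection. -/
noncomputable def inl : X.Hom (X.biprod Y) where
  hom := { app := fun i => biprod.inl, naturality := fun i j f => by simp [SigmaSeq.biprod] }
  comm := (biprod.inl_desc _ _).symm

/-- The second injection. -/
noncomputable def inr : Y.Hom (X.biprod Y) where
  hom := { app := fun i => biprod.inr, naturality := fun i j f => by simp [SigmaSeq.biprod] }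
  comm := (biprod.inr_desc _ _).symm

lemma isSum_biprod : X.IsSum Y (X.biprod Y) :=
  ⟨X.inl Y, X.inr Y, fun _ => ⟨biprod.fst, biprod.snd, biprod.inl_fst, biprod.inr_snd,
    biprod.inl_snd, biprod.inr_fst, biprod.total⟩⟩

variable {X Y}

/-- The morphism to a direct sum given by its components. -/
noncomputable def biprodLift [S.Additive] {Z : SigmaSeq S n} (f : Z.Hom X) (g : Z.Hom Y) :
    Z.Hom (X.biprod Y) where
  hom :=
    { app := fun i => biprod.lift (f.hom.app i) (g.hom.app i)
      naturality := fun i j h => by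
        have h₁ := f.hom.naturality h
        have h₂ := g.hom.naturality h
        apply biprod.hom_ext <;> simp [SigmaSeq.biprod, h₁, h₂] }
  comm := by
    have h₁ := f.comm
    have h₂ := g.comm
    have h0 := Nat.zero_le (n + 1)
    have hn : n + 1 ≤ n + 1 := le_rfl
    have : (biprod.lift (app' f.hom 0 h0) (app' g.hom 0 h0)) =
        app' f.hom 0 h0 ≫ biprod.inl + app' g.hom 0 h0 ≫ biprod.inr := by
      rw [biprod.lift_eq]
    change Z.δ ≫ S.map (biprod.lift (app' f.hom 0 h0) (app' g.hom 0 h0)) =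
      biprod.lift (app' f.hom (n + 1) hn) (app' g.hom (n + 1) hn) ≫
        biprod.desc (X.δ ≫ S.map biprod.inl) (Y.δ ≫ S.map biprod.inr)
    rw [biprod.lift_desc, this, S.map_add, S.map_comp, S.map_comp, Preadditive.comp_add,
      reassoc_of% h₁, reassoc_of% h₂]

/-- The morphism from a direct sum given by its components. -/
noncomputable def biprodDesc {Z : SigmaSeq S n} (f : X.Hom Z) (g : Y.Hom Z) :
    (X.biprod Y).Hom Z where
  hom :=
    { app := fun i => biprod.desc (f.hom.app i) (g.hom.app i)
      naturality := fun i j h => by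
        have h₁ := f.hom.naturality h
        have h₂ := g.hom.naturality h
        apply biprod.hom_ext' <;> simp [SigmaSeq.biprod, h₁, h₂] }
  comm := by
    have h₁ := f.comm
    have h₂ := g.comm
    change biprod.desc (X.δ ≫ S.map biprod.inl) (Y.δ ≫ S.map biprod.inr) ≫
      S.map (biprod.desc (app' f.hom 0 (Nat.zero_le _)) (app' g.hom 0 (Nat.zero_le _))) =
      biprod.desc (app' f.hom (n + 1) le_rfl) (app' g.hom (n + 1) le_rfl) ≫ Z.δ
    apply biprod.hom_ext'
    · rw [biprod.inl_desc_assoc, biprod.inl_desc_assoc, Category.assoc, ← S.map_comp,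
        biprod.inl_desc, h₁]
    · rw [biprod.inr_desc_assoc, biprod.inr_desc_assoc, Category.assoc, ← S.map_comp,
        biprod.inr_desc, h₂]

lemma lift_desc_app [S.Additive] {Z Z' : SigmaSeq S n} (f : Z.Hom X) (g : Z.Hom Y)
    (f' : X.Hom Z') (g' : Y.Hom Z') :
    (biprodLift f g).hom ≫ (biprodDesc f' g').hom = f.hom ≫ f'.hom + g.hom ≫ g'.hom := by
  ext
  exact biprod.lift_desc

/-- A retract of a sequence has a complement. -/
lemma exists_complement (hC : IsKrullSchmidt C) [S.Additive] {X Y : SigmaSeq S n} (s : Y.Hom X)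
    (r : X.Hom Y) (h : s.hom ≫ r.hom = 𝟙 Y.seq) :
    ∃ (W : SigmaSeq S n) (j : W.Hom X) (q : X.Hom W), Y.IsSum W X ∧ W.IsSum Y X ∧
      j.hom ≫ q.hom = 𝟙 W.seq ∧ s.hom ≫ q.hom = 0 ∧ j.hom ≫ r.hom = 0 ∧
        r.hom ≫ s.hom + q.hom ≫ j.hom = 𝟙 X.seq := by
  have hi : ∀ i, s.hom.app i ≫ r.hom.app i = 𝟙 _ := fun i => by
    rw [← NatTrans.comp_app, h, NatTrans.id_app]
  -- Complements are chosen termwise, and the differentials of `X` are compressed to them by `j` and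
  -- `q`. This is functorial because `s` and `r` commute with the differentials.
  choose W j q h₁ h₂ h₃ h₄ using fun i => hC.exists_complement (hi i)
  have hq : ∀ i, q i ≫ j i = 𝟙 _ - r.hom.app i ≫ s.hom.app i := fun i => by
    rw [← h₄]; abel
  have key₁ : ∀ {a b : Fin (n + 2)} (f : a ⟶ b),
      (j a ≫ X.seq.map f ≫ q b) ≫ j b = j a ≫ X.seq.map f := by
    intro a b f
    simp only [Category.assoc]
    rw [hq, Preadditive.comp_sub, Category.comp_id, r.hom.naturality_assoc, Preadditive.comp_sub,
      reassoc_of% (h₃ a), zero_comp, sub_zero]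
  have key₂ : ∀ {a b : Fin (n + 2)} (f : a ⟶ b),
      q a ≫ j a ≫ X.seq.map f ≫ q b = X.seq.map f ≫ q b := by
    intro a b f
    rw [← Category.assoc, hq, Preadditive.sub_comp, Category.id_comp, Category.assoc,
      ← s.hom.naturality_assoc, h₂ b, comp_zero, comp_zero, sub_zero]
  let W' : SigmaSeq S n :=
    { seq :=
        { obj := W
          map := fun {a b} f => j a ≫ X.seq.map f ≫ q b
          map_id := fun a => by simp [h₁]
          map_comp := fun {a b c} f g => by
            rw [← Category.assoc (j a ≫ X.seq.map f ≫ q b), key₁]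
            simp }
      δ := j _ ≫ X.δ ≫ S.map (q _) }
  let jj : W'.Hom X :=
    { hom := { app := j, naturality := fun a b f => key₁ f }
      comm := by
        change (j _ ≫ X.δ ≫ S.map (q _)) ≫ S.map (j _) = j _ ≫ X.δ
        rw [Category.assoc, Category.assoc, ← S.map_comp, hq, S.map_sub, S.map_id, S.map_comp,
          Preadditive.comp_sub, Category.comp_id, ← Category.assoc X.δ]
        have := r.comm
        rw [app', app'] at this
        rw [this, Category.assoc, Preadditive.comp_sub, ← Category.assoc (j _) (r.hom.app _), h₃,
          zero_comp, sub_zero] }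
  let qq : X.Hom W' :=
    { hom := { app := q, naturality := fun a b f => (key₂ f).symm }
      comm := by
        change X.δ ≫ S.map (q _) = q _ ≫ j _ ≫ X.δ ≫ S.map (q _)
        have := s.comm
        rw [app', app'] at this
        rw [← Category.assoc (q _), hq, Preadditive.sub_comp, Category.id_comp, Category.assoc,
          ← Category.assoc (s.hom.app _), ← this, Category.assoc, ← S.map_comp, h₂, S.map_zero,
          comp_zero, comp_zero, sub_zero] }
  refine ⟨W', jj, qq, ⟨s, jj, fun i => ⟨r.hom.app i, q i, hi i, h₁ i, h₂ i, h₃ i, h₄ i⟩⟩,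
    ⟨jj, s, fun i => ⟨q i, r.hom.app i, h₁ i, hi i, h₃ i, h₂ i, ?_⟩⟩, ?_, ?_, ?_, ?_⟩
  · exact (add_comm _ _).trans (h₄ i)
  · ext i; exact h₁ i
  · ext i; exact h₂ i
  · ext i; exact h₃ i
  · ext i; exact h₄ i

end SigmaSeq

end Sequences

/-! ### Closure of the angulation under homotopy retracts. -/

section Closure

variable {C : Type u} [Category.{v} C] [Preadditive C] [HasFiniteBiproducts C] {S : C ⥤ C}
  [S.Additive] {n : ℕ} {Θ : Set (SigmaSeq S n)}

lemma IsAngulation.of_retract (hΘ : IsAngulation Θ) (hC : IsKrullSchmidt C) {X Y : SigmaSeq S n}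
    (s : Y.Hom X) (r : X.Hom Y) (h : s.hom ≫ r.hom = 𝟙 Y.seq) (hX : X ∈ Θ) : Y ∈ Θ := by
  obtain ⟨W, _, _, hW, _⟩ := SigmaSeq.exists_complement hC s r h
  exact hΘ.summand hW hX

variable (S n) in
/-- The disk as a sequence with vanishing last morphism. -/
noncomputable abbrev diskSeq (j : ℕ) (N : C) : SigmaSeq S n where
  seq := disk (n + 1) j N
  δ := 0

/-- The `(n+2)`-angulation contains the disks. -/
lemma IsAngulation.diskSeq_mem (hΘ : IsAngulation Θ) (N : C) (j : ℕ) :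
    j ≤ n → diskSeq S n j N ∈ Θ := by
  induction j with
  | zero =>
    intro _
    -- The disk at `0` is a trivial sequence.
    refine hΘ.trivial ⟨?_, fun i h₁ h₂ => isZero_disk_obj (by simp only [InDisk]; omega)⟩
    have h₀ : InDisk 0 0 := ⟨le_rfl, by omega⟩
    have h₁ : InDisk 0 1 := ⟨by omega, le_rfl⟩
    change IsIso ((disk (n + 1) 0 N).map _)
    rw [disk_map _ (by exact h₀) (by exact h₁)]
    infer_instance
  | succ j ih =>
    intro hj
    have hS : ∀ {X : C}, IsZero X → IsZero (S.obj X) := fun h => S.map_isZero h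
    have hiso : ∀ {X X' Z Z' : C} (a : X ≅ N) (b : Z ≅ N) (a' : X' ≅ N) (b' : Z' ≅ N),
        (a.hom ≫ b.inv) ≫ (b ≪≫ b'.symm).hom = (a ≪≫ a'.symm).hom ≫ a'.hom ≫ b'.inv := by
      intros
      simp
    have hp : ∀ i, InDisk (j + 1) (i + 1) ↔ InDisk j i := fun i => by
      simp only [InDisk]; omega
    have hd0 : IsZero ((diskSeq S n (j + 1) N).seq.left) :=
      isZero_disk_obj (by simp only [InDisk]; omega)
    have hdl : IsZero ((diskSeq S n j N).seq.right) :=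
      isZero_disk_obj (by simp only [InDisk]; omega)
    classical
    let e : ∀ i : Fin (n + 1), (diskSeq S n (j + 1) N).seq.δ₀.obj i ≅
        (diskSeq S n j N).seq.δlast.obj i := fun i =>
      if h : InDisk j i.val then
        diskIso (m := n + 1) (a := i.succ) ((hp i).2 h) N ≪≫
          (diskIso (m := n + 1) (a := i.castSucc) h N).symm
      else
        IsZero.iso (isZero_disk_obj (m := n + 1) (a := i.succ) (fun h' => h ((hp i).1 h')))
          (isZero_disk_obj (m := n + 1) (a := i.castSucc) h)
    -- Left rotation moves the disk at `j + 1` to the disk at `j`. The terms that wrap around are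
    -- zero, so the two conditions on the last morphisms, sign included, are automatic.
    refine (hΘ.rotate_iff (X := diskSeq S n (j + 1) N) (Y := diskSeq S n j N)
      ⟨NatIso.ofComponents e fun {a b} f => ?_, IsZero.iso (hS hd0) hdl,
        hdl.eq_of_tgt _ _, (hS hd0).eq_of_src _ _⟩).2 (ih (by omega))
    by_cases ha : InDisk j a.val
    · by_cases hb : InDisk j b.val
      · simp only [e, dif_pos ha, dif_pos hb]
        change (disk (n + 1) (j + 1) N).map ((Fin.succFunctor (n + 1)).map f) ≫ _ =
          _ ≫ (disk (n + 1) j N).map ((Fin.castSuccFunctor (n + 1)).map f)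
        rw [disk_map _ ((hp a).2 ha) ((hp b).2 hb), disk_map _ (by exact ha) (by exact hb)]
        exact hiso _ _ _ _
      · exact IsZero.eq_of_tgt (isZero_disk_obj (m := n + 1) (a := b.castSucc) hb) _ _
    · exact IsZero.eq_of_src (isZero_disk_obj (m := n + 1) (a := a.succ)
        (fun h' => ha ((hp a).1 h'))) _ _

/-- A morphism to a disk is compatible with the last morphisms. -/
lemma exists_hom_toDisk {X : SigmaSeq S n} (hX : IsComplex X.seq)
    (hδ : X.δ ≫ S.map (X.seq.map' 0 1) = 0) {j : ℕ} (hj : j + 1 ≤ n + 1) {N : C}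
    (g : X.seq.obj' (j + 1) ⟶ N) : ∃ f : X.Hom (diskSeq S n j N), f.hom = toDisk hX hj g := by
  refine ⟨⟨toDisk hX hj g, ?_⟩, rfl⟩
  change _ = _ ≫ (0 : _ ⟶ _)
  rw [comp_zero]
  -- Only the disk at `0` meets the left end, and there the claim is `hδ`.
  by_cases h : InDisk j 0
  · obtain rfl : j = 0 := by simpa [InDisk] using h
    rw [app', toDisk_app _ _ _ (by exact h), S.map_comp, ← Category.assoc]
    erw [hδ]
    rw [zero_comp]
  · rw [(isZero_disk_obj (m := n + 1) (a := ⟨0, by omega⟩) h).eq_of_tgt (app' (toDisk hX hj g) 0) 0,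
      S.map_zero, comp_zero]

omit [S.Additive] in
/-- A morphism from a disk is compatible with the last morphisms. -/
lemma exists_hom_fromDisk {X : SigmaSeq S n} (hX : IsComplex X.seq)
    (hδ : X.seq.map' n (n + 1) ≫ X.δ = 0) {j : ℕ} (hj : j + 1 ≤ n + 1) {N : C}
    (g : N ⟶ X.seq.obj' j) : ∃ f : (diskSeq S n j N).Hom X, f.hom = fromDisk hX hj g := by
  refine ⟨⟨fromDisk hX hj g, ?_⟩, rfl⟩
  change (0 : _ ⟶ _) ≫ _ = _
  rw [zero_comp]
  by_cases h : InDisk j (n + 1)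
  · obtain rfl : j = n := by simp only [InDisk] at h; omega
    rw [app', fromDisk_app _ _ _ (by exact h), Category.assoc, Category.assoc]
    erw [hδ]
    rw [comp_zero, comp_zero]
  · rw [(isZero_disk_obj (m := n + 1) (a := ⟨n + 1, by omega⟩) h).eq_of_src
      (app' (fromDisk hX hj g) (n + 1)) 0, zero_comp]

/-- The class of endomorphisms of `Y` that factor through `(n+2)`-angles contains the
null-homotopic ones. -/
lemma IsAngulation.exists_factor (hΘ : IsAngulation Θ) {Y : SigmaSeq S n}
    (hY : IsComplex Y.seq) (hδ : Y.seq.map' n (n + 1) ≫ Y.δ = 0)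
    (hδ' : Y.δ ≫ S.map (Y.seq.map' 0 1) = 0) {u : Y.seq ⟶ Y.seq} (hu : u ∈ nullHomotopic hY hY) :
    ∃ T ∈ Θ, ∃ (s : Y.Hom T) (r : T.Hom Y), s.hom ≫ r.hom = u := by
  induction hu using AddSubgroup.closure_induction with
  | mem u hu =>
    obtain ⟨j, hj, h, rfl⟩ := hu
    obtain ⟨s, hs⟩ := exists_hom_toDisk hY hδ' hj h
    obtain ⟨r, hr⟩ := exists_hom_fromDisk hY hδ hj (𝟙 _)
    exact ⟨_, hΘ.diskSeq_mem _ j (by omega), s, r, by rw [hs, hr, nullMap]⟩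
  | zero =>
    obtain ⟨s, hs⟩ := exists_hom_toDisk hY hδ' (j := 0) (by omega) (0 : _ ⟶ Y.seq.obj' 0)
    obtain ⟨r, hr⟩ := exists_hom_fromDisk hY hδ (j := 0) (by omega) (0 : Y.seq.obj' 0 ⟶ _)
    refine ⟨_, hΘ.diskSeq_mem _ 0 (by omega), s, r, ?_⟩
    ext i
    rw [hs, hr, NatTrans.comp_app]
    by_cases hi : InDisk 0 i.val
    · rw [toDisk_app _ _ _ hi, zero_comp, comp_zero, zero_comp]
      rfl
    · rw [(isZero_disk_obj (m := n + 1) hi).eq_of_tgt ((toDisk hY _ _).app i) 0, zero_comp]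
      simp
  | add a b _ _ ha hb =>
    obtain ⟨T, hT, s, r, h⟩ := ha
    obtain ⟨T', hT', s', r', h'⟩ := hb
    exact ⟨T.biprod T', hΘ.sum (T.isSum_biprod T') hT hT', SigmaSeq.biprodLift s s',
      SigmaSeq.biprodDesc r r', by rw [SigmaSeq.lift_desc_app, h, h']⟩
  | neg a _ ha =>
    obtain ⟨T, hT, s, r, h⟩ := ha
    refine ⟨T, hT, s, ⟨-r.hom, ?_⟩, by rw [Preadditive.comp_neg, h]⟩
    have := r.comm
    change T.δ ≫ S.map (-(app' r.hom 0)) = (-(app' r.hom (n + 1))) ≫ Y.δ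
    rw [S.map_neg, Preadditive.comp_neg, Preadditive.neg_comp, this]

/-- A sequence which is a retract of an `(n+2)`-angle up to homotopy is an `(n+2)`-angle. -/
lemma IsAngulation.of_homotopy_retract (hΘ : IsAngulation Θ) (hC : IsKrullSchmidt C)
    {X Y : SigmaSeq S n} (hY : IsComplex Y.seq) (hδ : Y.seq.map' n (n + 1) ≫ Y.δ = 0)
    (hδ' : Y.δ ≫ S.map (Y.seq.map' 0 1) = 0) (s : Y.Hom X) (r : X.Hom Y)
    (h : 𝟙 _ - s.hom ≫ r.hom ∈ nullHomotopic hY hY) (hX : X ∈ Θ) : Y ∈ Θ := by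
  -- The homotopy factors through an angle `T`, which makes `Y` a strict retract of the direct sum
  -- of `X` and `T`.
  obtain ⟨T, hT, s', r', h'⟩ := hΘ.exists_factor hY hδ hδ' h
  refine hΘ.of_retract hC (SigmaSeq.biprodLift s s') (SigmaSeq.biprodDesc r r') ?_
    (hΘ.sum (X.isSum_biprod T) hX hT)
  rw [SigmaSeq.lift_desc_app, h']
  abel

end Closure

/-! ### Appending one morphism to a sequence, as needed for rotations. -/

section Snoc

variable {C : Type u} [Category.{v} C] {n : ℕ} (F : ComposableArrows C n) {Z : C} (f : F.right ⟶ Z)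

open Classical in
/-- The objects of the sequence `F` followed by `Z`. -/
noncomputable def snocObj (Z : C) (i : Fin (n + 2)) : C :=
  if h : i.val ≤ n then F.obj ⟨i.val, by omega⟩ else Z

/-- The objects of `snocObj` other than the last one. -/
noncomputable def snocIso (Z : C) {i : Fin (n + 2)} (h : i.val ≤ n) :
    snocObj F Z i ≅ F.obj ⟨i.val, by omega⟩ := eqToIso (dif_pos h)

/-- The last object of `snocObj`. -/
noncomputable def snocIsoLast (Z : C) {i : Fin (n + 2)} (h : ¬i.val ≤ n) :
    snocObj F Z i ≅ Z := eqToIso (dif_neg h)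

open Classical in
/-- The sequence `F` followed by the morphism `f`. -/
noncomputable def snoc : ComposableArrows C (n + 1) where
  obj := snocObj F Z
  map {a b} g :=
    if hb : b.val ≤ n then
      (snocIso F Z (i := a) (le_trans (leOfHom g) hb)).hom ≫
        F.map (homOfLE (Fin.mk_le_mk.2 (leOfHom g))) ≫ (snocIso F Z hb).inv
    else if ha : a.val ≤ n then
      (snocIso F Z ha).hom ≫ F.map (homOfLE (Fin.mk_le_mk.2 ha)) ≫ f ≫ (snocIsoLast F Z hb).inv
    else (snocIsoLast F Z ha).hom ≫ (snocIsoLast F Z hb).inv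
  map_id a := by
    by_cases ha : a.val ≤ n
    · rw [dif_pos ha]
      erw [F.map_id, Category.id_comp]
      exact Iso.hom_inv_id _
    · rw [dif_neg ha, dif_neg ha, Iso.hom_inv_id]
  map_comp {a b c} g h := by
    have h₁ : a.val ≤ b.val := leOfHom g
    have h₂ : b.val ≤ c.val := leOfHom h
    by_cases hc : c.val ≤ n
    · have hb : b.val ≤ n := by omega
      rw [dif_pos hc, dif_pos hb, dif_pos hc]
      simp only [Category.assoc, Iso.inv_hom_id_assoc]
      rw [← F.map_comp_assoc]
      rfl
    · rw [dif_neg hc]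
      by_cases hb : b.val ≤ n
      · have ha : a.val ≤ n := by omega
        rw [dif_pos ha, dif_pos hb, dif_neg hc, dif_pos hb]
        simp only [Category.assoc, Iso.inv_hom_id_assoc]
        rw [← F.map_comp_assoc]
        rfl
      · by_cases ha : a.val ≤ n
        · rw [dif_pos ha, dif_neg hb, dif_pos ha, dif_neg hc, dif_neg hb]
          simp
        · rw [dif_neg ha, dif_neg hb, dif_neg ha, dif_neg hc, dif_neg hb]
          simp

lemma snoc_map {a b : Fin (n + 2)} (g : a ⟶ b) (ha : a.val ≤ n) (hb : b.val ≤ n) :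
    (snoc F f).map g = (snocIso F Z ha).hom ≫ F.map (homOfLE (Fin.mk_le_mk.2 (leOfHom g))) ≫
      (snocIso F Z hb).inv := dif_pos hb

lemma snoc_map_last {a b : Fin (n + 2)} (g : a ⟶ b) (ha : a.val ≤ n) (hb : ¬b.val ≤ n) :
    (snoc F f).map g = (snocIso F Z ha).hom ≫ F.map (homOfLE (Fin.mk_le_mk.2 ha)) ≫ f ≫
      (snocIsoLast F Z hb).inv := (dif_neg hb).trans (dif_pos ha)

end Snoc

/-! ### Long exact `Hom` sequences of an angle. -/

section Exactness

variable {C : Type u} [Category.{v} C] [Preadditive C] {S : C ⥤ C} {n : ℕ}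

/-- Every sequence has a left rotation. -/
lemma SigmaSeq.exists_leftRotation (X : SigmaSeq S n) :
    ∃ Y : SigmaSeq S n, Nonempty (X.LeftRotation Y) := by
  have hl : ¬ (n + 1 ≤ n) := by omega
  let e : ∀ i : Fin (n + 1), X.seq.δ₀.obj i ≅ (snoc X.seq.δ₀ X.δ).δlast.obj i := fun i =>
    (snocIso X.seq.δ₀ (S.obj X.seq.left) (i := i.castSucc) (by simp; omega)).symm
  let e' : X.seq.δ₀ ≅ (snoc X.seq.δ₀ X.δ).δlast := NatIso.ofComponents e fun {a b} f => by
    have := snoc_map X.seq.δ₀ X.δ ((Fin.castSuccFunctor (n + 1)).map f)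
      (by simp; omega) (by simp; omega)
    change _ = _ ≫ (snoc X.seq.δ₀ X.δ).map ((Fin.castSuccFunctor (n + 1)).map f)
    rw [this]
    exact (Iso.inv_hom_id_assoc _ _).symm
  let l := snocIsoLast X.seq.δ₀ (S.obj X.seq.left) (i := ⟨n + 1, by omega⟩) hl
  refine ⟨⟨snoc X.seq.δ₀ X.δ, l.hom ≫ ((-1 : ℤ) ^ n •
    (S.map (X.seq.map' 0 1) ≫ S.map (app' e'.hom 0)))⟩, ⟨e', l.symm, ?_, ?_⟩⟩
  · have := snoc_map_last X.seq.δ₀ X.δ (a := ⟨n, by omega⟩) (b := ⟨n + 1, by omega⟩)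
      (homOfLE (by simp)) le_rfl hl
    have h₂ : X.seq.δ₀.map (homOfLE (Fin.mk_le_mk.2 le_rfl)) = 𝟙 (X.seq.δ₀.obj' n) :=
      X.seq.δ₀.map_id _
    rw [h₂, Category.id_comp] at this
    exact ((congrArg (fun t => app' e'.hom n ≫ t) this).trans (Iso.inv_hom_id_assoc _ _)).symm
  · exact Iso.inv_hom_id_assoc _ _

namespace IsAngulation

variable {Θ : Set (SigmaSeq S n)} (hΘ : IsAngulation Θ)

include hΘ

/-- Unpacks a rotation degree by degree, so that exactness at one position can be carried to the
next one by induction. -/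
lemma exists_rotation {X : SigmaSeq S n} (hX : X ∈ Θ) :
    ∃ Y ∈ Θ, ∃ (e : ∀ i : ℕ, ∀ hi : i ≤ n, X.seq.obj' (i + 1) ≅ Y.seq.obj' i)
      (l : S.obj X.seq.left ≅ Y.seq.right),
      (∀ (i : ℕ) (hi : i + 1 ≤ n), X.seq.map' (i + 1) (i + 2) ≫ (e (i + 1) hi).hom =
        (e i (by omega)).hom ≫ Y.seq.map' i (i + 1)) ∧
      X.δ ≫ l.hom = (e n le_rfl).hom ≫ Y.seq.map' n (n + 1) ∧
      l.hom ≫ Y.δ =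
        (-1 : ℤ) ^ n • S.map (X.seq.map' 0 1 ≫ (e 0 (Nat.zero_le _)).hom) := by
  obtain ⟨Y, ⟨ρ⟩⟩ := X.exists_leftRotation
  refine ⟨Y, (hΘ.rotate_iff ρ).1 hX, fun i hi => ρ.iso.app ⟨i, by omega⟩, ρ.isoLast,
    fun i hi => ?_, ρ.comm, ?_⟩
  · exact ComposableArrows.naturality' ρ.iso.hom i (i + 1)
  · rw [S.map_comp]
    exact ρ.comm_δ

variable [HasFiniteBiproducts C] [S.Additive] (hn : 1 ≤ n)

include hn

/-- The trivial angle on `X₀` maps to `X` with the identity and the first differential as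
components. Its term in degree `2` is zero, so the first two differentials of `X` compose to zero;
rotation handles the other positions. -/
lemma isComplex {X : SigmaSeq S n} (hX : X ∈ Θ) : IsComplex X.seq := by
  intro i
  induction i generalizing X with
  | zero =>
    intro _
    have h₀ : InDisk 0 (0 : ℕ) := ⟨le_rfl, by omega⟩
    have h₁ : InDisk 0 1 := ⟨by omega, le_rfl⟩
    obtain ⟨φ, hφ₀, hφ₁, -⟩ := hΘ.exists_hom (hΘ.diskSeq_mem (X.seq.obj' 0) 0 (by omega)) hX
      (diskIso (a := ⟨0, by omega⟩) h₀ _).hom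
      ((diskIso (a := ⟨1, by omega⟩) h₁ _).hom ≫ X.seq.map' 0 1) (by
        rw [ComposableArrows.map', disk_map _ (by exact h₀) (by exact h₁)]
        simp only [Category.assoc, Iso.inv_hom_id_assoc])
    have := ComposableArrows.naturality' φ.hom 1 2
    rw [hφ₁, (isZero_disk_obj (m := n + 1) (a := ⟨2, by omega⟩)
      (by simp [InDisk])).eq_of_src (app' φ.hom 2) 0, comp_zero, Category.assoc] at this
    rw [← cancel_epi (diskIso (m := n + 1) (a := ⟨1, by omega⟩) h₁ (X.seq.obj' 0)).hom,
      ← this, comp_zero]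
  | succ i ih =>
    intro hi
    obtain ⟨Y, hY, e, l, h₁, h₂, h₃⟩ := hΘ.exists_rotation hX
    rw [← cancel_mono (e (i + 2) (by omega)).hom, Category.assoc, h₁ (i + 1) (by omega),
      ← Category.assoc, h₁ i (by omega), Category.assoc, ih hY (by omega), comp_zero, zero_comp]

lemma comp_δ {X : SigmaSeq S n} (hX : X ∈ Θ) : X.seq.map' n (n + 1) ≫ X.δ = 0 := by
  obtain ⟨k, rfl⟩ : ∃ k, n = k + 1 := ⟨n - 1, by omega⟩
  obtain ⟨Y, hY, e, l, h₁, h₂, h₃⟩ := hΘ.exists_rotation hX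
  rw [← cancel_mono l.hom, Category.assoc, h₂, ← Category.assoc, h₁ k le_rfl, Category.assoc,
    hΘ.isComplex hn hY k le_rfl, comp_zero, zero_comp]

lemma δ_comp {X : SigmaSeq S n} (hX : X ∈ Θ) : X.δ ≫ S.map (X.seq.map' 0 1) = 0 := by
  obtain ⟨Y, hY, e, l, h₁, h₂, h₃⟩ := hΘ.exists_rotation hX
  have h₄ : X.δ ≫ l.hom ≫ Y.δ = 0 := by
    rw [reassoc_of% h₂, hΘ.comp_δ hn hY, comp_zero]
  rw [h₃, Preadditive.comp_zsmul] at h₄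
  rw [← cancel_mono (S.map (e 0 (Nat.zero_le _)).hom), zero_comp, Category.assoc, ← S.map_comp]
  rcases neg_one_pow_eq_or ℤ n with h | h
  · rwa [h, one_zsmul] at h₄
  · rwa [h, neg_one_zsmul, neg_eq_zero] at h₄

/-- Exactness of `Hom(-, T)` at `Xᵢ₊₁`. -/
lemma desc (i : ℕ) : ∀ {X : SigmaSeq S n} (_ : X ∈ Θ) (_ : i + 2 ≤ n + 1) {T : C}
    (g : X.seq.obj' (i + 1) ⟶ T), X.seq.map' i (i + 1) ≫ g = 0 →
      ∃ h : X.seq.obj' (i + 2) ⟶ T, g = X.seq.map' (i + 1) (i + 2) ≫ h := by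
  induction i with
  | zero =>
    intro X hX _ T g hg
    have h₁ : InDisk 1 1 := ⟨le_rfl, by omega⟩
    have h₂ : InDisk 1 2 := ⟨by omega, le_rfl⟩
    -- The pair `(0, g)` extends to a morphism into the disk at `1` on `T`, whose component in
    -- degree `2` is the factorization.
    obtain ⟨φ, hφ₀, hφ₁, -⟩ := hΘ.exists_hom hX (hΘ.diskSeq_mem T 1 hn)
      0 (g ≫ (diskIso (a := ⟨1, by omega⟩) h₁ _).inv) (by
        rw [← Category.assoc]
        erw [hg]
        rw [zero_comp, zero_comp])
    refine ⟨app' φ.hom 2 ≫ (diskIso (a := ⟨2, by omega⟩) h₂ _).hom, ?_⟩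
    rw [← Category.assoc, ComposableArrows.naturality' φ.hom 1 2, hφ₁, ComposableArrows.map',
      disk_map _ (by exact h₁) (by exact h₂)]
    simp only [Category.assoc, Iso.inv_hom_id, Iso.inv_hom_id_assoc, Category.comp_id]
  | succ i ih =>
    intro X hX hi T g hg
    obtain ⟨Y, hY, e, l, h₁, h₂, h₃⟩ := hΘ.exists_rotation hX
    obtain ⟨h, hh⟩ := ih hY (by omega) ((e (i + 1) (by omega)).inv ≫ g) (by
      rw [← cancel_epi (e i (by omega)).hom, ← Category.assoc, ← h₁ i (by omega), Category.assoc,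
        Iso.hom_inv_id_assoc, hg, comp_zero])
    refine ⟨(e (i + 2) (by omega)).hom ≫ h, ?_⟩
    rw [← Category.assoc, h₁ (i + 1) (by omega), Category.assoc, ← hh, Iso.hom_inv_id_assoc]

/-- Exactness of `Hom(-, T)` at `Xₙ₊₁`. -/
lemma desc_last {X : SigmaSeq S n} (hX : X ∈ Θ) {T : C} (g : X.seq.obj' (n + 1) ⟶ T)
    (hg : X.seq.map' n (n + 1) ≫ g = 0) : ∃ h : S.obj X.seq.left ⟶ T, g = X.δ ≫ h := by
  obtain ⟨k, rfl⟩ : ∃ k, n = k + 1 := ⟨n - 1, by omega⟩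
  obtain ⟨Y, hY, e, l, h₁, h₂, h₃⟩ := hΘ.exists_rotation hX
  obtain ⟨h, hh⟩ := hΘ.desc hn k hY (by omega) ((e (k + 1) (by omega)).inv ≫ g) (by
      rw [← cancel_epi (e k (by omega)).hom, ← Category.assoc, ← h₁ k (by omega), Category.assoc,
        Iso.hom_inv_id_assoc, hg, comp_zero])
  refine ⟨l.hom ≫ h, ?_⟩
  rw [← Category.assoc, h₂, Category.assoc, ← hh, Iso.hom_inv_id_assoc]

/-- Exactness of `Hom(-, T)` at `X₀`. -/
lemma desc_zero [S.IsEquivalence] {X : SigmaSeq S n} (hX : X ∈ Θ) {T : C}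
    (g : X.seq.obj' 0 ⟶ T) (hg : X.δ ≫ S.map g = 0) :
    ∃ h : X.seq.obj' 1 ⟶ T, g = X.seq.map' 0 1 ≫ h := by
  -- Rotation puts `S X₀` in the last position, where `desc_last` applies. The factorization
  -- descends along the fully faithful `S`, up to the sign of the rotation.
  obtain ⟨Y, hY, e, l, h₁, h₂, h₃⟩ := hΘ.exists_rotation hX
  obtain ⟨h, hh⟩ := hΘ.desc_last hn hY (l.inv ≫ S.map g) (by
    rw [← cancel_epi (e n le_rfl).hom, ← Category.assoc, ← h₂, Category.assoc,
      Iso.hom_inv_id_assoc, hg, comp_zero])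
  obtain ⟨h', rfl⟩ := S.map_surjective h
  refine ⟨(-1 : ℤ) ^ n • ((e 0 (Nat.zero_le _)).hom ≫ h'), S.map_injective ?_⟩
  rw [← cancel_epi l.inv, hh, ← cancel_epi l.hom, Iso.hom_inv_id_assoc, reassoc_of% h₃,
    Preadditive.zsmul_comp, Preadditive.comp_zsmul, S.map_zsmul, ← S.map_comp, Category.assoc]

/-- Exactness of `Hom(T, -)` at `S X₀`. -/
lemma lift_zero [S.IsEquivalence] {X : SigmaSeq S n} (hX : X ∈ Θ) {T : C}
    (g : T ⟶ S.obj X.seq.left) (hg : g ≫ S.map (X.seq.map' 0 1) = 0) :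
    ∃ h : T ⟶ X.seq.right, g = h ≫ X.δ := by
  let t := S.objObjPreimageIso T
  obtain ⟨g', hg'⟩ := S.map_surjective (t.hom ≫ g)
  have h₀ : InDisk 0 (0 : ℕ) := ⟨le_rfl, by omega⟩
  have hd₁ : InDisk 0 1 := ⟨by omega, le_rfl⟩
  -- With `T ≅ S T'`, the rotated trivial angle on `T'` is `T' ⟶ 0 ⟶ ⋯ ⟶ S T' ⟶ S T'`, ending in the
  -- identity up to sign. A morphism from it to `X` that begins with `(g', 0)` has the required lift
  -- as component in degree `n + 1`.
  obtain ⟨Y, hY, e, l, h₁, h₂, h₃⟩ :=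
    hΘ.exists_rotation (hΘ.diskSeq_mem (S.objPreimage T) 0 (by omega))
  obtain ⟨φ, hφ, -⟩ := hΘ.exists_hom hY hX ((e 0 (Nat.zero_le _)).inv ≫
      (diskIso (a := ⟨1, by omega⟩) hd₁ _).hom ≫ g') 0 (by
    have : g' ≫ X.seq.map' 0 1 = 0 := S.map_injective (by
      rw [S.map_comp, hg', Category.assoc, hg, comp_zero, S.map_zero])
    rw [comp_zero, Category.assoc, Category.assoc, this, comp_zero, comp_zero])
  have h₄ := φ.comm
  rw [hφ] at h₄
  have h₅ : l.hom ≫ app' φ.hom (n + 1) ≫ X.δ =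
      (-1 : ℤ) ^ n • S.map ((diskIso (a := ⟨0, by omega⟩) h₀ _).hom ≫ g') := by
    rw [← h₄, reassoc_of% h₃, Preadditive.zsmul_comp, ← S.map_comp, ComposableArrows.map',
      disk_map _ (by exact h₀) (by exact hd₁)]
    simp only [Category.assoc, Iso.hom_inv_id_assoc, Iso.inv_hom_id_assoc]
  refine ⟨(-1 : ℤ) ^ n • (t.inv ≫ S.map (diskIso (m := n + 1) (a := ⟨0, by omega⟩) h₀ _).inv ≫
    l.hom ≫ app' φ.hom (n + 1)), ?_⟩
  rw [Preadditive.zsmul_comp, Category.assoc, Category.assoc, Category.assoc, h₅,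
    Preadditive.comp_zsmul, Preadditive.comp_zsmul, smul_smul, ← pow_add, Even.neg_one_pow ⟨n, rfl⟩,
    one_smul, ← S.map_comp, Iso.inv_hom_id_assoc, hg', Iso.inv_hom_id_assoc]

/-- Exactness of `Hom(T, -)` at `Xᵢ₊₁`. -/
lemma lift [S.IsEquivalence] (i : ℕ) : ∀ {X : SigmaSeq S n} (_ : X ∈ Θ) (_ : i + 2 ≤ n + 1)
    {T : C} (g : T ⟶ X.seq.obj' (i + 1)), g ≫ X.seq.map' (i + 1) (i + 2) = 0 →
      ∃ h : T ⟶ X.seq.obj' i, g = h ≫ X.seq.map' i (i + 1) := by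
  induction i with
  | zero =>
    intro X hX _ T g hg
    obtain ⟨Y, hY, e, l, h₁, h₂, h₃⟩ := hΘ.exists_rotation hX
    obtain ⟨h, hh⟩ := hΘ.lift_zero hn hY (S.map (g ≫ (e 0 (by omega)).hom)) (by
      rw [← S.map_comp, Category.assoc, ← h₁ 0 (by omega), reassoc_of% hg, zero_comp, S.map_zero])
    obtain ⟨h', hh'⟩ := S.map_surjective (h ≫ l.inv)
    have h₄ : S.map (g ≫ (e 0 (by omega)).hom) =
        S.map ((-1 : ℤ) ^ n • (h' ≫ X.seq.map' 0 1 ≫ (e 0 (by omega)).hom)) := by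
      rw [S.map_zsmul, S.map_comp h', ← Preadditive.comp_zsmul, ← h₃, hh', Category.assoc,
        Iso.inv_hom_id_assoc, hh]
    refine ⟨(-1 : ℤ) ^ n • h', ?_⟩
    rw [← cancel_mono (e 0 (by omega)).hom, S.map_injective h₄, Preadditive.zsmul_comp,
      Preadditive.zsmul_comp, Category.assoc]
  | succ i ih =>
    intro X hX hi T g hg
    obtain ⟨Y, hY, e, l, h₁, h₂, h₃⟩ := hΘ.exists_rotation hX
    obtain ⟨h, hh⟩ := ih hY (by omega) (g ≫ (e (i + 1) (by omega)).hom) (by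
      rw [Category.assoc, ← h₁ (i + 1) (by omega), reassoc_of% hg, zero_comp])
    refine ⟨h ≫ (e i (by omega)).inv, ?_⟩
    rw [← cancel_mono (e (i + 1) (by omega)).hom, hh, Category.assoc, Category.assoc,
      h₁ i (by omega), Iso.inv_hom_id_assoc]

/-- Exactness of `Hom(T, -)` at `Xₙ₊₁`. -/
lemma lift_last [S.IsEquivalence] {X : SigmaSeq S n} (hX : X ∈ Θ) {T : C}
    (g : T ⟶ X.seq.obj' (n + 1)) (hg : g ≫ X.δ = 0) :
    ∃ h : T ⟶ X.seq.obj' n, g = h ≫ X.seq.map' n (n + 1) := by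
  obtain ⟨k, rfl⟩ : ∃ k, n = k + 1 := ⟨n - 1, by omega⟩
  obtain ⟨Y, hY, e, l, h₁, h₂, h₃⟩ := hΘ.exists_rotation hX
  obtain ⟨h, hh⟩ := hΘ.lift hn k hY (by omega) (g ≫ (e (k + 1) (by omega)).hom) (by
    rw [Category.assoc, ← h₂, reassoc_of% hg, zero_comp])
  refine ⟨h ≫ (e k (by omega)).inv, ?_⟩
  rw [← cancel_mono (e (k + 1) (by omega)).hom, hh, Category.assoc, Category.assoc,
    h₁ k (by omega), Iso.inv_hom_id_assoc]

end IsAngulation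

end Exactness

/-! ### Invariance of conflations under weak isomorphisms. -/

section WeakIso

variable {C : Type u} [Category.{v} C] [Preadditive C] [HasFiniteBiproducts C] {S : C ⥤ C}
  [S.IsEquivalence] [S.Additive] {n : ℕ} {Θ : Set (SigmaSeq S n)} {A : ObjectProperty C}

namespace IsAngulation

variable (hΘ : IsAngulation Θ) (hn : 1 ≤ n)

include hΘ hn

/-- An `(n+2)`-angle with terms in `A` is `n`-exact in `A`. -/
lemma isNExactIn (hvan : ∀ {X Y : C}, A X → A Y → ∀ f : S.obj X ⟶ Y, f = 0) {X : SigmaSeq S n}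
    (hX : X ∈ Θ) (hXA : ∀ i, A (X.seq.obj i)) : IsNExactIn A X.seq where
  mem := hXA
  isComplex := hΘ.isComplex hn hX
  desc i hi _ _ g hg := hΘ.desc hn i hX hi g hg
  -- In both `desc_last` and `lift_zero` the morphism factors through one from the image under `S`
  -- of an object of `A` to an object of `A`.
  desc_last hT g hg := by
    obtain ⟨h, rfl⟩ := hΘ.desc_last hn hX g hg
    rw [hvan (hXA _) hT h, comp_zero]
  lift i hi _ _ g hg := hΘ.lift hn i hX hi g hg
  lift_zero hT g hg := by
    obtain ⟨h, hh⟩ := hΘ.lift_zero hn hX (S.map g) (by rw [← S.map_comp, hg, S.map_zero])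
    apply S.map_injective
    rw [hh, hvan hT (hXA _) h, zero_comp, S.map_zero]

-- At the ends a null-homotopic morphism factors through a differential, so the connecting morphism
-- does not see it. This lets `δ` be transported along homotopy equivalences.
omit [S.IsEquivalence] in
lemma nullHomotopic_comp_δ {X : SigmaSeq S n} (hX : X ∈ Θ) {Z : ComposableArrows C (n + 1)}
    {hZ : IsComplex Z} {hX' : IsComplex X.seq} {u : Z ⟶ X.seq} (hu : u ∈ nullHomotopic hZ hX') :
    app' u (n + 1) le_rfl ≫ X.δ = 0 := by
  obtain ⟨h, hh⟩ := nullHomotopic.app_last hZ hX' hu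
  rw [hh, Category.assoc, hΘ.comp_δ hn hX, comp_zero]

omit [S.IsEquivalence] in
lemma δ_comp_nullHomotopic {X : SigmaSeq S n} (hX : X ∈ Θ) {Z : ComposableArrows C (n + 1)}
    {hZ : IsComplex Z} {hX' : IsComplex X.seq} {u : X.seq ⟶ Z} (hu : u ∈ nullHomotopic hX' hZ) :
    X.δ ≫ S.map (app' u 0 (Nat.zero_le _)) = 0 := by
  obtain ⟨h, hh⟩ := nullHomotopic.app_zero hX' hZ (by omega) hu
  rw [hh, S.map_comp, ← Category.assoc, hΘ.δ_comp hn hX, zero_comp]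

omit [S.IsEquivalence] in
/-- A complex which is homotopy equivalent to an `(n+2)`-angle can be completed to an
`(n+2)`-angle. -/
lemma exists_of_homotopyEquiv (hC : IsKrullSchmidt C) {X : SigmaSeq S n} (hX : X ∈ Θ)
    {Y : ComposableArrows C (n + 1)} {hX' : IsComplex X.seq} (hY : IsComplex Y) (f : X.seq ⟶ Y)
    (g : Y ⟶ X.seq) (hfg : 𝟙 _ - f ≫ g ∈ nullHomotopic hX' hX')
    (hgf : 𝟙 _ - g ≫ f ∈ nullHomotopic hY hY) :
    ∃ δ : Y.right ⟶ S.obj Y.left, SigmaSeq.mk Y δ ∈ Θ := by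
  have h₁ : app' f (n + 1) le_rfl ≫ app' g (n + 1) le_rfl ≫ X.δ = X.δ := by
    have h : (𝟙 _ - app' f (n + 1) le_rfl ≫ app' g (n + 1) le_rfl) ≫ X.δ = 0 :=
      hΘ.nullHomotopic_comp_δ hn hX hfg
    rw [Preadditive.sub_comp, Category.id_comp, sub_eq_zero, Category.assoc] at h
    exact h.symm
  have h₂ : X.δ ≫ S.map (app' f 0 (Nat.zero_le _)) ≫ S.map (app' g 0 (Nat.zero_le _)) = X.δ := by
    have h : X.δ ≫ S.map (𝟙 _ - app' f 0 (Nat.zero_le _) ≫ app' g 0 (Nat.zero_le _)) = 0 :=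
      hΘ.δ_comp_nullHomotopic hn hX hfg
    rw [S.map_sub, S.map_id, Preadditive.comp_sub, Category.comp_id, sub_eq_zero, S.map_comp] at h
    exact h.symm
  -- By `h₁` and `h₂`, both `f` and `g` are compatible with this transported last morphism, so `Y`
  -- becomes a homotopy retract of `X`.
  let δ : Y.right ⟶ S.obj Y.left := app' g (n + 1) le_rfl ≫ X.δ ≫ S.map (app' f 0 (Nat.zero_le _))
  let s : (SigmaSeq.mk Y δ).Hom X :=
    { hom := g
      comm := by
        change (app' g (n + 1) le_rfl ≫ X.δ ≫ S.map (app' f 0 (Nat.zero_le _))) ≫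
          S.map (app' g 0 (Nat.zero_le _)) = _
        rw [Category.assoc, Category.assoc, h₂] }
  let r : X.Hom (SigmaSeq.mk Y δ) :=
    { hom := f
      comm := by
        change _ = app' f (n + 1) le_rfl ≫ app' g (n + 1) le_rfl ≫ X.δ ≫
          S.map (app' f 0 (Nat.zero_le _))
        rw [reassoc_of% h₁] }
  refine ⟨δ, hΘ.of_homotopy_retract hC (Y := SigmaSeq.mk Y δ) hY ?_ ?_ s r hgf hX⟩
  · change Y.map' n (n + 1) ≫ app' g (n + 1) le_rfl ≫ X.δ ≫ S.map (app' f 0 (Nat.zero_le _)) = 0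
    rw [← Category.assoc, ComposableArrows.naturality' g n (n + 1), Category.assoc,
      ← Category.assoc (X.seq.map' n (n + 1)), hΘ.comp_δ hn hX, zero_comp, comp_zero]
  · change (app' g (n + 1) le_rfl ≫ X.δ ≫ S.map (app' f 0 (Nat.zero_le _))) ≫ S.map (Y.map' 0 1) = 0
    rw [Category.assoc, Category.assoc, ← S.map_comp, ← ComposableArrows.naturality' f 0 1,
      S.map_comp, ← Category.assoc X.δ, hΘ.δ_comp hn hX, zero_comp, comp_zero]

/-- A morphism between the ends of two `(n+2)`-angles extends to a morphism of sequences. -/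
lemma exists_hom_of_ends {X Y : SigmaSeq S n} (hX : X ∈ Θ) (hY : Y ∈ Θ)
    (a : X.seq.left ⟶ Y.seq.left) (c : X.seq.right ⟶ Y.seq.right)
    (hac : X.δ ≫ S.map a = c ≫ Y.δ) :
    ∃ φ : X.seq ⟶ Y.seq, app' φ 0 (Nat.zero_le _) = a ∧ app' φ (n + 1) le_rfl = c := by
  obtain ⟨b, hb⟩ := hΘ.desc_zero hn hX (a ≫ Y.seq.map' 0 1) (by
    rw [S.map_comp, reassoc_of% hac, hΘ.δ_comp hn hY, comp_zero])
  obtain ⟨ψ, hψ₀, -, -⟩ := hΘ.exists_hom hX hY a b hb.symm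
  have hψ := ψ.comm
  rw [hψ₀, hac] at hψ
  -- The axiom controls the left end only. The error at the right end is killed by `Y.δ`, so a
  -- homotopy in degrees `n` and `n + 1` removes it; degree `0` is untouched since `n ≥ 1`.
  obtain ⟨h, hh⟩ := hΘ.lift_last hn hY (app' ψ.hom (n + 1) le_rfl - c) (by
    rw [Preadditive.sub_comp, ← hψ, sub_self])
  have hX' := hΘ.isComplex hn hX
  have hY' := hΘ.isComplex hn hY
  refine ⟨ψ.hom - nullMap hX' hY' le_rfl h, ?_, ?_⟩
  · have : (nullMap hX' hY' le_rfl h).app ⟨0, by omega⟩ = 0 :=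
      nullMap_app_of_not _ _ _ _ (by simp only [InDisk]; omega)
    change app' ψ.hom 0 (Nat.zero_le _) - (nullMap hX' hY' le_rfl h).app ⟨0, Nat.succ_pos _⟩ = a
    rw [this, sub_zero, hψ₀]
  · change app' ψ.hom (n + 1) le_rfl - app' (nullMap hX' hY' le_rfl h) (n + 1) le_rfl = c
    rw [nullMap_app_right, ← hh, sub_sub_cancel]

variable (hvan : ∀ {X Y : C}, A X → A Y → ∀ f : S.obj X ⟶ Y, f = 0) (hC : IsKrullSchmidt C)

include hvan hC

/-- An `n`-exact sequence with two consecutive terms as in an `(n+2)`-angle with terms in `A` can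
be completed to an `(n+2)`-angle. -/
lemma exists_of_consecutive_iso {X : SigmaSeq S n} (hX : X ∈ Θ) (hXA : ∀ i, A (X.seq.obj i))
    {Y : ComposableArrows C (n + 1)} (hY : IsNExactIn A Y) (k : ℕ) (hk : k ≤ n)
    (a : X.seq.obj' k ≅ Y.obj' k) (b : X.seq.obj' (k + 1) ≅ Y.obj' (k + 1))
    (hab : X.seq.map' k (k + 1) ≫ b.hom = a.hom ≫ Y.map' k (k + 1)) :
    ∃ δ : Y.right ⟶ S.obj Y.left, SigmaSeq.mk Y δ ∈ Θ := by
  have hX' := hΘ.isNExactIn hn hvan hX hXA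
  -- The comparison morphisms in both directions compose to endomorphisms with identity component at
  -- `k`, hence homotopic to the identity.
  obtain ⟨f, hf, -⟩ := exists_hom_extending hX' hY k hk a.hom b.hom hab
  obtain ⟨g, hg, -⟩ := exists_hom_extending hY hX' k hk a.inv b.inv (by
    rw [← cancel_epi a.hom, ← reassoc_of% hab, Iso.hom_inv_id, Category.comp_id,
      Iso.hom_inv_id_assoc])
  refine hΘ.exists_of_homotopyEquiv hn hC hX (hX' := hX'.isComplex) hY.isComplex f g
    (mem_nullHomotopic hX' hX' _ k (by omega) ?_) (mem_nullHomotopic hY hY _ k (by omega) ?_)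
  · change 𝟙 _ - app' f k (by omega) ≫ app' g k (by omega) = 0
    rw [hf, hg, Iso.hom_inv_id, sub_self]
  · change 𝟙 _ - app' g k (by omega) ≫ app' f k (by omega) = 0
    rw [hf, hg, Iso.inv_hom_id, sub_self]

variable (hext : IsExtensionClosed Θ A)

include hext

/-- An `n`-exact sequence to which an `(n+2)`-angle with terms in `A` maps isomorphically at both
ends can be completed to an `(n+2)`-angle. -/
lemma exists_of_ends_iso_target {X : SigmaSeq S n} (hX : X ∈ Θ) (hXA : ∀ i, A (X.seq.obj i))
    {Y : ComposableArrows C (n + 1)} (hY : IsNExactIn A Y) (f : X.seq ⟶ Y)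
    [IsIso (app' f 0 (Nat.zero_le _))]
    [IsIso (app' f (n + 1) le_rfl)] : ∃ δ : Y.right ⟶ S.obj Y.left, SigmaSeq.mk Y δ ∈ Θ := by
  have hX' := hΘ.isNExactIn hn hvan hX hXA
  -- A homotopy inverse needs `Yₙ ⟶ Yₙ₊₁ ≅ Xₙ₊₁` to lift to `Xₙ`. The obstruction is the composite
  -- with `X.δ`; it is realised here, up to the isomorphism at the left end, by an angle `E` in `A`.
  obtain ⟨E, hE, hEA, a, c, hac⟩ := hext
    (Y.map' n (n + 1) ≫ inv (app' f (n + 1) le_rfl) ≫ X.δ ≫ S.map (app' f 0 (Nat.zero_le _)))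
      (hY.mem _) (hY.mem _)
  have hE' := hΘ.isNExactIn hn hvan hE hEA
  obtain ⟨φ, hφ₀, hφ₁⟩ := hΘ.exists_hom_of_ends hn hE hX (a.hom ≫ inv (app' f 0 (Nat.zero_le _)))
    (c.hom ≫ Y.map' n (n + 1) ≫ inv (app' f (n + 1) le_rfl)) (by
      rw [S.map_comp, reassoc_of% hac, ← S.map_comp, IsIso.hom_inv_id, S.map_id, Category.comp_id]
      simp only [Category.assoc])
  -- The right component of `φ ≫ f` factors through the last differential of `Y`, so one homotopy
  -- makes it zero. As the left component is the isomorphism `a`, the realised obstruction must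
  -- vanish.
  have hw : φ ≫ f ∈ nullHomotopic hE'.isComplex hY.isComplex := by
    rw [← sub_add_cancel (φ ≫ f) (nullMap hE'.isComplex hY.isComplex le_rfl c.hom)]
    refine AddSubgroup.add_mem _ (mem_nullHomotopic hE' hY _ (n + 1) le_rfl ?_)
      (nullMap_mem _ _ _ _)
    change app' φ (n + 1) le_rfl ≫ app' f (n + 1) le_rfl -
      app' (nullMap hE'.isComplex hY.isComplex le_rfl c.hom) (n + 1) le_rfl = 0
    rw [nullMap_app_right, hφ₁, Category.assoc, Category.assoc, IsIso.inv_hom_id,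
      Category.comp_id, sub_self]
  have h₀ : E.δ ≫ S.map (app' φ 0 (Nat.zero_le _) ≫ app' f 0 (Nat.zero_le _)) = 0 :=
    hΘ.δ_comp_nullHomotopic hn hE hw
  rw [hφ₀, Category.assoc, IsIso.inv_hom_id, Category.comp_id, hac] at h₀
  obtain ⟨h, hh⟩ := hΘ.lift_last hn hX (Y.map' n (n + 1) ≫ inv (app' f (n + 1) le_rfl)) (by
    rw [← cancel_mono (S.map (app' f 0 (Nat.zero_le _))), ← cancel_epi c.hom, zero_comp, comp_zero,
      ← h₀]
    simp only [Category.assoc])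
  obtain ⟨g, -, hg⟩ := exists_hom_extending hY hX' n le_rfl h (inv (app' f (n + 1) le_rfl)) hh
  refine hΘ.exists_of_homotopyEquiv hn hC hX (hX' := hX'.isComplex) hY.isComplex f g
    (mem_nullHomotopic hX' hX' _ (n + 1) le_rfl ?_) (mem_nullHomotopic hY hY _ (n + 1) le_rfl ?_)
  · change 𝟙 _ - app' f (n + 1) le_rfl ≫ app' g (n + 1) le_rfl = 0
    rw [hg, IsIso.hom_inv_id, sub_self]
  · change 𝟙 _ - app' g (n + 1) le_rfl ≫ app' f (n + 1) le_rfl = 0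
    rw [hg, IsIso.inv_hom_id, sub_self]

/-- An `n`-exact sequence which maps isomorphically at both ends to an `(n+2)`-angle with terms in
`A` can be completed to an `(n+2)`-angle. -/
lemma exists_of_ends_iso_source {Y : SigmaSeq S n} (hY : Y ∈ Θ) (hYA : ∀ i, A (Y.seq.obj i))
    {X : ComposableArrows C (n + 1)} (hX : IsNExactIn A X) (f : X ⟶ Y.seq)
    [IsIso (app' f 0 (Nat.zero_le _))]
    [IsIso (app' f (n + 1) le_rfl)] : ∃ δ : X.right ⟶ S.obj X.left, SigmaSeq.mk X δ ∈ Θ := by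
  have hY' := hΘ.isNExactIn hn hvan hY hYA
  -- Dually, the obstruction is `Yₙ₊₁ ⟶ S Y₀ ≅ S X₀ ⟶ S X₁`. The morphism `f ≫ φ` below is
  -- null-homotopic because its left component factors through the first differential of `X`.
  obtain ⟨E, hE, hEA, a, c, hac⟩ := hext (Y.δ ≫ S.map (inv (app' f 0 (Nat.zero_le _)) ≫ X.map' 0 1))
    (hX.mem _) (hYA _)
  have hE' := hΘ.isNExactIn hn hvan hE hEA
  obtain ⟨φ, hφ₀, hφ₁⟩ := hΘ.exists_hom_of_ends hn hY hE
    (inv (app' f 0 (Nat.zero_le _)) ≫ X.map' 0 1 ≫ a.inv) c.inv (by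
      rw [← cancel_mono (S.map a.hom), ← cancel_epi c.hom, Category.assoc, Category.assoc,
        Iso.hom_inv_id_assoc, hac, ← S.map_comp]
      simp only [Category.assoc, Iso.inv_hom_id, Category.comp_id])
  have h1 : 0 + 1 ≤ n + 1 := by omega
  have hw : f ≫ φ ∈ nullHomotopic hX.isComplex hE'.isComplex := by
    rw [← sub_add_cancel (f ≫ φ) (nullMap hX.isComplex hE'.isComplex (j := 0) h1 a.inv)]
    refine AddSubgroup.add_mem _ (mem_nullHomotopic hX hE' _ 0 (by omega) ?_)
      (nullMap_mem _ _ _ _)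
    change app' f 0 (Nat.zero_le _) ≫ app' φ 0 (Nat.zero_le _) -
      app' (nullMap hX.isComplex hE'.isComplex (j := 0) h1 a.inv) 0 (Nat.zero_le _) = 0
    rw [nullMap_app_left, hφ₀, IsIso.hom_inv_id_assoc, sub_self]
  have h₀ : (app' f (n + 1) le_rfl ≫ app' φ (n + 1) le_rfl) ≫ E.δ = 0 :=
    hΘ.nullHomotopic_comp_δ hn hE hw
  rw [hφ₁, Category.assoc, ← comp_zero (f := app' f (n + 1) le_rfl), cancel_epi] at h₀
  obtain ⟨h, hh⟩ := hΘ.desc_zero hn hY (inv (app' f 0 (Nat.zero_le _)) ≫ X.map' 0 1) (by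
    rw [← cancel_epi c.hom, ← hac, comp_zero, ← cancel_epi c.inv, reassoc_of% h₀, zero_comp,
      comp_zero])
  obtain ⟨g, hg, -⟩ := exists_hom_extending hY' hX 0 (by omega) (inv (app' f 0 (Nat.zero_le _))) h
    hh.symm
  refine hΘ.exists_of_homotopyEquiv hn hC hY (hX' := hY'.isComplex) hX.isComplex g f
    (mem_nullHomotopic hY' hY' _ 0 (by omega) ?_) (mem_nullHomotopic hX hX _ 0 (by omega) ?_)
  · change 𝟙 _ - app' g 0 (Nat.zero_le _) ≫ app' f 0 (Nat.zero_le _) = 0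
    rw [hg, IsIso.inv_hom_id, sub_self]
  · change 𝟙 _ - app' f 0 (Nat.zero_le _) ≫ app' g 0 (Nat.zero_le _) = 0
    rw [hg, IsIso.hom_inv_id, sub_self]

end IsAngulation

end WeakIso

/-! ### Morphisms into and out of a direct sum. -/

section DirectSum

variable {M : Type u} [Category.{v} M] [Preadditive M] {X Y Z : M} {i₁ : X ⟶ Z} {i₂ : Y ⟶ Z}

lemma IsDirectSum.hom_ext (h : IsDirectSum i₁ i₂) {T : M} {f g : Z ⟶ T} (h₁ : i₁ ≫ f = i₁ ≫ g)
    (h₂ : i₂ ≫ f = i₂ ≫ g) : f = g := by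
  obtain ⟨p₁, p₂, -, -, -, -, e⟩ := h
  rw [← Category.id_comp f, ← Category.id_comp g, ← e]
  simp only [Preadditive.add_comp, Category.assoc, h₁, h₂]

lemma IsDirectSum.exists_desc (h : IsDirectSum i₁ i₂) {T : M} (a : X ⟶ T) (b : Y ⟶ T) :
    ∃ f : Z ⟶ T, i₁ ≫ f = a ∧ i₂ ≫ f = b := by
  obtain ⟨p₁, p₂, e₁, e₂, e₃, e₄, -⟩ := h
  exact ⟨p₁ ≫ a + p₂ ≫ b, by simp [reassoc_of% e₁, reassoc_of% e₃],
    by simp [reassoc_of% e₂, reassoc_of% e₄]⟩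

lemma IsDirectSum.exists_eq (h : IsDirectSum i₁ i₂) {T : M} (g : T ⟶ Z) :
    ∃ (a : T ⟶ X) (b : T ⟶ Y), g = a ≫ i₁ + b ≫ i₂ := by
  obtain ⟨p₁, p₂, -, -, -, -, e⟩ := h
  refine ⟨g ≫ p₁, g ≫ p₂, ?_⟩
  rw [Category.assoc, Category.assoc, ← Preadditive.comp_add, e, Category.comp_id]

lemma IsDirectSum.eq_zero (h : IsDirectSum i₁ i₂) {T : M} {a : T ⟶ X} {b : T ⟶ Y}
    (hab : a ≫ i₁ + b ≫ i₂ = 0) : a = 0 ∧ b = 0 := by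
  obtain ⟨p₁, p₂, e₁, e₂, e₃, e₄, -⟩ := h
  constructor
  · simpa [e₁, e₄] using congrArg (· ≫ p₁) hab
  · simpa [e₂, e₃] using congrArg (· ≫ p₂) hab

end DirectSum

/-! ### Construction of mapping cones. -/

section ConeExists

variable {M : Type u} [Category.{v} M] [Preadditive M] [HasFiniteBiproducts M] {n : ℕ}

open scoped ZeroObject in
/-- The `i`-th object of `F`, or zero if `i` is out of range. -/
noncomputable def objOrZero (F : ComposableArrows M n) (i : ℕ) : M :=
  if h : i ≤ n then F.obj' i h else 0

/-- `objOrZero` in the range of `F`. -/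
noncomputable def objOrZeroIso (F : ComposableArrows M n) {i : ℕ} (h : i ≤ n) :
    objOrZero F i ≅ F.obj' i h := eqToIso (dif_pos h)

lemma isZero_objOrZero (F : ComposableArrows M n) {i : ℕ} (h : ¬i ≤ n) :
    IsZero (objOrZero F i) := by
  unfold objOrZero
  rw [dif_neg h]
  exact isZero_zero M

open scoped ZeroObject in
/-- The objects `0, Y₀, Y₁, …`. -/
noncomputable def shiftObj (Y : ComposableArrows M n) : ℕ → M
  | 0 => 0
  | i + 1 => objOrZero Y i

/-- `shiftObj` in the range of `Y`. -/
noncomputable def shiftIso (Y : ComposableArrows M n) {i : ℕ} (h : i ≤ n) :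
    shiftObj Y (i + 1) ≅ Y.obj' i h := objOrZeroIso Y h

variable {X Y : ComposableArrows M n} (φ : X ⟶ Y)

/-- The differentials of `objOrZero`. -/
noncomputable def objOrZeroMap (X : ComposableArrows M n) (i : ℕ) :
    objOrZero X i ⟶ objOrZero X (i + 1) :=
  if h : i + 1 ≤ n then
    (objOrZeroIso X (i.le_succ.trans h)).hom ≫ X.map' i (i + 1) ≫ (objOrZeroIso X h).inv
  else 0

/-- The components of a morphism, extended by zero. -/
noncomputable def objOrZeroHom (i : ℕ) : objOrZero X i ⟶ shiftObj Y (i + 1) :=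
  if h : i ≤ n then (objOrZeroIso X h).hom ≫ app' φ i h ≫ (shiftIso Y h).inv else 0

/-- The differentials of `shiftObj`. -/
noncomputable def shiftMap (Y : ComposableArrows M n) : ∀ i, shiftObj Y i ⟶ shiftObj Y (i + 1)
  | 0 => 0
  | i + 1 => if h : i + 1 ≤ n then
      (shiftIso Y (i.le_succ.trans h)).hom ≫ Y.map' i (i + 1) ≫ (shiftIso Y h).inv
    else 0

/-- The differentials of the mapping cone. -/
noncomputable def coneMap (i : ℕ) :
    objOrZero X i ⊞ shiftObj Y i ⟶ objOrZero X (i + 1) ⊞ shiftObj Y (i + 1) :=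
  biprod.desc (biprod.lift (-objOrZeroMap X i) (objOrZeroHom φ i)) (biprod.lift 0 (shiftMap Y i))

variable (X Y) in
/-- The injections of `X` into the mapping cone. -/
noncomputable def coneInX (i : ℕ) (hi : i ≤ n) : X.obj' i ⟶ objOrZero X i ⊞ shiftObj Y i :=
  (objOrZeroIso X hi).inv ≫ biprod.inl

variable (X Y) in
/-- The injections of `Y` into the mapping cone. -/
noncomputable def coneInY (i : ℕ) (hi : i ≤ n) :
    Y.obj' i ⟶ objOrZero X (i + 1) ⊞ shiftObj Y (i + 1) :=
  (shiftIso Y hi).inv ≫ biprod.inr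

lemma coneInX_map (i : ℕ) (hi : i < n) : coneInX X Y i hi.le ≫ coneMap φ i =
    -(X.map' i (i + 1) ≫ coneInX X Y (i + 1) hi) + app' φ i hi.le ≫ coneInY X Y i hi.le := by
  have h₁ : objOrZeroMap X i = _ := dif_pos (show i + 1 ≤ n from hi)
  have h₂ : objOrZeroHom φ i = _ := dif_pos hi.le
  rw [coneInX, coneMap, Category.assoc, biprod.inl_desc, biprod.lift_eq, h₁, h₂, coneInX, coneInY]
  simp

lemma coneInX_map_last :
    coneInX X Y n le_rfl ≫ coneMap φ n = app' φ n le_rfl ≫ coneInY X Y n le_rfl := by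
  have h₁ : objOrZeroMap X n = 0 := dif_neg (by omega)
  have h₂ : objOrZeroHom φ n = _ := dif_pos le_rfl
  rw [coneInX, coneMap, Category.assoc, biprod.inl_desc, biprod.lift_eq, h₁, h₂, coneInY]
  simp

lemma coneInY_map (i : ℕ) (hi : i < n) : coneInY X Y i hi.le ≫ coneMap φ (i + 1) =
    Y.map' i (i + 1) ≫ coneInY X Y (i + 1) hi := by
  have h₁ : shiftMap Y (i + 1) = _ := dif_pos (show i + 1 ≤ n from hi)
  rw [coneInY, coneMap, Category.assoc, biprod.inr_desc, biprod.lift_eq, h₁, coneInY]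
  simp

lemma isDirectSum_cone (i : ℕ) (hi : i < n) :
    IsDirectSum (coneInX X Y (i + 1) hi) (coneInY X Y i hi.le) := by
  refine ⟨biprod.fst ≫ (objOrZeroIso X hi).hom, biprod.snd ≫ (shiftIso Y hi.le).hom, ?_, ?_, ?_,
    ?_, ?_⟩
  · rw [coneInX, Category.assoc, biprod.inl_fst_assoc, Iso.inv_hom_id]
  · rw [coneInY, Category.assoc, biprod.inr_snd_assoc, Iso.inv_hom_id]
  · rw [coneInX, Category.assoc, biprod.inl_snd_assoc, zero_comp, comp_zero]
  · rw [coneInY, Category.assoc, biprod.inr_fst_assoc, zero_comp, comp_zero]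
  · rw [coneInX, coneInY, Category.assoc, Category.assoc, Iso.hom_inv_id_assoc,
      Iso.hom_inv_id_assoc, biprod.total]

lemma isIso_coneInX_zero : IsIso (coneInX X Y 0 (Nat.zero_le n)) := by
  have h : (biprod.snd : objOrZero X 0 ⊞ shiftObj Y 0 ⟶ shiftObj Y 0) = 0 :=
    (isZero_zero M).eq_of_tgt _ _
  have : IsIso (biprod.inl : objOrZero X 0 ⟶ objOrZero X 0 ⊞ shiftObj Y 0) :=
    ⟨biprod.fst, biprod.inl_fst, by rw [← biprod.total, h, zero_comp, add_zero]⟩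
  rw [coneInX]
  infer_instance

lemma isIso_coneInY_last : IsIso (coneInY X Y n le_rfl) := by
  have h : (biprod.fst : objOrZero X (n + 1) ⊞ shiftObj Y (n + 1) ⟶ objOrZero X (n + 1)) = 0 :=
    (isZero_objOrZero X (by omega)).eq_of_tgt _ _
  have : IsIso (biprod.inr : shiftObj Y (n + 1) ⟶ objOrZero X (n + 1) ⊞ shiftObj Y (n + 1)) :=
    ⟨biprod.snd, biprod.inr_snd, by rw [← biprod.total, h, zero_comp, zero_add]⟩
  rw [coneInY]
  infer_instance

/-- The mapping cone. -/
noncomputable def coneSeq : ComposableArrows M (n + 1) :=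
  -- Padding by zeros makes the differential uniform in `i : ℕ`; in the restricted range the two end
  -- terms reduce to `X₀` and `Yₙ`.
  (Monotone.functor (f := fun i : Fin (n + 2) => i.val) fun _ _ h => h) ⋙
    Functor.ofSequence (coneMap φ)

lemma coneSeq_map (i : ℕ) (hi : i < n + 1) : (coneSeq φ).map' i (i + 1) = coneMap φ i :=
  Functor.ofSequence_map_homOfLE_succ (coneMap φ) i

/-- Mapping cones exist. -/
noncomputable def coneOfSeq : Cone φ (coneSeq φ) where
  inX i hi := coneInX X Y i hi
  inY i hi := coneInY X Y i hi
  isIso_first := isIso_coneInX_zero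
  isDirectSum i hi := isDirectSum_cone i hi
  isIso_last := isIso_coneInY_last
  inX_d i hi := by
    rw [coneSeq_map φ i (by omega)]
    exact coneInX_map φ i hi
  inX_d_last := by
    rw [coneSeq_map φ n (by omega)]
    exact coneInX_map_last φ
  inY_d i hi := by
    rw [coneSeq_map φ (i + 1) (by omega)]
    exact coneInY_map φ i hi

end ConeExists

/-! ### Exactness of cones of morphisms between `n`-exact sequences. -/

section Bicartesian

variable {M : Type u} [Category.{v} M] [Preadditive M] {n : ℕ}

/-- The sign on the differential of `X` makes the two mixed terms cancel, by naturality of `φ`. -/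
lemma Cone.isComplex {X Y : ComposableArrows M n} {φ : X ⟶ Y} {Z : ComposableArrows M (n + 1)}
    (c : Cone φ Z) (hX : IsComplex X) (hY : IsComplex Y) : IsComplex Z := by
  intro i hi
  have h₁ : c.inX i (by omega) ≫ Z.map' i (i + 1) ≫ Z.map' (i + 1) (i + 2) = 0 := by
    rw [← Category.assoc, c.inX_d i (by omega), Preadditive.add_comp, Preadditive.neg_comp,
      Category.assoc, Category.assoc, c.inY_d i (by omega)]
    obtain hi' | rfl : i + 1 < n ∨ n = i + 1 := by omega
    · rw [c.inX_d (i + 1) hi', Preadditive.comp_add, Preadditive.comp_neg, ← Category.assoc,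
        hX i (by omega), ← Category.assoc (X.map' i (i + 1)),
        ComposableArrows.naturality' φ i (i + 1)]
      simp
    · rw [c.inX_d_last, ← Category.assoc (X.map' i (i + 1)),
        ComposableArrows.naturality' φ i (i + 1)]
      simp
  cases i with
  | zero =>
    have := c.isIso_first
    rw [← cancel_epi (c.inX 0 (Nat.zero_le n)), h₁, comp_zero]
  | succ i =>
    refine (c.isDirectSum i (by omega)).hom_ext ?_ ?_
    · rw [h₁, comp_zero]
    · rw [← Category.assoc, c.inY_d i (by omega), Category.assoc, c.inY_d (i + 1) (by omega),
        ← Category.assoc, hY i (by omega), zero_comp, comp_zero]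

variable {X Y : ComposableArrows M (n + 1)} (φ : X ⟶ Y)

/-- A morphism of `n`-exact sequences which is invertible at the right end is an `n`-pushout
diagram if it is cocartesian at the left end. -/
lemma isNCokernel_cone (hX : IsNExact X) (hY : IsNExact Y) [IsIso (app' φ (n + 1) le_rfl)]
    (hφ : ∀ {T : M} (t : Y.obj' 0 ⟶ T) (s : X.obj' 1 ⟶ T),
      app' φ 0 (Nat.zero_le _) ≫ t = X.map' 0 1 ≫ s → ∃ r : Y.obj' 1 ⟶ T, Y.map' 0 1 ≫ r = t)
    {Z : ComposableArrows M (n + 1)}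
    (c : Cone (ComposableArrows.δlastFunctor.map φ : X.δlast ⟶ Y.δlast) Z) : IsNCokernel Z := by
  have hZ : IsComplex Z := c.isComplex (fun i hi => hX.isNKernel.zero i (by omega))
    (fun i hi => hY.isNKernel.zero i (by omega))
  -- Only an unfolding: the terms of the truncations are rewritten as terms of `X` and `Y`.
  obtain ⟨inX, inY, hfirst, hsum, hlast, inX_d, inX_d_last, inY_d⟩ :
      ∃ (inX : ∀ (i : ℕ) (hi : i ≤ n), X.obj' i ⟶ Z.obj' i)
        (inY : ∀ (i : ℕ) (hi : i ≤ n), Y.obj' i ⟶ Z.obj' (i + 1)),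
        IsIso (inX 0 (Nat.zero_le n)) ∧
        (∀ (i : ℕ) (hi : i < n), IsDirectSum (inX (i + 1) hi) (inY i hi.le)) ∧
        IsIso (inY n le_rfl) ∧
        (∀ (i : ℕ) (hi : i < n), inX i hi.le ≫ Z.map' i (i + 1) =
          -(X.map' i (i + 1) ≫ inX (i + 1) hi) + app' φ i (by omega) ≫ inY i hi.le) ∧
        (inX n le_rfl ≫ Z.map' n (n + 1) = app' φ n n.le_succ ≫ inY n le_rfl) ∧
        (∀ (i : ℕ) (hi : i < n), inY i hi.le ≫ Z.map' (i + 1) (i + 2) =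
          Y.map' i (i + 1) ≫ inY (i + 1) hi) :=
    ⟨c.inX, c.inY, c.isIso_first, c.isDirectSum, c.isIso_last, c.inX_d, c.inX_d_last, c.inY_d⟩
  clear c
  refine ⟨hZ, fun i hi T g hg => ?_, fun {T} g hg => ?_⟩
  -- The component of `g` on `Yᵢ` extends along the differential of `Y`, by `hφ` if `i = 0` and by
  -- exactness otherwise. After subtracting `b`, the component on `Xᵢ₊₁` extends along the
  -- differential of `X`.
  · obtain ⟨b, hb⟩ : ∃ b : Y.obj' (i + 1) ⟶ T,
        Y.map' i (i + 1) ≫ b = inY i (by omega) ≫ g := by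
      have h₁ : inX i (by omega) ≫ Z.map' i (i + 1) ≫ g = 0 := by rw [hg, comp_zero]
      rw [← Category.assoc, inX_d i (by omega), Preadditive.add_comp, Preadditive.neg_comp,
        neg_add_eq_zero, Category.assoc, Category.assoc] at h₁
      cases i with
      | zero => exact hφ _ _ h₁.symm
      | succ i =>
        refine hY.isNCokernel.exact i (by omega) _ ?_
        rw [← Category.assoc, ← inY_d i (by omega), Category.assoc, hg, comp_zero]
    have h₁ : inX i (by omega) ≫ Z.map' i (i + 1) ≫ g = 0 := by rw [hg, comp_zero]
    rw [← Category.assoc, inX_d i (by omega), Preadditive.add_comp, Preadditive.neg_comp,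
      neg_add_eq_zero, Category.assoc, Category.assoc, ← hb, ← Category.assoc (app' φ i _),
      ← ComposableArrows.naturality' φ i (i + 1), Category.assoc] at h₁
    obtain ⟨a, ha⟩ := hX.isNCokernel.exact i hi
      (inX (i + 1) (by omega) ≫ g - app' φ (i + 1) (Nat.le_of_succ_le hi) ≫ b) (by
        rw [Preadditive.comp_sub, h₁, sub_self])
    rw [eq_sub_iff_add_eq] at ha
    obtain hi' | rfl : i + 1 < n ∨ n = i + 1 := by omega
    · obtain ⟨h, hh₁, hh₂⟩ := (hsum (i + 1) hi').exists_desc (-a) b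
      refine ⟨h, (hsum i (by omega)).hom_ext ?_ ?_⟩
      · rw [← Category.assoc, inX_d (i + 1) hi', Preadditive.add_comp, Preadditive.neg_comp,
          Category.assoc, Category.assoc, hh₁, hh₂, Preadditive.comp_neg, neg_neg]
        exact ha
      · rw [← Category.assoc, inY_d i (by omega), Category.assoc, hh₂]
        exact hb
    -- The cone has no summand `Xₙ₊₁`, so `a` is moved to `Yₙ` through the inverse of the right
    -- component of `φ`.
    · refine ⟨inv (inY (i + 1) le_rfl) ≫ (b + Y.map' (i + 1) (i + 2) ≫
        inv (app' φ (i + 2) le_rfl) ≫ a), (hsum i (by omega)).hom_ext ?_ ?_⟩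
      · rw [← Category.assoc, inX_d_last, Category.assoc, IsIso.hom_inv_id_assoc,
          Preadditive.comp_add, ← Category.assoc (app' φ (i + 1) _) (Y.map' (i + 1) (i + 2)),
          ← ComposableArrows.naturality' φ (i + 1) (i + 2), Category.assoc,
          IsIso.hom_inv_id_assoc]
        exact (add_comm _ _).trans ha
      · rw [← Category.assoc, inY_d i (by omega), Category.assoc, IsIso.hom_inv_id_assoc,
          Preadditive.comp_add, hb, ← Category.assoc, hY.isNKernel.zero i (by omega), zero_comp,
          add_zero]
  · have h₁ : app' φ n n.le_succ ≫ inY n le_rfl ≫ g = 0 := by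
      rw [← Category.assoc, ← inX_d_last, Category.assoc, hg, comp_zero]
    obtain ⟨b, hb⟩ : ∃ b : Y.obj' (n + 1) ⟶ T, Y.map' n (n + 1) ≫ b = inY n le_rfl ≫ g := by
      cases n with
      | zero => exact hφ (inY 0 le_rfl ≫ g) 0 (by rw [h₁, comp_zero])
      | succ n =>
        refine hY.isNCokernel.exact n le_rfl _ ?_
        rw [← Category.assoc, ← inY_d n (by omega), Category.assoc, hg, comp_zero]
    have h₂ : app' φ (n + 1) le_rfl ≫ b = 0 := by
      apply hX.isNCokernel.injective
      rw [← Category.assoc, ComposableArrows.naturality' φ n (n + 1), Category.assoc, hb, h₁]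
    have h₃ : b = 0 := by rw [← cancel_epi (app' φ (n + 1) le_rfl), h₂, comp_zero]
    rw [← cancel_epi (inY n le_rfl), ← hb, h₃, comp_zero, comp_zero]

/-- A morphism of `n`-exact sequences which is invertible at the left end is an `n`-pullback
diagram if it is cartesian at the right end. -/
lemma isNKernel_cone (hX : IsNExact X) (hY : IsNExact Y) [IsIso (app' φ 0 (Nat.zero_le _))]
    (hφ : ∀ {T : M} (t : T ⟶ X.obj' (n + 1)) (s : T ⟶ Y.obj' n),
      t ≫ app' φ (n + 1) le_rfl = s ≫ Y.map' n (n + 1) →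
        ∃ r : T ⟶ X.obj' n, r ≫ X.map' n (n + 1) = t)
    {Z : ComposableArrows M (n + 1)}
    (c : Cone (ComposableArrows.δ₀Functor.map φ : X.δ₀ ⟶ Y.δ₀) Z) : IsNKernel Z := by
  have hZ : IsComplex Z := c.isComplex (fun i hi => hX.isNKernel.zero (i + 1) (by omega))
    (fun i hi => hY.isNKernel.zero (i + 1) (by omega))
  obtain ⟨inX, inY, hfirst, hsum, hlast, inX_d, inX_d_last, inY_d⟩ :
      ∃ (inX : ∀ (i : ℕ) (hi : i ≤ n), X.obj' (i + 1) ⟶ Z.obj' i)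
        (inY : ∀ (i : ℕ) (hi : i ≤ n), Y.obj' (i + 1) ⟶ Z.obj' (i + 1)),
        IsIso (inX 0 (Nat.zero_le n)) ∧
        (∀ (i : ℕ) (hi : i < n), IsDirectSum (inX (i + 1) hi) (inY i hi.le)) ∧
        IsIso (inY n le_rfl) ∧
        (∀ (i : ℕ) (hi : i < n), inX i hi.le ≫ Z.map' i (i + 1) =
          -(X.map' (i + 1) (i + 2) ≫ inX (i + 1) hi) +
            app' φ (i + 1) (by omega) ≫ inY i hi.le) ∧
        (inX n le_rfl ≫ Z.map' n (n + 1) = app' φ (n + 1) le_rfl ≫ inY n le_rfl) ∧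
        (∀ (i : ℕ) (hi : i < n), inY i hi.le ≫ Z.map' (i + 1) (i + 2) =
          Y.map' (i + 1) (i + 2) ≫ inY (i + 1) hi) :=
    ⟨c.inX, c.inY, c.isIso_first, c.isDirectSum, c.isIso_last, c.inX_d, c.inX_d_last, c.inY_d⟩
  clear c
  refine ⟨hZ, fun i hi T g hg => ?_, fun {T} g hg => ?_⟩
  · obtain ⟨x, y, rfl⟩ := (hsum i (by omega)).exists_eq g
    -- the two components of `hg`
    have h₁ : x ≫ app' φ (i + 2) (by omega) = (-y) ≫ Y.map' (i + 1) (i + 2) ∧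
        ∃ x' : T ⟶ X.obj' (i + 1), x' ≫ X.map' (i + 1) (i + 2) = x := by
      obtain hi' | rfl : i + 1 < n ∨ n = i + 1 := by omega
      · have h₂ : ((-x) ≫ X.map' (i + 2) (i + 3)) ≫ inX (i + 2) hi' +
            (x ≫ app' φ (i + 2) (by omega) + y ≫ Y.map' (i + 1) (i + 2)) ≫
              inY (i + 1) hi'.le = 0 := by
          rw [Preadditive.add_comp, Category.assoc, Category.assoc, inX_d (i + 1) hi',
            inY_d i (by omega)] at hg
          rw [← hg]
          simp only [Preadditive.comp_add, Preadditive.comp_neg, Preadditive.neg_comp,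
            Preadditive.add_comp, Category.assoc]
          abel
        obtain ⟨h₃, h₄⟩ := (hsum (i + 1) hi').eq_zero h₂
        refine ⟨by rw [Preadditive.neg_comp, eq_neg_iff_add_eq_zero, h₄],
          hX.isNKernel.exact (i + 1) (by omega) x ?_⟩
        rwa [Preadditive.neg_comp, neg_eq_zero] at h₃
      · have h₄ : x ≫ app' φ (i + 2) (by omega) + y ≫ Y.map' (i + 1) (i + 2) = 0 := by
          rw [← cancel_mono (inY (i + 1) le_rfl), zero_comp, ← hg, Preadditive.add_comp,
            Preadditive.add_comp]
          simp only [Category.assoc]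
          rw [inX_d_last, inY_d i (by omega)]
        have h₅ : x ≫ app' φ (i + 2) (by omega) = (-y) ≫ Y.map' (i + 1) (i + 2) := by
          rw [Preadditive.neg_comp, eq_neg_iff_add_eq_zero, h₄]
        exact ⟨h₅, hφ _ _ h₅⟩
    obtain ⟨h₁, x', rfl⟩ := h₁
    obtain ⟨y', hy'⟩ := hY.isNKernel.exact i hi (y + x' ≫ app' φ (i + 1) (Nat.le_of_succ_le hi)) (by
      rw [Preadditive.add_comp, Category.assoc, ← ComposableArrows.naturality' φ (i + 1) (i + 2),
        ← Category.assoc, h₁, Preadditive.neg_comp, add_neg_cancel])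
    rw [← sub_eq_iff_eq_add] at hy'
    subst hy'
    cases i with
    | zero =>
      -- The cone has no summand `Y₀`, so `y'` is moved to `X₁` through the inverse of the left
      -- component of `φ`.
      refine ⟨(-x' + y' ≫ inv (app' φ 0 (Nat.zero_le _)) ≫ X.map' 0 1) ≫
        inX 0 (Nat.zero_le n), ?_⟩
      have h₂ : X.map' 0 1 ≫ inX 0 (Nat.zero_le n) ≫ Z.map' 0 1 =
          app' φ 0 (Nat.zero_le _) ≫ Y.map' 0 1 ≫ inY 0 (by omega) := by
        rw [inX_d 0 (by omega), Preadditive.comp_add, Preadditive.comp_neg, ← Category.assoc,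
          hX.isNKernel.zero 0 (by omega), zero_comp, neg_zero, zero_add, ← Category.assoc,
          ComposableArrows.naturality' φ 0 1, Category.assoc]
      simp only [Preadditive.add_comp, Category.assoc, h₂, IsIso.inv_hom_id_assoc]
      rw [inX_d 0 (by omega)]
      simp only [Preadditive.comp_add, Preadditive.comp_neg, Preadditive.neg_comp,
        Preadditive.sub_comp, Category.assoc]
      abel
    | succ i =>
      refine ⟨(-x') ≫ inX (i + 1) (by omega) + y' ≫ inY i (by omega), ?_⟩
      rw [Preadditive.add_comp, Category.assoc, Category.assoc, inX_d (i + 1) (by omega),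
        inY_d i (by omega)]
      simp only [Preadditive.comp_add, Preadditive.comp_neg, Preadditive.neg_comp,
        Preadditive.sub_comp, Category.assoc]
      abel
  · obtain ⟨x, rfl⟩ : ∃ x, g = x ≫ inX 0 (Nat.zero_le n) :=
      ⟨g ≫ inv (inX 0 (Nat.zero_le n)), by
        rw [Category.assoc, IsIso.inv_hom_id, Category.comp_id]⟩
    have h₁ : x ≫ app' φ 1 (by omega) = 0 ∧ ∃ x' : T ⟶ X.obj' 0, x' ≫ X.map' 0 1 = x := by
      cases n with
      | zero =>
        have h₂ : x ≫ app' φ 1 (by omega) = 0 := by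
          rw [← cancel_mono (inY 0 le_rfl), zero_comp, ← hg, Category.assoc, Category.assoc,
            inX_d_last]
        exact ⟨h₂, hφ x 0 (by rw [h₂, zero_comp])⟩
      | succ n =>
        have h₂ : ((-x) ≫ X.map' 1 2) ≫ inX 1 (by omega) +
            (x ≫ app' φ 1 (by omega)) ≫ inY 0 (by omega) = 0 := by
          have h₃ : inX 0 (Nat.zero_le _) ≫ Z.map' 0 1 = _ := inX_d 0 (by omega)
          refine Eq.trans ?_ (((Category.assoc _ _ _).trans (congrArg (x ≫ ·) h₃)).symm.trans hg)
          simp only [Preadditive.comp_add, Preadditive.comp_neg, Preadditive.neg_comp,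
            Category.assoc]
        obtain ⟨h₃, h₄⟩ := (hsum 0 (by omega)).eq_zero h₂
        rw [Preadditive.neg_comp, neg_eq_zero] at h₃
        exact ⟨h₄, hX.isNKernel.exact 0 (by omega) x h₃⟩
    obtain ⟨h₁, x', rfl⟩ := h₁
    have h₂ : x' ≫ app' φ 0 (Nat.zero_le _) = 0 := by
      apply hY.isNKernel.injective
      rw [Category.assoc, ← ComposableArrows.naturality' φ 0 1, ← Category.assoc, h₁]
    have h₃ : x' = 0 := by rw [← cancel_mono (app' φ 0 (Nat.zero_le _)), h₂, zero_comp]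
    rw [h₃, zero_comp, zero_comp]

end Bicartesian

/-! ### The axioms on conflations, apart from composition. -/

section Conflations

variable {C : Type u} [Category.{v} C] [Preadditive C] [HasFiniteBiproducts C] {S : C ⥤ C}
  [S.IsEquivalence] [S.Additive] {n : ℕ} {Θ : Set (SigmaSeq S n)} {A : ObjectProperty C}

omit [HasFiniteBiproducts C] in
lemma IsAdditiveSubcategory.hasFiniteBiproducts [HasFiniteBiproducts C]
    (hA : IsAdditiveSubcategory A) : HasFiniteBiproducts A.FullSubcategory := by
  have : A.IsClosedUnderIsomorphisms := ⟨fun e h => hA.of_iso e h⟩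
  have : HasZeroObject A.FullSubcategory :=
    ⟨⟨⟨_, hA.of_isZero (isZero_zero C)⟩, by
      rw [IsZero.iff_id_eq_zero]
      exact InducedCategory.hom_ext ((isZero_zero C).eq_of_src _ _)⟩⟩
  have : HasBinaryBiproducts C := hasBinaryBiproducts_of_finite_biproducts C
  have : HasBinaryBiproducts A.FullSubcategory := ⟨fun X Y => hasBinaryBiproduct_of_total
    { pt := ⟨X.obj ⊞ Y.obj, hA.biprod X.property Y.property⟩
      fst := ObjectProperty.homMk biprod.fst
      snd := ObjectProperty.homMk biprod.snd
      inl := ObjectProperty.homMk biprod.inl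
      inr := ObjectProperty.homMk biprod.inr
      inl_fst := by ext; exact biprod.inl_fst
      inl_snd := by ext; exact biprod.inl_snd
      inr_fst := by ext; exact biprod.inr_fst
      inr_snd := by ext; exact biprod.inr_snd } (InducedCategory.hom_ext biprod.total)⟩
  have := hasFiniteProducts_of_has_binary_and_terminal (C := A.FullSubcategory)
  exact HasFiniteBiproducts.of_hasFiniteProducts

/-- A morphism between sequences with terms in `A`, as a morphism in the full subcategory. -/
def liftHom {m : ℕ} {X Y : ComposableArrows A.FullSubcategory m}
    (φ : (A.ι.mapComposableArrows m).obj X ⟶ (A.ι.mapComposableArrows m).obj Y) : X ⟶ Y where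
  app i := ObjectProperty.homMk (φ.app i)
  naturality {i j} f := by
    ext
    exact φ.naturality f

omit [HasFiniteBiproducts C] in
lemma isZero_hom {X : A.FullSubcategory} (h : IsZero X) : IsZero X.obj := by
  rw [IsZero.iff_id_eq_zero] at h ⊢
  exact congrArg InducedCategory.Hom.hom h

omit [Preadditive C] [HasFiniteBiproducts C] in
lemma isIso_hom {X Y : A.FullSubcategory} (f : X ⟶ Y) [IsIso f] : IsIso f.hom :=
  inferInstanceAs (IsIso (A.ι.map f))

omit [Preadditive C] [HasFiniteBiproducts C] in
lemma isIso_of_hom {X Y : A.FullSubcategory} (f : X ⟶ Y) [h : IsIso f.hom] : IsIso f := by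
  have : IsIso (A.ι.map f) := h
  exact isIso_of_fully_faithful A.ι f

namespace IsAngulation

variable (hΘ : IsAngulation Θ) (hn : 1 ≤ n)

include hΘ

omit [S.IsEquivalence] [S.Additive] [HasFiniteBiproducts C] in
lemma conflations_of_isZero {X : ComposableArrows A.FullSubcategory (n + 1)}
    (hX : ∀ i, IsZero (X.obj i)) : conflations Θ A X := by
  refine ⟨0, hΘ.trivial ⟨?_, fun i _ hi => isZero_hom (hX ⟨i, by omega⟩)⟩⟩
  exact (isZero_hom (hX ⟨0, by omega⟩)).isIso (isZero_hom (hX ⟨1, by omega⟩)) _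

include hn

variable (hvan : ∀ {X Y : C}, A X → A Y → ∀ f : S.obj X ⟶ Y, f = 0)

include hvan

lemma isNExact_of_conflations {X : ComposableArrows A.FullSubcategory (n + 1)}
    (hX : conflations Θ A X) : IsNExact X := by
  obtain ⟨δ, hδ⟩ := hX
  exact isNExact_iff.2 (hΘ.isNExactIn hn hvan hδ fun i => (X.obj i).property)

/-- Adjacent isomorphisms give inverse homotopy equivalences at once and can be inverted;
isomorphisms at the two ends need extension closure and a separate argument in each direction. -/
lemma conflations_weakIso (hC : IsKrullSchmidt C) (hext : IsExtensionClosed Θ A)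
    {X Y : ComposableArrows A.FullSubcategory (n + 1)} (f : X ⟶ Y) (hX : IsNExact X)
    (hY : IsNExact Y) (hf : IsWeakIso f) : conflations Θ A X ↔ conflations Θ A Y := by
  rw [isNExact_iff] at hX hY
  let F := (A.ι.mapComposableArrows (n + 1)).map f
  obtain ⟨k, hk, h₁, h₂⟩ | ⟨h₁, h₂⟩ := hf
  · have hk₀ : k ≤ n + 1 := by omega
    have hk₁ : k + 1 ≤ n + 1 := by omega
    have := isIso_hom (app' f k hk₀)
    have := isIso_hom (app' f (k + 1) hk₁)
    let a := asIso (app' f k hk₀).hom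
    let b := asIso (app' f (k + 1) hk₁).hom
    have hab := ComposableArrows.naturality' F k (k + 1)
    change _ ≫ b.hom = a.hom ≫ _ at hab
    constructor
    · rintro ⟨δ, hδ⟩
      exact hΘ.exists_of_consecutive_iso hn hvan hC hδ (fun i => (X.obj i).property) hY k hk
        a b hab
    · rintro ⟨δ, hδ⟩
      exact hΘ.exists_of_consecutive_iso hn hvan hC hδ (fun i => (Y.obj i).property) hX k hk
        a.symm b.symm (((Iso.comp_inv_eq b).2 (((Iso.inv_comp_eq a).2 hab).symm.trans
          (Category.assoc _ _ _).symm)))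
  · have i₁ : IsIso (app' F (n + 1) le_rfl) := isIso_hom (app' f (n + 1) le_rfl)
    have i₂ : IsIso (app' F 0 (Nat.zero_le _)) := isIso_hom (app' f 0 (Nat.zero_le _))
    constructor
    · rintro ⟨δ, hδ⟩
      exact hΘ.exists_of_ends_iso_target hn hvan hC hext hδ (fun i => (X.obj i).property) hY F
    · rintro ⟨δ, hδ⟩
      exact hΘ.exists_of_ends_iso_source hn hvan hC hext hδ (fun i => (Y.obj i).property) hX F

omit hvan in
/-- An `(n+2)`-angle can be pushed out along each morphism from its first term to `A`. -/
lemma exists_pushout_angle (hext : IsExtensionClosed Θ A) {X : SigmaSeq S n} (hX : X ∈ Θ)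
    (hXA : A X.seq.right) {B : C} (hB : A B) (f : X.seq.obj' 0 ⟶ B) :
    ∃ Y ∈ Θ, (∀ i, A (Y.seq.obj i)) ∧ ∃ (φ : X.seq ⟶ Y.seq) (a : Y.seq.obj' 0 ≅ B),
      app' φ 0 (Nat.zero_le _) ≫ a.hom = f ∧ IsIso (app' φ (n + 1) le_rfl) ∧
      ∀ {T : C} (t : Y.seq.obj' 0 ⟶ T) (s : X.seq.obj' 1 ⟶ T),
        app' φ 0 (Nat.zero_le _) ≫ t = X.seq.map' 0 1 ≫ s →
          ∃ r : Y.seq.obj' 1 ⟶ T, Y.seq.map' 0 1 ≫ r = t := by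
  obtain ⟨Y, hY, hYA, a, c, hac⟩ := hext (X.δ ≫ S.map f) hB hXA
  have hac' : X.δ ≫ S.map (f ≫ a.inv) = c.inv ≫ Y.δ := by
    rw [← cancel_mono (S.map a.hom), ← cancel_epi c.hom, Category.assoc, Category.assoc,
      ← S.map_comp, Category.assoc, a.inv_hom_id, Category.comp_id, c.hom_inv_id_assoc, hac]
  obtain ⟨φ, hφ₀, hφ₁⟩ := hΘ.exists_hom_of_ends hn hX hY (f ≫ a.inv) c.inv hac'
  refine ⟨Y, hY, hYA, φ, a, ?_, hφ₁ ▸ inferInstance, fun {T} t s hts => ?_⟩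
  · rw [hφ₀, Category.assoc]
    exact (congrArg (f ≫ ·) a.inv_hom_id).trans (Category.comp_id _)
  -- `t` extends once `Y.δ ≫ S.map t` is zero. Through the invertible right end this becomes a
  -- statement on `X`, where `app' φ 0 ≫ t` factors through the first differential.
  obtain ⟨r, hr⟩ := hΘ.desc_zero hn hY t (by
    have h : X.δ ≫ S.map (app' φ 0 (Nat.zero_le _) ≫ t) = 0 := by
      rw [hts, S.map_comp, ← Category.assoc, hΘ.δ_comp hn hX, zero_comp]
    rw [← cancel_epi c.inv, ← Category.assoc, ← hac', ← hφ₀, Category.assoc, ← S.map_comp, h,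
      comp_zero])
  exact ⟨r, hr.symm⟩

omit hvan in
/-- An `(n+2)`-angle can be pulled back along each morphism from `A` to its last term. -/
lemma exists_pullback_angle (hext : IsExtensionClosed Θ A) {X : SigmaSeq S n} (hX : X ∈ Θ)
    (hXA : A X.seq.left) {B : C} (hB : A B) (g : B ⟶ X.seq.obj' (n + 1)) :
    ∃ Y ∈ Θ, (∀ i, A (Y.seq.obj i)) ∧ ∃ (φ : Y.seq ⟶ X.seq) (c : B ≅ Y.seq.obj' (n + 1)),
      c.hom ≫ app' φ (n + 1) le_rfl = g ∧ IsIso (app' φ 0 (Nat.zero_le _)) ∧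
      ∀ {T : C} (t : T ⟶ Y.seq.obj' (n + 1)) (s : T ⟶ X.seq.obj' n),
        t ≫ app' φ (n + 1) le_rfl = s ≫ X.seq.map' n (n + 1) →
          ∃ r : T ⟶ Y.seq.obj' n, r ≫ Y.seq.map' n (n + 1) = t := by
  obtain ⟨Y, hY, hYA, a, c, hac⟩ := hext (g ≫ X.δ) hXA hB
  obtain ⟨φ, hφ₀, hφ₁⟩ := hΘ.exists_hom_of_ends hn hY hX a.hom (c.hom ≫ g)
    (hac.trans (Category.assoc _ _ _).symm)
  refine ⟨Y, hY, hYA, φ, c.symm, by rw [hφ₁]; exact c.inv_hom_id_assoc g, hφ₀ ▸ inferInstance,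
    fun {T} t s hts => ?_⟩
  obtain ⟨r, hr⟩ := hΘ.lift_last hn hY t (by
    rw [← cancel_mono (S.map a.hom), zero_comp, Category.assoc, hac, ← Category.assoc c.hom, ← hφ₁,
      ← Category.assoc, hts, Category.assoc, hΘ.comp_δ hn hX, comp_zero])
  exact ⟨r, hr.symm⟩

lemma exists_pushout (hA : IsAdditiveSubcategory A) (hext : IsExtensionClosed Θ A)
    {X : ComposableArrows A.FullSubcategory (n + 1)} (hX : conflations Θ A X)
    {B : A.FullSubcategory} (f : X.obj' 0 ⟶ B) :
    ∃ (Y : ComposableArrows A.FullSubcategory n) (φ : X.δlast ⟶ Y) (e : Y.obj' 0 ≅ B),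
      app' φ 0 ≫ e.hom = f ∧ IsNPushout φ ∧
        IsAdmissibleMono (conflations Θ A) (Y.map' 0 1) := by
  have := hA.hasFiniteBiproducts
  have hX' := hΘ.isNExact_of_conflations hn hvan hX
  obtain ⟨δ, hδ⟩ := hX
  obtain ⟨Y, hY, hYA, φ, a, hφ₀, hφ₁, hφ⟩ := hΘ.exists_pushout_angle hn hext hδ
    (X.obj' (n + 1)).property B.property f.hom
  let Y' : ComposableArrows A.FullSubcategory (n + 1) := A.lift Y.seq hYA
  have hY' : conflations Θ A Y' := ⟨Y.δ, hY⟩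
  let ψ : X ⟶ Y' := liftHom φ
  have : IsIso (app' ψ (n + 1) le_rfl) := isIso_of_hom (h := hφ₁) _
  refine ⟨Y'.δlast, ComposableArrows.δlastFunctor.map ψ, A.isoMk a, InducedCategory.hom_ext hφ₀,
    ⟨_, ⟨coneOfSeq _⟩, isNCokernel_cone ψ hX' (hΘ.isNExact_of_conflations hn hvan hY')
      (fun t s hts => ?_) (coneOfSeq _)⟩, Y', hY', ⟨Iso.refl _⟩⟩
  obtain ⟨r, hr⟩ := hφ t.hom s.hom (congrArg InducedCategory.Hom.hom hts)
  exact ⟨ObjectProperty.homMk r, InducedCategory.hom_ext hr⟩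

lemma exists_pullback (hA : IsAdditiveSubcategory A) (hext : IsExtensionClosed Θ A)
    {X : ComposableArrows A.FullSubcategory (n + 1)} (hX : conflations Θ A X)
    {B : A.FullSubcategory} (g : B ⟶ X.obj' (n + 1)) :
    ∃ (Y : ComposableArrows A.FullSubcategory n) (φ : Y ⟶ X.δ₀) (e : B ≅ Y.obj' n),
      e.hom ≫ app' φ n = g ∧ IsNPullback φ ∧
        IsAdmissibleEpi (conflations Θ A) (Y.map' (n - 1) n) := by
  have := hA.hasFiniteBiproducts
  have hX' := hΘ.isNExact_of_conflations hn hvan hX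
  obtain ⟨δ, hδ⟩ := hX
  obtain ⟨Y, hY, hYA, φ, c, hφ₀, hφ₁, hφ⟩ := hΘ.exists_pullback_angle hn hext hδ
    (X.obj' 0).property B.property g.hom
  let Y' : ComposableArrows A.FullSubcategory (n + 1) := A.lift Y.seq hYA
  have hY' : conflations Θ A Y' := ⟨Y.δ, hY⟩
  let ψ : Y' ⟶ X := liftHom φ
  have : IsIso (app' ψ 0 (Nat.zero_le _)) := isIso_of_hom (h := hφ₁) _
  refine ⟨Y'.δ₀, ComposableArrows.δ₀Functor.map ψ, A.isoMk c, InducedCategory.hom_ext hφ₀,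
    ⟨_, ⟨coneOfSeq _⟩, isNKernel_cone ψ (hΘ.isNExact_of_conflations hn hvan hY') hX'
      (fun t s hts => ?_) (coneOfSeq _)⟩, Y', hY', ?_⟩
  · obtain ⟨r, hr⟩ := hφ t.hom s.hom (congrArg InducedCategory.Hom.hom hts)
    exact ⟨ObjectProperty.homMk r, InducedCategory.hom_ext hr⟩
  -- Makes position `n - 1` of the truncation literally position `n` of `Y'`.
  · obtain ⟨k, rfl⟩ : ∃ k, n = k + 1 := ⟨n - 1, by omega⟩
    exact ⟨Iso.refl _⟩

end IsAngulation

end Conflations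

/-! ### Adding disks to angles and splitting them off. -/

section Disks

variable {C : Type u} [Category.{v} C] [Preadditive C] [HasFiniteBiproducts C] {m : ℕ}

omit [HasFiniteBiproducts C] in
lemma IsDirectSum.isIso_left {X Y Z : C} {i₁ : X ⟶ Z} {i₂ : Y ⟶ Z} (h : IsDirectSum i₁ i₂)
    (hY : IsZero Y) : IsIso i₁ := by
  obtain ⟨p₁, p₂, e₁, -, -, -, e⟩ := h
  exact ⟨p₁, e₁, by rw [← e, hY.eq_of_tgt p₂ 0, zero_comp, add_zero]⟩

omit [HasFiniteBiproducts C] in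
lemma IsDirectSum.iso_comp {X Y Y' Z : C} {i₁ : X ⟶ Z} {i₂ : Y ⟶ Z} (h : IsDirectSum i₁ i₂)
    (e : Y' ≅ Y) : IsDirectSum i₁ (e.hom ≫ i₂) := by
  obtain ⟨p₁, p₂, e₁, e₂, e₃, e₄, e₅⟩ := h
  exact ⟨p₁, p₂ ≫ e.inv, e₁, by simp [reassoc_of% e₂], by simp [reassoc_of% e₃], by simp [e₄],
    by simp [e₅]⟩

/-- A section and a retraction across a single differential make the disk a retract of the whole
complex. -/
lemma fromDisk_comp_toDisk {X : ComposableArrows C m} (hX : IsComplex X) {j : ℕ} (hj : j + 1 ≤ m)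
    {N : C} (s : N ⟶ X.obj' j) (r : X.obj' (j + 1) ⟶ N) (h : s ≫ X.map' j (j + 1) ≫ r = 𝟙 N) :
    fromDisk hX hj s ≫ toDisk hX hj r = 𝟙 _ := by
  ext a
  by_cases ha : InDisk j a.val
  · rw [NatTrans.comp_app, fromDisk_app _ _ _ ha, toDisk_app _ _ _ ha]
    have h₁ : X.map (homOfLE (ge_of_inDisk hj ha)) ≫ X.map (homOfLE (le_of_inDisk hj ha)) =
        X.map' j (j + 1) := (X.map_comp _ _).symm
    rw [← cancel_epi (diskIso ha N).inv, ← cancel_mono (diskIso ha N).hom]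
    simp only [Category.assoc, Iso.inv_hom_id_assoc, Iso.inv_hom_id, Category.comp_id]
    rw [← Category.assoc (X.map _) (X.map _), h₁, h]
    simp
  · exact (isZero_disk_obj ha).eq_of_src _ _

/-- Gives the components of the idempotent of a split disk; away from `j` and `j + 1` they vanish.
-/
lemma toDisk_comp_fromDisk {X : ComposableArrows C m} (hX : IsComplex X) {j : ℕ} (hj : j + 1 ≤ m)
    {N : C} (s : N ⟶ X.obj' j) (r : X.obj' (j + 1) ⟶ N) :
    toDisk hX hj r ≫ fromDisk hX hj s = nullMap hX hX hj (r ≫ s) := by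
  rw [nullMap]
  ext a
  simp only [NatTrans.comp_app]
  by_cases ha : InDisk j a.val
  · rw [fromDisk_app _ _ _ ha, toDisk_app _ _ _ ha, fromDisk_app _ _ _ ha, toDisk_app _ _ _ ha]
    simp
  · rw [(isZero_disk_obj ha).eq_of_tgt ((toDisk hX hj r).app a) 0,
      (isZero_disk_obj ha).eq_of_tgt ((toDisk hX hj (r ≫ s)).app a) 0, zero_comp, zero_comp]

variable {S : C ⥤ C} [S.IsEquivalence] [S.Additive] {n : ℕ} {Θ : Set (SigmaSeq S n)}
  {A : ObjectProperty C}

namespace IsAngulation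

variable (hΘ : IsAngulation Θ) (hn : 1 ≤ n)

include hΘ hn

omit [S.IsEquivalence] in
/-- Splitting off a disk from an `(n+2)`-angle. -/
lemma exists_split (hC : IsKrullSchmidt C) {X : SigmaSeq S n} (hX : X ∈ Θ) (j : ℕ)
    (hj : j + 1 ≤ n + 1) {N : C} (s : N ⟶ X.seq.obj' j (Nat.le_of_succ_le hj))
    (r : X.seq.obj' (j + 1) hj ⟶ N)
    (h : s ≫ X.seq.map' j (j + 1) ≫ r = 𝟙 N) :
    ∃ W ∈ Θ, ∃ (i : W.seq ⟶ X.seq) (q : X.seq ⟶ W.seq),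
      (∀ (k : ℕ) (hk : k ≤ n + 1), app' i k hk ≫ app' q k hk = 𝟙 _) ∧
      (∀ (k : ℕ) (hk : k ≤ n + 1), ¬InDisk j k → app' q k hk ≫ app' i k hk = 𝟙 _) ∧
      app' q j (Nat.le_of_succ_le hj) ≫ app' i j (Nat.le_of_succ_le hj) +
        X.seq.map' j (j + 1) ≫ r ≫ s = 𝟙 _ ∧
      app' q (j + 1) hj ≫ app' i (j + 1) hj + r ≫ s ≫ X.seq.map' j (j + 1) = 𝟙 _ ∧
      s ≫ app' q j (Nat.le_of_succ_le hj) = 0 ∧ app' i (j + 1) hj ≫ r = 0 := by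
  have hX' := hΘ.isComplex hn hX
  obtain ⟨s', hs'⟩ := exists_hom_fromDisk hX' (hΘ.comp_δ hn hX) hj s
  obtain ⟨r', hr'⟩ := exists_hom_toDisk hX' (hΘ.δ_comp hn hX) hj r
  obtain ⟨W, i, q, -, hW, h₁, h₂, h₃, h₄⟩ := SigmaSeq.exists_complement hC s' r' (by
    rw [hs', hr', fromDisk_comp_toDisk hX' hj s r h])
  rw [hs', hr', toDisk_comp_fromDisk] at h₄
  obtain ⟨q, _⟩ := q
  obtain ⟨i, _⟩ := i
  dsimp only at h₁ h₂ h₃ h₄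
  have e₁ : ∀ (k : ℕ) (hk : k ≤ n + 1), app' i k hk ≫ app' q k hk = 𝟙 _ := fun k hk =>
    (congrArg (fun t : W.seq ⟶ W.seq => t.app ⟨k, by omega⟩) h₁ :)
  have e₂ : ∀ (k : ℕ) (hk : k ≤ n + 1), app' (nullMap hX' hX' hj (r ≫ s)) k hk +
      app' q k hk ≫ app' i k hk = 𝟙 _ := fun k hk =>
    (congrArg (fun t : X.seq ⟶ X.seq => t.app ⟨k, by omega⟩) h₄ :)
  have e₃ : app' q j (Nat.le_of_succ_le hj) ≫ app' i j (Nat.le_of_succ_le hj) +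
      X.seq.map' j (j + 1) ≫ r ≫ s = 𝟙 _ := by
    rw [← e₂ j (by omega), nullMap_app_left]
    exact add_comm _ _
  have e₄ : app' q (j + 1) hj ≫ app' i (j + 1) hj + r ≫ s ≫ X.seq.map' j (j + 1) = 𝟙 _ := by
    rw [← e₂ (j + 1) hj, nullMap_app_right, Category.assoc]
    exact add_comm _ _
  refine ⟨W, hΘ.summand hW hX, i, q, e₁, fun k hk hjk => ?_, e₃, e₄, ?_, ?_⟩
  · have : app' (nullMap hX' hX' hj (r ≫ s)) k hk = 0 := nullMap_app_of_not _ _ _ _ hjk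
    rw [← e₂ k hk, this, zero_add]
  · have e₅ : s ≫ app' q j (by omega) ≫ app' i j (by omega) = 0 := by
      rw [← eq_sub_iff_add_eq] at e₃
      rw [e₃, Preadditive.comp_sub, Category.comp_id, ← Category.assoc (X.seq.map' _ _),
        ← Category.assoc, h, Category.id_comp, sub_self]
    rw [← cancel_mono (𝟙 _), Category.assoc, ← e₁ j (by omega), ← Category.assoc (app' q _ _),
      ← Category.assoc, e₅, zero_comp, zero_comp]
  · have e₅ : (app' q (j + 1) hj ≫ app' i (j + 1) hj) ≫ r = 0 := by
      rw [← eq_sub_iff_add_eq] at e₄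
      rw [e₄, Preadditive.sub_comp, Category.id_comp, Category.assoc, Category.assoc, h,
        Category.comp_id, sub_self]
    rw [← Category.id_comp (app' i (j + 1) hj), ← e₁ (j + 1) hj, Category.assoc, Category.assoc,
      ← Category.assoc (app' q (j + 1) hj), e₅, comp_zero]

omit hn [S.IsEquivalence] in
/-- Adding a disk to an `(n+2)`-angle. -/
lemma exists_add_disk {E : SigmaSeq S n} (hE : E ∈ Θ) (j : ℕ) (hj : j + 1 ≤ n + 1) (N : C) :
    ∃ B ∈ Θ, ∃ (i : E.seq ⟶ B.seq) (x : N ⟶ B.seq.obj' j) (x' : N ⟶ B.seq.obj' (j + 1)),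
      (∀ (k : ℕ) (hk : k ≤ n + 1), ¬InDisk j k → IsIso (app' i k hk)) ∧
      IsDirectSum (app' i j (Nat.le_of_succ_le hj)) x ∧ IsDirectSum (app' i (j + 1) hj) x' ∧
      x ≫ B.seq.map' j (j + 1) = x' := by
  have h₁ : InDisk j j := ⟨le_rfl, by omega⟩
  have h₂ : InDisk j (j + 1) := ⟨by omega, le_rfl⟩
  have hi : ∀ k : Fin (n + 2), IsDirectSum ((E.inl (diskSeq S n j N)).hom.app k)
      ((E.inr (diskSeq S n j N)).hom.app k) := fun _ =>
    ⟨biprod.fst, biprod.snd, biprod.inl_fst, biprod.inr_snd, biprod.inl_snd, biprod.inr_fst,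
      biprod.total⟩
  let e₁ := diskIso (m := n + 1) (a := ⟨j, by omega⟩) h₁ N
  let e₂ := diskIso (m := n + 1) (a := ⟨j + 1, by omega⟩) h₂ N
  refine ⟨_, hΘ.sum (E.isSum_biprod (diskSeq S n j N)) hE (hΘ.diskSeq_mem N j (by omega)),
    (E.inl _).hom, e₁.inv ≫ (E.inr (diskSeq S n j N)).hom.app ⟨j, by omega⟩,
    e₂.inv ≫ (E.inr (diskSeq S n j N)).hom.app ⟨j + 1, by omega⟩,
    fun k hk hk' => (hi ⟨k, by omega⟩).isIso_left (isZero_disk_obj hk'),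
    (hi ⟨j, by omega⟩).iso_comp e₁.symm, (hi ⟨j + 1, by omega⟩).iso_comp e₂.symm, ?_⟩
  have h := ComposableArrows.naturality' (E.inr (diskSeq S n j N)).hom j (j + 1)
  have h' : (disk (n + 1) j N).map' j (j + 1) = e₁.hom ≫ e₂.inv := disk_map _ h₁ h₂
  rw [Category.assoc]
  refine (congrArg (e₁.inv ≫ ·) h.symm).trans ?_
  refine (congrArg (fun t => e₁.inv ≫ t ≫ _) h').trans ?_
  simp

variable (hC : IsKrullSchmidt C) (hA : IsAdditiveSubcategory A) (hext : IsExtensionClosed Θ A)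

include hC hA hext

/-- The first morphism of an `(n+2)`-angle is the first morphism of an `(n+2)`-angle with terms in
`A` if the first two terms and the last one belong to `A`. -/
lemma exists_mem_of_left {X : SigmaSeq S n} (hX : X ∈ Θ) (h₀ : A X.seq.left)
    (h₁ : A (X.seq.obj' 1)) (hlast : A X.seq.right) :
    ∃ W ∈ Θ, (∀ i, A (W.seq.obj i)) ∧
      Nonempty (Arrow.mk (W.seq.map' 0 1) ≅ Arrow.mk (X.seq.map' 0 1)) := by
  obtain rfl | hn2 : n = 1 ∨ 2 ≤ n := by omega
  · refine ⟨X, hX, fun i => ?_, ⟨Iso.refl _⟩⟩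
    match i with
    | ⟨0, _⟩ => exact h₀
    | ⟨1, _⟩ => exact h₁
    | ⟨2, _⟩ => exact hlast
  -- `E` lies in `A` and shares the last morphism of `X`. The first morphisms of `E` and `X` factor
  -- through one another, and `𝟙 - a' ≫ b` factors through `E₂`; this allows `E₁` to be exchanged
  -- for `X₁`.
  obtain ⟨E, hE, hEA, a, c, hac⟩ := hext X.δ h₀ hlast
  let f : X.seq.left ⟶ X.seq.obj' 1 := X.seq.map' 0 1
  obtain ⟨b, hb⟩ : ∃ b : X.seq.obj' 1 ⟶ E.seq.obj' 1, a.inv ≫ E.seq.map' 0 1 = f ≫ b :=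
    hΘ.desc_zero hn hX _ (by
    have h : X.δ ≫ S.map a.inv = c.inv ≫ E.δ := by
      rw [← cancel_epi c.hom, ← reassoc_of% hac, ← S.map_comp, a.hom_inv_id, S.map_id,
        Category.comp_id, c.hom_inv_id_assoc]
    rw [S.map_comp, reassoc_of% h, hΘ.δ_comp hn hE, comp_zero])
  obtain ⟨a', ha'⟩ : ∃ a' : E.seq.obj' 1 ⟶ X.seq.obj' 1, a.hom ≫ f = E.seq.map' 0 1 ≫ a' :=
    hΘ.desc_zero hn hE _ (by
    rw [S.map_comp, reassoc_of% hac, hΘ.δ_comp hn hX, comp_zero])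
  obtain ⟨k, hk⟩ := hΘ.desc hn 0 hE (by omega) (𝟙 _ - a' ≫ b) (by
    rw [Preadditive.comp_sub, Category.comp_id, ← reassoc_of% ha', ← hb, a.hom_inv_id_assoc,
      sub_self])
  have h01 : 0 ≤ n + 1 := by omega
  have h11 : 1 ≤ n + 1 := by omega
  have h12 : 1 + 1 ≤ n + 1 := by omega
  -- A disk on `X₁` is added in degrees `1` and `2`. Then a disk on `E₁` is split off, embedded by
  -- `s = (1, a')` and with retraction `r = (k, b)`.
  obtain ⟨B, hB, i, x, x', hi, hsum₁, hsum₂, hx⟩ := hΘ.exists_add_disk hE 1 h12 (X.seq.obj' 1)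
  obtain ⟨r, hr₁, hr₂⟩ := hsum₂.exists_desc k b
  have hid : app' i 1 h11 ≫ B.seq.map' 1 2 = E.seq.map' 1 2 ≫ app' i 2 h12 :=
    (ComposableArrows.naturality' i 1 2).symm
  obtain ⟨s, hs⟩ : ∃ s, s = app' i 1 h11 + a' ≫ x := ⟨_, rfl⟩
  obtain ⟨W, hW, ι, q, hιq, hqι, h₃, -, hsq, -⟩ := hΘ.exists_split hn hC hB 1 h12 s r (by
    rw [hs, Preadditive.add_comp, Category.assoc, ← Category.assoc x, hx, hr₂,
      ← Category.assoc (app' i 1 _), hid, Category.assoc, hr₁]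
    exact (sub_eq_iff_eq_add.1 hk).symm)
  refine ⟨W, hW, fun l => hA.of_retract hC _ _ (hιq l.val (by omega)) ?_, ?_⟩
  · by_cases hl : InDisk 1 l.val
    · obtain ⟨l, hl'⟩ := l
      obtain rfl | rfl : l = 1 ∨ l = 2 := by simp only [InDisk] at hl; omega
      · exact hA.sum _ _ hsum₁ (hEA _) h₁
      · exact hA.sum _ _ hsum₂ (hEA _) h₁
    · have := hi l.val (by omega) hl
      exact hA.of_iso (asIso (app' i l.val (Nat.le_of_lt_succ l.2))) (hEA _)
  -- `π = (a', -1)` is a split cokernel of `s`; it identifies the complement of `E₁` in degree `1`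
  -- with `X₁`.
  obtain ⟨π, hπ₁, hπ₂⟩ := hsum₁.exists_desc a' (-𝟙 _)
  obtain ⟨y, hy₁, hy₂⟩ := hsum₁.exists_desc (𝟙 _) (0 : X.seq.obj' 1 ⟶ _)
  have hsπ : s ≫ π = 0 := by
    rw [hs, Preadditive.add_comp, Category.assoc, hπ₁, hπ₂, Preadditive.comp_neg,
      Category.comp_id, add_neg_cancel]
  have hys : y ≫ s = 𝟙 _ + π ≫ x := by
    refine hsum₁.hom_ext ?_ ?_
    · rw [reassoc_of% hy₁, Preadditive.comp_add, reassoc_of% hπ₁, Category.comp_id, hs]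
    · rw [reassoc_of% hy₂, Preadditive.comp_add, reassoc_of% hπ₂, Category.comp_id, zero_comp,
        Preadditive.neg_comp, Category.id_comp, add_neg_cancel]
  let e₁ : X.seq.obj' 1 ≅ W.seq.obj' 1 :=
    { hom := -x ≫ app' q 1 h11
      inv := app' ι 1 h11 ≫ π
      hom_inv_id := by
        rw [← eq_sub_iff_add_eq] at h₃
        rw [Preadditive.neg_comp, Category.assoc, ← Category.assoc (app' q 1 _), h₃,
          Preadditive.sub_comp, Category.assoc, Category.assoc, hsπ, comp_zero, comp_zero,
          sub_zero, Category.id_comp, hπ₂, neg_neg]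
      inv_hom_id := by
        rw [Preadditive.comp_neg, Category.assoc, ← Category.assoc π, ← sub_eq_iff_eq_add'.2 hys]
        rw [Preadditive.sub_comp, Category.assoc, hsq, comp_zero, zero_sub, Preadditive.comp_neg,
          neg_neg, Category.id_comp, hιq] }
  have hnd : ¬InDisk 1 0 := by simp only [InDisk]; omega
  have := hi 0 (by omega) hnd
  let e₀ : X.seq.left ≅ W.seq.left :=
    a.symm ≪≫ asIso (app' i 0 h01) ≪≫
      ⟨app' q 0 h01, app' ι 0 h01, hqι 0 (by omega) hnd, hιq 0 (by omega)⟩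
  refine ⟨(Arrow.isoMk e₀ e₁ ?_).symm⟩
  change (a.inv ≫ app' i 0 h01 ≫ app' q 0 h01) ≫ W.seq.map' 0 1 =
    f ≫ (-x ≫ app' q 1 h11)
  have h₅ : app' q 0 h01 ≫ W.seq.map' 0 1 = B.seq.map' 0 1 ≫ app' q 1 h11 :=
    (ComposableArrows.naturality' q 0 1).symm
  have h₆ : app' i 0 h01 ≫ B.seq.map' 0 1 = E.seq.map' 0 1 ≫ app' i 1 h11 :=
    (ComposableArrows.naturality' i 0 1).symm
  rw [Category.assoc, Category.assoc, h₅, ← Category.assoc (app' i 0 _), h₆,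
    eq_sub_of_add_eq hs.symm, Category.assoc, Preadditive.sub_comp, hsq, zero_sub,
    Preadditive.comp_neg, Preadditive.comp_neg, Category.assoc, ← reassoc_of% ha',
    a.inv_hom_id_assoc, Preadditive.comp_neg]

/-- The last morphism of an `(n+2)`-angle is the last morphism of an `(n+2)`-angle with terms in
`A` if the last two terms and the first one belong to `A`. -/
lemma exists_mem_of_right {X : SigmaSeq S n} (hX : X ∈ Θ) (h₀ : A X.seq.left)
    (h₁ : A (X.seq.obj' n)) (hlast : A X.seq.right) :
    ∃ W ∈ Θ, (∀ i, A (W.seq.obj i)) ∧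
      Nonempty (Arrow.mk (W.seq.map' n (n + 1)) ≅ Arrow.mk (X.seq.map' n (n + 1))) := by
  obtain ⟨m, rfl⟩ : ∃ m, n = m + 1 := ⟨n - 1, by omega⟩
  obtain rfl | hm : m = 0 ∨ 1 ≤ m := by omega
  · refine ⟨X, hX, fun i => ?_, ⟨Iso.refl _⟩⟩
    match i with
    | ⟨0, _⟩ => exact h₀
    | ⟨1, _⟩ => exact h₁
    | ⟨2, _⟩ => exact hlast
  obtain ⟨E, hE, hEA, a, c, hac⟩ := hext X.δ h₀ hlast
  let f : X.seq.obj' (m + 1) ⟶ X.seq.right := X.seq.map' (m + 1) (m + 2)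
  obtain ⟨u, hu⟩ : ∃ u : E.seq.obj' (m + 1) ⟶ X.seq.obj' (m + 1),
      E.seq.map' (m + 1) (m + 2) ≫ c.hom = u ≫ f := hΘ.lift_last hn hX _ (by
    rw [Category.assoc, ← hac, ← Category.assoc, hΘ.comp_δ hn hE, zero_comp])
  obtain ⟨v, hv⟩ : ∃ v : X.seq.obj' (m + 1) ⟶ E.seq.obj' (m + 1),
      f ≫ c.inv = v ≫ E.seq.map' (m + 1) (m + 2) := hΘ.lift_last hn hE _ (by
    rw [← cancel_mono (S.map a.hom), zero_comp, Category.assoc, Category.assoc, hac,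
      c.inv_hom_id_assoc]
    exact hΘ.comp_δ hn hX)
  obtain ⟨k, hk⟩ := hΘ.lift hn m hE (by omega) (𝟙 _ - u ≫ v) (by
    rw [Preadditive.sub_comp, Category.id_comp, Category.assoc, ← hv, ← Category.assoc, ← hu,
      Category.assoc, c.hom_inv_id, Category.comp_id, sub_self])
  have hm₁ : m ≤ m + 1 + 1 := by omega
  have hm₂ : m + 1 ≤ m + 1 + 1 := by omega
  -- Mirror image: a disk on `Xₙ` is added in degrees `n - 1` and `n`, and a disk on `Eₙ` is split
  -- off by `s = (k, u)` and `r = (1, v)`.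
  obtain ⟨B, hB, i, x, x', hi, hsum₁, hsum₂, hx⟩ := hΘ.exists_add_disk hE m hm₂
    (X.seq.obj' (m + 1))
  obtain ⟨r, hr₁, hr₂⟩ := hsum₂.exists_desc (𝟙 _) v
  have hid : app' i m hm₁ ≫ B.seq.map' m (m + 1) = E.seq.map' m (m + 1) ≫ app' i (m + 1) hm₂ :=
    (ComposableArrows.naturality' i m (m + 1)).symm
  obtain ⟨s, hs⟩ : ∃ s, s = k ≫ app' i m hm₁ + u ≫ x := ⟨_, rfl⟩
  obtain ⟨W, hW, ι, q, hιq, hqι, -, h₄, -, hιr⟩ := hΘ.exists_split hn hC hB m hm₂ s r (by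
    rw [hs, Preadditive.add_comp, Category.assoc, Category.assoc, ← Category.assoc x, hx, hr₂,
      ← Category.assoc (app' i m _), hid, Category.assoc, hr₁, Category.comp_id]
    exact (sub_eq_iff_eq_add.1 hk).symm)
  refine ⟨W, hW, fun l => hA.of_retract hC _ _ (hιq l.val (by omega)) ?_, ?_⟩
  · by_cases hl : InDisk m l.val
    · obtain ⟨l, hl'⟩ := l
      obtain rfl | rfl : l = m ∨ l = m + 1 := by simp only [InDisk] at hl; omega
      · exact hA.sum _ _ hsum₁ (hEA _) h₁
      · exact hA.sum _ _ hsum₂ (hEA _) h₁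
    · have := hi l.val (by omega) hl
      exact hA.of_iso (asIso (app' i l.val (Nat.le_of_lt_succ l.2))) (hEA _)
  obtain ⟨π, hπ₁, hπ₂⟩ := hsum₂.exists_desc 0 (-𝟙 (X.seq.obj' (m + 1)))
  -- `ψ` is a split kernel of `r`, with retraction `π`.
  obtain ⟨ψ, hψ⟩ : ∃ ψ, ψ = v ≫ app' i (m + 1) hm₂ - x' := ⟨_, rfl⟩
  have hψr : ψ ≫ r = 0 := by
    rw [hψ, Preadditive.sub_comp, Category.assoc, hr₁, hr₂, Category.comp_id, sub_self]
  have hψπ : ψ ≫ π = 𝟙 _ := by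
    rw [hψ, Preadditive.sub_comp, Category.assoc, hπ₁, hπ₂, comp_zero, zero_sub, neg_neg]
  have hri : r ≫ app' i (m + 1) hm₂ = 𝟙 _ - π ≫ ψ := by
    refine hsum₂.hom_ext ?_ ?_
    · rw [reassoc_of% hr₁, Preadditive.comp_sub, reassoc_of% hπ₁, Category.comp_id, zero_comp,
        sub_zero]
    · rw [reassoc_of% hr₂, Preadditive.comp_sub, reassoc_of% hπ₂, Category.comp_id,
        Preadditive.neg_comp, Category.id_comp, hψ, sub_neg_eq_add, add_sub_cancel]
  let e₁ : X.seq.obj' (m + 1) ≅ W.seq.obj' (m + 1) :=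
    { hom := ψ ≫ app' q (m + 1) hm₂
      inv := app' ι (m + 1) hm₂ ≫ π
      hom_inv_id := by
        rw [← eq_sub_iff_add_eq] at h₄
        rw [Category.assoc, ← Category.assoc (app' q (m + 1) _), h₄, Preadditive.sub_comp,
          Preadditive.comp_sub, Category.id_comp, Category.assoc, reassoc_of% hψr, zero_comp,
          sub_zero, hψπ]
      inv_hom_id := by
        rw [Category.assoc, ← Category.assoc π, ← sub_eq_iff_eq_add'.2 (eq_add_of_sub_eq hri.symm),
          Preadditive.sub_comp, Preadditive.comp_sub, Category.id_comp, Category.assoc,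
          reassoc_of% hιr, zero_comp, sub_zero, hιq] }
  have hnd : ¬InDisk m (m + 2) := by simp only [InDisk]; omega
  have hm₃ : m + 2 ≤ m + 1 + 1 := by omega
  have := hi (m + 2) hm₃ hnd
  let e₂ : X.seq.right ≅ W.seq.right :=
    c.symm ≪≫ asIso (app' i (m + 2) hm₃) ≪≫
      ⟨app' q (m + 2) hm₃, app' ι (m + 2) hm₃, hqι (m + 2) hm₃ hnd, hιq (m + 2) hm₃⟩
  refine ⟨(Arrow.isoMk e₁ e₂ ?_).symm⟩
  change (ψ ≫ app' q (m + 1) hm₂) ≫ W.seq.map' (m + 1) (m + 2) =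
    f ≫ c.inv ≫ app' i (m + 2) hm₃ ≫ app' q (m + 2) hm₃
  have h₅ : app' q (m + 1) hm₂ ≫ W.seq.map' (m + 1) (m + 2) =
      B.seq.map' (m + 1) (m + 2) ≫ app' q (m + 2) hm₃ :=
    (ComposableArrows.naturality' q (m + 1) (m + 2)).symm
  have h₆ : app' i (m + 1) hm₂ ≫ B.seq.map' (m + 1) (m + 2) =
      E.seq.map' (m + 1) (m + 2) ≫ app' i (m + 2) hm₃ :=
    (ComposableArrows.naturality' i (m + 1) (m + 2)).symm
  have h₇ : x' ≫ B.seq.map' (m + 1) (m + 2) = 0 := by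
    rw [← hx, Category.assoc, hΘ.isComplex hn hB m hm₃, comp_zero]
  rw [Category.assoc, h₅, ← Category.assoc, hψ, Preadditive.sub_comp, Category.assoc, h₆, h₇,
    sub_zero, ← Category.assoc v, ← hv]
  simp only [Category.assoc]

end IsAngulation

end Disks

/-! ### Composites of first and of last morphisms of angles in `A`. -/

section Composition

lemma exists_iso_of_arrow_iso {D : Type u} [Category.{v} D] {X Y X' Y' : D} {f : X ⟶ Y}
    {g : X' ⟶ Y'} (e : Arrow.mk f ≅ Arrow.mk g) :
    ∃ (α : X ≅ X') (β : Y ≅ Y'), f ≫ β.hom = α.hom ≫ g :=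
  ⟨Arrow.leftFunc.mapIso e, Arrow.rightFunc.mapIso e, e.hom.w.symm⟩

variable {C : Type u} [Category.{v} C] [Preadditive C] [HasFiniteBiproducts C] {S : C ⥤ C}
  [S.IsEquivalence] [S.Additive] {n : ℕ} {Θ : Set (SigmaSeq S n)} {A : ObjectProperty C}

namespace IsAngulation

variable (hΘ : IsAngulation Θ) (hn : 1 ≤ n)

include hΘ

omit [HasFiniteBiproducts C] [S.Additive] in
/-- Every morphism is the last morphism of an `(n+2)`-angle. -/
lemma exists_angle_last {V W : C} (f : V ⟶ W) :
    ∃ X ∈ Θ, Nonempty (Arrow.mk (X.seq.map' n (n + 1)) ≅ Arrow.mk f) := by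
  let a := S.objObjPreimageIso V
  let b := S.objObjPreimageIso W
  -- Two rotations bring the first morphism `g` to the last place as `S.map g` up to sign; the sign
  -- is absorbed into the isomorphism of targets.
  obtain ⟨g, hg⟩ := S.map_surjective (a.hom ≫ f ≫ b.inv)
  obtain ⟨X, hX, ⟨e⟩⟩ := hΘ.exists_angle g
  obtain ⟨Y, hY, s, l, -, -, h₁⟩ := hΘ.exists_rotation hX
  obtain ⟨Z, hZ, s', l', -, h₂, -⟩ := hΘ.exists_rotation hY
  obtain ⟨α, β, hαβ⟩ := exists_iso_of_arrow_iso e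
  let L : V ≅ Z.seq.obj' n := a.symm ≪≫ S.mapIso α.symm ≪≫ l ≪≫ s' n le_rfl
  let R : W ≅ Z.seq.obj' (n + 1) := b.symm ≪≫
    S.mapIso (β.symm ≪≫ s 0 (Nat.zero_le _)) ≪≫ l'
  have key : L.hom ≫ Z.seq.map' n (n + 1) = (-1 : ℤ) ^ n • (f ≫ R.hom) := by
    have h₃ : L.hom ≫ Z.seq.map' n (n + 1) =
        a.inv ≫ S.map α.inv ≫ l.hom ≫ (s' n le_rfl).hom ≫ Z.seq.map' n (n + 1) := by
      change (a.inv ≫ S.map α.inv ≫ l.hom ≫ (s' n le_rfl).hom) ≫ _ = _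
      simp only [Category.assoc]
    have h₄ : α.inv ≫ X.seq.map' 0 1 = g ≫ β.inv := by
      rw [Iso.inv_comp_eq, ← Category.assoc, ← hαβ, Category.assoc, β.hom_inv_id,
        Category.comp_id]
    rw [h₃, ← h₂, reassoc_of% h₁, Preadditive.zsmul_comp, Preadditive.comp_zsmul,
      Preadditive.comp_zsmul]
    congr 1
    rw [← Category.assoc (S.map α.inv), ← S.map_comp, ← Category.assoc α.inv, h₄, Category.assoc,
      S.map_comp, hg]
    change _ = f ≫ b.inv ≫ S.map (β.inv ≫ (s 0 (Nat.zero_le _)).hom) ≫ l'.hom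
    simp only [S.map_comp, Category.assoc, a.inv_hom_id_assoc]
  refine ⟨Z, hZ, ?_⟩
  obtain h | h := neg_one_pow_eq_or ℤ n
  · rw [h, one_smul] at key
    exact ⟨(Arrow.isoMk L R key).symm⟩
  · rw [h, neg_one_smul] at key
    exact ⟨(Arrow.isoMk L ⟨-R.hom, -R.inv, by simp, by simp⟩
      (key.trans (Preadditive.comp_neg _ _).symm)).symm⟩

include hn

lemma lift_map {X : SigmaSeq S n} (hX : X ∈ Θ) {T : C} (g : T ⟶ S.obj (X.seq.obj' 1))
    (hg : g ≫ S.map (X.seq.map' 1 2) = 0) : ∃ z, g = z ≫ S.map (X.seq.map' 0 1) := by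
  let t := S.objObjPreimageIso T
  obtain ⟨g', hg'⟩ := S.map_surjective (t.hom ≫ g)
  obtain ⟨z, hz⟩ := hΘ.lift hn 0 hX (by omega) g' (by
    apply S.map_injective
    rw [S.map_comp, S.map_zero, hg', Category.assoc, hg, comp_zero])
  refine ⟨t.inv ≫ S.map z, ?_⟩
  rw [Category.assoc, ← S.map_comp, ← hz, hg', t.inv_hom_id_assoc]

/-- The identity of the cone of a composite of morphisms with cones in `A` is, up to a morphism
which factors through `A`, a morphism which factors through the last morphism of the
`(n+2)`-angle. -/
lemma exists_factor_last (hext : IsExtensionClosed Θ A) {P Q X : SigmaSeq S n} (hP : P ∈ Θ)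
    (hQ : Q ∈ Θ) (hX : X ∈ Θ) (hPA : ∀ i, A (P.seq.obj i)) (hQA : ∀ i, A (Q.seq.obj i))
    (e : P.seq.obj' 1 ≅ Q.seq.obj' 0) (α : X.seq.obj' 0 ≅ P.seq.obj' 0)
    (β : X.seq.obj' 1 ≅ Q.seq.obj' 1)
    (hαβ : X.seq.map' 0 1 ≫ β.hom = α.hom ≫ P.seq.map' 0 1 ≫ e.hom ≫ Q.seq.map' 0 1) :
    ∃ (M : C) (_ : A M) (u : X.seq.right ⟶ M) (w : M ⟶ X.seq.right) (K : C) (_ : A K)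
      (u' : X.seq.right ⟶ K) (w' : K ⟶ X.seq.right) (b : X.seq.right ⟶ X.seq.obj' n),
      u ≫ w + u' ≫ w' + b ≫ X.seq.map' n (n + 1) = 𝟙 _ := by
  have h12 : 1 + 1 ≤ n + 1 := by omega
  obtain ⟨f, hf⟩ : ∃ f : P.seq.obj' 0 ⟶ Q.seq.obj' 0, f = P.seq.map' 0 1 ≫ e.hom := ⟨_, rfl⟩
  obtain ⟨x, hx⟩ : ∃ x : Q.seq.obj' 0 ⟶ P.seq.obj' 2, x = e.inv ≫ P.seq.map' 1 2 := ⟨_, rfl⟩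
  obtain ⟨g, hg⟩ : ∃ g : Q.seq.obj' 0 ⟶ Q.seq.obj' 1, g = Q.seq.map' 0 1 := ⟨_, rfl⟩
  have hfx : f ≫ x = 0 := by
    rw [hf, hx, Category.assoc, e.hom_inv_id_assoc, hΘ.isComplex hn hP 0 h12]
  obtain ⟨δ, hδ⟩ : ∃ δ : X.seq.right ⟶ S.obj (P.seq.obj' 0), δ = X.δ ≫ S.map α.hom := ⟨_, rfl⟩
  have hX' : X.seq.map' 0 1 ≫ β.hom = α.hom ≫ f ≫ g := by
    rw [hαβ, hf, hg, Category.assoc]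
  have hX'' : f ≫ g = α.inv ≫ X.seq.map' 0 1 ≫ β.hom := by
    rw [hX', α.inv_hom_id_assoc]
  have hδfg : δ ≫ S.map f ≫ S.map g = 0 := by
    rw [hδ, Category.assoc, ← S.map_comp, ← S.map_comp, ← hX', S.map_comp, ← Category.assoc,
      hΘ.δ_comp hn hX, zero_comp]
  -- morphisms to `S P₀` which `f ≫ g` annihilates factor through `δ`
  have hlift : ∀ {T : C} (z : T ⟶ S.obj (P.seq.obj' 0)), z ≫ S.map f ≫ S.map g = 0 →
      ∃ y : T ⟶ X.seq.right, y ≫ δ = z := by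
    intro T z hz
    obtain ⟨y, hy⟩ := hΘ.lift_zero hn hX (z ≫ S.map α.inv) (by
      rw [← S.map_comp, hX''] at hz
      rw [← cancel_mono (S.map β.hom), Category.assoc, Category.assoc, ← S.map_comp,
        ← S.map_comp, hz, zero_comp])
    refine ⟨y, ?_⟩
    rw [hδ, ← Category.assoc, ← hy, Category.assoc, ← S.map_comp, α.inv_hom_id, S.map_id,
      Category.comp_id]
  -- A substitute for the octahedron. Both `ε : Eₙ ⟶ S Q₀` and `δ ≫ S.map f` are annihilated by
  -- `S.map x` and `S.map g`, and exactness of the angles makes each factor through the other.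
  obtain ⟨E, hE, hEA, a, c, hac⟩ := hext (Q.δ ≫ S.map x) (hPA _) (hQA _)
  obtain ⟨ε, hε⟩ : ∃ ε : E.seq.obj' n ⟶ S.obj (Q.seq.obj' 0),
    ε = E.seq.map' n (n + 1) ≫ c.hom ≫ Q.δ := ⟨_, rfl⟩
  have hεx : ε ≫ S.map x = 0 := by
    rw [hε, Category.assoc, Category.assoc, ← hac, ← Category.assoc, hΘ.comp_δ hn hE, zero_comp]
  have hQδ : Q.δ ≫ S.map g = 0 := by rw [hg, hΘ.δ_comp hn hQ]
  obtain ⟨u, hu⟩ : ∃ u, u ≫ ε = δ ≫ S.map f := by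
    obtain ⟨w, hw⟩ := hΘ.lift_zero hn hQ (δ ≫ S.map f) (by
      rw [← hg, Category.assoc, hδfg])
    obtain ⟨u, hu⟩ := hΘ.lift_last hn hE (w ≫ c.inv) (by
      rw [← cancel_mono (S.map a.hom), Category.assoc, Category.assoc, hac, c.inv_hom_id_assoc,
        ← Category.assoc, ← hw, Category.assoc, ← S.map_comp, hfx, S.map_zero, comp_zero,
        zero_comp])
    refine ⟨u, ?_⟩
    rw [hε, ← Category.assoc, ← hu, Category.assoc, c.inv_hom_id_assoc, hw]
  obtain ⟨v, hv⟩ : ∃ v, v ≫ δ ≫ S.map f = ε := by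
    obtain ⟨z, hz⟩ := hΘ.lift_map hn hP (ε ≫ S.map e.inv) (by
      rw [Category.assoc, ← S.map_comp, ← hx, hεx])
    have hz' : z ≫ S.map f = ε := by
      rw [hf, S.map_comp, ← Category.assoc, ← hz, Category.assoc, ← S.map_comp, e.inv_hom_id,
        S.map_id, Category.comp_id]
    obtain ⟨v, hv⟩ := hlift z (by
      rw [← Category.assoc, hz', hε, Category.assoc, Category.assoc, hQδ, comp_zero, comp_zero])
    exact ⟨v, by rw [← Category.assoc, hv, hz']⟩
  -- The defect is annihilated by `S.map f`, hence passes through `Pₙ₊₁`, which is in `A`. What then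
  -- remains of the identity is annihilated by `δ`, so it passes through `Xₙ`.
  obtain ⟨a', ha'⟩ := hΘ.lift_zero hn hP ((𝟙 _ - u ≫ v) ≫ δ) (by
    rw [← cancel_mono (S.map e.hom), Category.assoc, ← S.map_comp, ← hf, Category.assoc,
      Preadditive.sub_comp, Category.assoc, hv, hu, Category.id_comp, sub_self, zero_comp])
  obtain ⟨γ, hγ⟩ := hlift P.δ (by
    rw [hf, S.map_comp, ← Category.assoc, ← Category.assoc, hΘ.δ_comp hn hP, zero_comp, zero_comp])
  obtain ⟨b, hb⟩ := hΘ.lift_last hn hX (𝟙 _ - u ≫ v - a' ≫ γ) (by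
    rw [← cancel_mono (S.map α.hom), Category.assoc, ← hδ, Preadditive.sub_comp, ha',
      Category.assoc, hγ, sub_self, zero_comp])
  refine ⟨_, hEA _, u, v, _, hPA _, a', γ, b, ?_⟩
  rw [← hb]
  abel

/-- The dual of `exists_factor_last`: the identity of the first term of a sequence on a composite of
admissible epimorphisms factors through `A` and its first morphism. -/
lemma exists_factor_first (hext : IsExtensionClosed Θ A) {P Q X : SigmaSeq S n} (hP : P ∈ Θ)
    (hQ : Q ∈ Θ) (hX : X ∈ Θ) (hPA : ∀ i, A (P.seq.obj i)) (hQA : ∀ i, A (Q.seq.obj i))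
    (e : P.seq.obj' (n + 1) ≅ Q.seq.obj' n) (α : X.seq.obj' n ≅ P.seq.obj' n)
    (β : X.seq.obj' (n + 1) ≅ Q.seq.obj' (n + 1))
    (hαβ : X.seq.map' n (n + 1) ≫ β.hom =
      α.hom ≫ P.seq.map' n (n + 1) ≫ e.hom ≫ Q.seq.map' n (n + 1)) :
    ∃ (M : C) (_ : A M) (u : X.seq.left ⟶ M) (w : M ⟶ X.seq.left) (K : C) (_ : A K)
      (u' : X.seq.left ⟶ K) (w' : K ⟶ X.seq.left) (b : X.seq.obj' 1 ⟶ X.seq.left),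
      u ≫ w + u' ≫ w' + X.seq.map' 0 1 ≫ b = 𝟙 _ := by
  obtain ⟨m, rfl⟩ : ∃ m, n = m + 1 := ⟨n - 1, by omega⟩
  have hm : m + 1 ≤ m + 2 := by omega
  have hm₂ : m + 2 ≤ m + 2 := le_rfl
  obtain ⟨f, hf⟩ : ∃ f : P.seq.obj' (m + 1) ⟶ Q.seq.obj' (m + 1),
    f = P.seq.map' (m + 1) (m + 2) ≫ e.hom := ⟨_, rfl⟩
  obtain ⟨x, hx⟩ : ∃ x : Q.seq.obj' m ⟶ P.seq.obj' (m + 2),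
    x = Q.seq.map' m (m + 1) ≫ e.inv := ⟨_, rfl⟩
  obtain ⟨g, hg⟩ : ∃ g : Q.seq.obj' (m + 1) ⟶ Q.seq.obj' (m + 2),
    g = Q.seq.map' (m + 1) (m + 2) := ⟨_, rfl⟩
  have hxg : x ≫ e.hom ≫ g = 0 := by
    rw [hg, hx, Category.assoc, e.inv_hom_id_assoc, hΘ.isComplex hn hQ m hm₂]
  have hfP : f ≫ e.inv ≫ P.δ = 0 := by
    rw [hf, Category.assoc, e.hom_inv_id_assoc]
    exact hΘ.comp_δ hn hP
  have hgQ : g ≫ Q.δ = 0 := by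
    rw [hg]
    exact hΘ.comp_δ hn hQ
  obtain ⟨δ, hδ⟩ : ∃ δ : Q.seq.obj' (m + 2) ⟶ S.obj X.seq.left, δ = β.inv ≫ X.δ := ⟨_, rfl⟩
  have hX' : X.seq.map' (m + 1) (m + 2) ≫ β.hom = α.hom ≫ f ≫ g := by
    rw [hαβ, hf, hg, Category.assoc]
  have hfgδ : f ≫ g ≫ δ = 0 := by
    have h : α.hom ≫ f ≫ g ≫ δ = (α.hom ≫ f ≫ g) ≫ δ := by simp only [Category.assoc]
    rw [← cancel_epi α.hom, h, ← hX', Category.assoc, hδ, β.hom_inv_id_assoc, comp_zero]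
    exact hΘ.comp_δ hn hX
  -- morphisms from `Qₙ₊₁` which `f ≫ g` annihilates factor through `δ`
  have hdesc : ∀ {T : C} (z : Q.seq.obj' (m + 2) ⟶ S.obj T), f ≫ g ≫ z = 0 →
      ∃ y : X.seq.left ⟶ T, δ ≫ S.map y = z := by
    intro T z hz
    obtain ⟨y, hy⟩ := hΘ.desc_last hn hX (β.hom ≫ z) (by
      rw [← Category.assoc]
      refine (congrArg (· ≫ z) hX').trans ?_
      rw [Category.assoc, Category.assoc, hz, comp_zero])
    obtain ⟨y, rfl⟩ := S.map_surjective y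
    refine ⟨y, ?_⟩
    rw [hδ, Category.assoc, ← hy, β.inv_hom_id_assoc]
  -- Mirror image, with `E` realising `Qₙ₋₁ ⟶ Pₙ₊₁ ⟶ S P₀`: now `ε` and `e.hom ≫ g ≫ δ`, both
  -- starting at `Pₙ₊₁`, factor through one another.
  obtain ⟨E, hE, hEA, a, c, hac⟩ := hext (x ≫ P.δ) (hPA _) (hQA _)
  obtain ⟨ε, hε⟩ : ∃ ε : P.seq.obj' (m + 2) ⟶ S.obj (E.seq.obj' 1),
    ε = P.δ ≫ S.map (a.inv ≫ E.seq.map' 0 1) := ⟨_, rfl⟩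
  have hPa : (x ≫ P.δ) ≫ S.map a.inv = c.inv ≫ E.δ := by
    rw [← cancel_epi c.hom, ← Category.assoc, ← hac, Category.assoc, ← S.map_comp, a.hom_inv_id,
      S.map_id, Category.comp_id, c.hom_inv_id_assoc]
  have hxε : x ≫ ε = 0 := by
    rw [hε, S.map_comp, ← Category.assoc, ← Category.assoc]
    refine (congrArg (· ≫ _) hPa).trans ?_
    rw [Category.assoc, hΘ.δ_comp hn hE, comp_zero]
  obtain ⟨v, hv⟩ : ∃ v : E.seq.obj' 1 ⟶ X.seq.left, ε ≫ S.map v = e.hom ≫ g ≫ δ := by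
    obtain ⟨w, hw⟩ := hΘ.desc_last hn hP (e.hom ≫ g ≫ δ) (by
      rw [← Category.assoc]
      refine (congrArg (· ≫ g ≫ δ) hf.symm).trans ?_
      rw [hfgδ])
    obtain ⟨w, rfl⟩ := S.map_surjective w
    obtain ⟨v, hv⟩ := hΘ.desc_zero hn hE (a.hom ≫ w) (by
      rw [S.map_comp, reassoc_of% hac]
      have h : x ≫ P.δ ≫ S.map w = 0 := by
        rw [← hw, ← Category.assoc e.hom, ← Category.assoc x, hxg, zero_comp]
      rw [h, comp_zero])
    refine ⟨v, ?_⟩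
    rw [hε, hw, Category.assoc, ← S.map_comp, Category.assoc, ← hv, a.inv_hom_id_assoc]
  obtain ⟨u, hu⟩ : ∃ u : X.seq.left ⟶ E.seq.obj' 1, e.hom ≫ g ≫ δ ≫ S.map u = ε := by
    obtain ⟨z, hz⟩ := hΘ.desc hn m hQ hm₂ (e.inv ≫ ε) (by
      rw [← Category.assoc]
      refine (congrArg (· ≫ ε) hx.symm).trans hxε)
    have hz' : e.hom ≫ g ≫ z = ε := by
      rw [hg, ← hz, e.hom_inv_id_assoc]
    obtain ⟨u, hu⟩ := hdesc z (by
      rw [hf, Category.assoc, hz', hε, ← Category.assoc]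
      refine (congrArg (· ≫ _) (hΘ.comp_δ hn hP)).trans zero_comp)
    exact ⟨u, by rw [hu, hz']⟩
  obtain ⟨a', ha'⟩ := hΘ.desc_last hn hQ (δ ≫ S.map (𝟙 _ - u ≫ v)) (by
    refine (congrArg (· ≫ _) hg.symm).trans ?_
    rw [← cancel_epi e.hom, S.map_sub, S.map_id, S.map_comp, Preadditive.comp_sub,
      Category.comp_id, Preadditive.comp_sub, Preadditive.comp_sub, ← hv, ← hu, comp_zero]
    simp only [Category.assoc, sub_self])
  obtain ⟨a', rfl⟩ := S.map_surjective a'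
  obtain ⟨γ, hγ⟩ := hdesc Q.δ (by rw [hgQ, comp_zero])
  obtain ⟨b, hb⟩ := hΘ.desc_zero hn hX (𝟙 _ - u ≫ v - γ ≫ a') (by
    have h : δ ≫ S.map (𝟙 _ - u ≫ v - γ ≫ a') = 0 := by
      rw [S.map_sub, Preadditive.comp_sub, ha', S.map_comp, ← hγ, Category.assoc, sub_self]
    rw [hδ, Category.assoc, ← comp_zero (f := β.inv), cancel_epi] at h
    exact h)
  refine ⟨_, hEA ⟨1, by omega⟩, u, v, _, hQA _, γ, a', b, ?_⟩
  rw [← hb]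
  abel

variable (hC : IsKrullSchmidt C) (hA : IsAdditiveSubcategory A) (hext : IsExtensionClosed Θ A)

include hC hA hext

/-- Composites of first morphisms of `(n+2)`-angles with terms in `A` are such morphisms. -/
lemma exists_mono_comp {P Q : SigmaSeq S n} (hP : P ∈ Θ) (hQ : Q ∈ Θ)
    (hPA : ∀ i, A (P.seq.obj i)) (hQA : ∀ i, A (Q.seq.obj i))
    (e : P.seq.obj' 1 ≅ Q.seq.obj' 0) :
    ∃ W ∈ Θ, (∀ i, A (W.seq.obj i)) ∧ Nonempty (Arrow.mk (W.seq.map' 0 1) ≅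
      Arrow.mk (P.seq.map' 0 1 ≫ e.hom ≫ Q.seq.map' 0 1)) := by
  obtain ⟨h, hh⟩ : ∃ h : P.seq.obj' 0 ⟶ Q.seq.obj' 1,
    h = P.seq.map' 0 1 ≫ e.hom ≫ Q.seq.map' 0 1 := ⟨_, rfl⟩
  rw [← hh]
  suffices ∃ X ∈ Θ, A X.seq.right ∧ Nonempty (Arrow.mk (X.seq.map' 0 1) ≅ Arrow.mk h) by
    obtain ⟨X, hX, hXA, ⟨i⟩⟩ := this
    obtain ⟨α, β, -⟩ := exists_iso_of_arrow_iso i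
    obtain ⟨W, hW, hWA, ⟨j⟩⟩ := hΘ.exists_mem_of_left hn hC hA hext hX
      (hA.of_iso α.symm (hPA _)) (hA.of_iso β.symm (hQA _)) hXA
    exact ⟨W, hW, hWA, ⟨j ≪≫ i⟩⟩
  have key : ∀ X ∈ Θ, ∀ (_ : Arrow.mk (X.seq.map' 0 1) ≅ Arrow.mk h),
      ∃ (M : C) (_ : A M) (u : X.seq.right ⟶ M) (w : M ⟶ X.seq.right)
        (b : X.seq.right ⟶ X.seq.obj' n), u ≫ w + b ≫ X.seq.map' n (n + 1) = 𝟙 _ := by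
    intro X hX i
    obtain ⟨α, β, hαβ⟩ := exists_iso_of_arrow_iso i
    obtain ⟨M, hM, u, w, K, hK, u', w', b, hb⟩ := hΘ.exists_factor_last hn hext hP hQ hX hPA hQA e
      α β (by rw [hαβ, hh])
    exact ⟨_, hA.biprod hM hK, biprod.lift u u', biprod.desc w w', b, by
      rw [biprod.lift_desc, hb]⟩
  obtain ⟨X, hX, ⟨i⟩⟩ := hΘ.exists_angle h
  -- For `n = 1` the term `Xₙ` is in `A`, so the last term is a retract of an object of `A`.
  obtain rfl | hn2 : n = 1 ∨ 2 ≤ n := by omega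
  · refine ⟨X, hX, ?_, ⟨i⟩⟩
    obtain ⟨M, hM, u, w, b, hb⟩ := key X hX i
    obtain ⟨-, β, -⟩ := exists_iso_of_arrow_iso i
    exact hA.of_retract hC (biprod.lift u b) (biprod.desc w (X.seq.map' 1 2))
      (by rw [biprod.lift_desc, hb]) (hA.biprod hM (hA.of_iso β.symm (hQA _)))
  -- A summand of the last term on which the part through `Xₙ` is invertible spans a disk in degrees
  -- `n` and `n + 1`. As `n ≥ 2`, removing this disk leaves the first morphism unchanged.
  let Φ : C → Prop := fun V => ∃ X ∈ Θ,
    Nonempty (Arrow.mk (X.seq.map' 0 1) ≅ Arrow.mk h) ∧ Nonempty (X.seq.right ≅ V)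
  suffices ∃ V, A V ∧ Φ V by
    obtain ⟨V, hV, X, hX, hi, ⟨κ⟩⟩ := this
    exact ⟨X, hX, hA.of_iso κ.symm hV, hi⟩
  refine hC.exists_mem hA ?_ X.seq.right ⟨X, hX, ⟨i⟩, ⟨Iso.refl _⟩⟩
  rintro V ⟨X, hX, ⟨i⟩, ⟨κ⟩⟩
  obtain ⟨M, hM, u, w, b, hb⟩ := key X hX i
  refine ⟨M, hM, κ.inv ≫ u, w ≫ κ.hom, κ.inv ≫ b ≫ X.seq.map' n (n + 1) ≫ κ.hom, ?_, ?_⟩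
  · have := congrArg (fun t => κ.inv ≫ t ≫ κ.hom) hb
    simpa only [Preadditive.comp_add, Preadditive.add_comp, Category.assoc, Category.id_comp,
      κ.inv_hom_id] using this
  intro N V' y y' p p' h₁ h₂ h₃ h₄ h₅ hI
  have hm : n + 1 ≤ n + 1 := le_rfl
  obtain ⟨t, ht⟩ : ∃ t, t = y ≫ (κ.inv ≫ b ≫ X.seq.map' n (n + 1) ≫ κ.hom) ≫ p := ⟨_, rfl⟩
  rw [← ht] at hI
  obtain ⟨s, hs⟩ : ∃ s, s = y ≫ κ.inv ≫ b := ⟨_, rfl⟩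
  obtain ⟨r, hr⟩ : ∃ r, r = κ.hom ≫ p ≫ inv t := ⟨_, rfl⟩
  obtain ⟨W, hW, ι, q, hιq, hqι, -, hq, -, hιr⟩ := hΘ.exists_split hn hC hX n hm s r (by
    have : s ≫ X.seq.map' n (n + 1) ≫ r = t ≫ inv t := by
      rw [hs, hr]
      refine Eq.trans ?_ (congrArg (· ≫ inv t) ht.symm)
      simp only [Category.assoc]
    rw [this, IsIso.hom_inv_id])
  have h0 : ¬InDisk n 0 := by simp only [InDisk]; omega
  have h1 : ¬InDisk n 1 := by simp only [InDisk]; omega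
  have h0' : 0 ≤ n + 1 := by omega
  have h1' : 1 ≤ n + 1 := by omega
  let e₀ : W.seq.obj' 0 ≅ X.seq.obj' 0 := ⟨app' ι 0 h0', app' q 0 h0', hιq _ _, hqι _ _ h0⟩
  let e₁ : W.seq.obj' 1 ≅ X.seq.obj' 1 := ⟨app' ι 1 h1', app' q 1 h1', hιq _ _, hqι _ _ h1⟩
  let e : Arrow.mk (W.seq.map' 0 1) ≅ Arrow.mk (X.seq.map' 0 1) :=
    Arrow.isoMk e₀ e₁ (ComposableArrows.naturality' ι 0 1).symm
  refine ⟨W, hW, ⟨e ≪≫ i⟩,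
    ⟨⟨app' ι (n + 1) hm ≫ κ.hom ≫ p', y' ≫ κ.inv ≫ app' q (n + 1) hm, ?_, ?_⟩⟩⟩
  · have hιp : app' ι (n + 1) hm ≫ κ.hom ≫ p = 0 := by
      rw [hr] at hιr
      rw [← cancel_mono (inv t), zero_comp, ← hιr]
      simp only [Category.assoc]
    have h₆ := eq_sub_of_add_eq' h₅
    simp only [Category.assoc]
    rw [← Category.assoc p', h₆, Preadditive.sub_comp, Preadditive.comp_sub, Preadditive.comp_sub,
      Category.id_comp, κ.hom_inv_id_assoc, hιq, Category.assoc, ← Category.assoc κ.hom,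
      ← Category.assoc (app' ι _ _), hιp, zero_comp, sub_zero]
  · have h₆ := eq_sub_of_add_eq hq
    simp only [Category.assoc]
    rw [← Category.assoc (app' q _ _), h₆, Preadditive.sub_comp, Preadditive.comp_sub,
      Preadditive.comp_sub, Category.id_comp, κ.inv_hom_id_assoc, h₂, hr]
    simp only [Category.assoc, κ.inv_hom_id_assoc]
    rw [← Category.assoc y', h₄, zero_comp, sub_zero]

/-- Composites of last morphisms of `(n+2)`-angles with terms in `A` are such morphisms. -/
lemma exists_epi_comp {P Q : SigmaSeq S n} (hP : P ∈ Θ) (hQ : Q ∈ Θ)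
    (hPA : ∀ i, A (P.seq.obj i)) (hQA : ∀ i, A (Q.seq.obj i))
    (e : P.seq.obj' (n + 1) ≅ Q.seq.obj' n) :
    ∃ W ∈ Θ, (∀ i, A (W.seq.obj i)) ∧ Nonempty (Arrow.mk (W.seq.map' n (n + 1)) ≅
      Arrow.mk (P.seq.map' n (n + 1) ≫ e.hom ≫ Q.seq.map' n (n + 1))) := by
  obtain ⟨h, hh⟩ : ∃ h : P.seq.obj' n ⟶ Q.seq.obj' (n + 1),
    h = P.seq.map' n (n + 1) ≫ e.hom ≫ Q.seq.map' n (n + 1) := ⟨_, rfl⟩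
  rw [← hh]
  suffices ∃ X ∈ Θ, A X.seq.left ∧ Nonempty (Arrow.mk (X.seq.map' n (n + 1)) ≅ Arrow.mk h) by
    obtain ⟨X, hX, hXA, ⟨i⟩⟩ := this
    obtain ⟨α, β, -⟩ := exists_iso_of_arrow_iso i
    obtain ⟨W, hW, hWA, ⟨j⟩⟩ := hΘ.exists_mem_of_right hn hC hA hext hX hXA
      (hA.of_iso α.symm (hPA _)) (hA.of_iso β.symm (hQA _))
    exact ⟨W, hW, hWA, ⟨j ≪≫ i⟩⟩
  have key : ∀ X ∈ Θ, ∀ (_ : Arrow.mk (X.seq.map' n (n + 1)) ≅ Arrow.mk h),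
      ∃ (M : C) (_ : A M) (u : X.seq.left ⟶ M) (w : M ⟶ X.seq.left)
        (b : X.seq.obj' 1 ⟶ X.seq.left), u ≫ w + X.seq.map' 0 1 ≫ b = 𝟙 _ := by
    intro X hX i
    obtain ⟨α, β, hαβ⟩ := exists_iso_of_arrow_iso i
    obtain ⟨M, hM, u, w, K, hK, u', w', b, hb⟩ := hΘ.exists_factor_first hn hext hP hQ hX hPA hQA e
      α β (by rw [hαβ, hh])
    exact ⟨_, hA.biprod hM hK, biprod.lift u u', biprod.desc w w', b, by
      rw [biprod.lift_desc, hb]⟩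
  obtain ⟨X, hX, ⟨i⟩⟩ := hΘ.exists_angle_last h
  obtain rfl | hn2 : n = 1 ∨ 2 ≤ n := by omega
  · refine ⟨X, hX, ?_, ⟨i⟩⟩
    obtain ⟨M, hM, u, w, b, hb⟩ := key X hX i
    obtain ⟨α, -, -⟩ := exists_iso_of_arrow_iso i
    exact hA.of_retract hC (biprod.lift u (X.seq.map' 0 1)) (biprod.desc w b)
      (by rw [biprod.lift_desc, hb]) (hA.biprod hM (hA.of_iso α.symm (hPA _)))
  -- Disks are now removed in degrees `0` and `1`, which do not meet the last morphism because `n ≥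
  -- 2`.
  let Φ : C → Prop := fun V => ∃ X ∈ Θ,
    Nonempty (Arrow.mk (X.seq.map' n (n + 1)) ≅ Arrow.mk h) ∧ Nonempty (X.seq.left ≅ V)
  suffices ∃ V, A V ∧ Φ V by
    obtain ⟨V, hV, X, hX, hi, ⟨κ⟩⟩ := this
    exact ⟨X, hX, hA.of_iso κ.symm hV, hi⟩
  refine hC.exists_mem hA ?_ X.seq.left ⟨X, hX, ⟨i⟩, ⟨Iso.refl _⟩⟩
  rintro V ⟨X, hX, ⟨i⟩, ⟨κ⟩⟩
  obtain ⟨M, hM, u, w, b, hb⟩ := key X hX i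
  refine ⟨M, hM, κ.inv ≫ u, w ≫ κ.hom, κ.inv ≫ X.seq.map' 0 1 ≫ b ≫ κ.hom, ?_, ?_⟩
  · have := congrArg (fun t => κ.inv ≫ t ≫ κ.hom) hb
    simpa only [Preadditive.comp_add, Preadditive.add_comp, Category.assoc, Category.id_comp,
      κ.inv_hom_id] using this
  intro N V' y y' p p' h₁ h₂ h₃ h₄ h₅ hI
  have h00 : 0 ≤ n + 1 := by omega
  have h01 : 0 + 1 ≤ n + 1 := by omega
  obtain ⟨t, ht⟩ : ∃ t, t = y ≫ (κ.inv ≫ X.seq.map' 0 1 ≫ b ≫ κ.hom) ≫ p := ⟨_, rfl⟩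
  rw [← ht] at hI
  obtain ⟨s, hs⟩ : ∃ s : N ⟶ X.seq.obj' 0, s = y ≫ κ.inv := ⟨_, rfl⟩
  obtain ⟨r, hr⟩ : ∃ r, r = b ≫ κ.hom ≫ p ≫ inv t := ⟨_, rfl⟩
  obtain ⟨W, hW, ι, q, hιq, hqι, hq, -, hsq, -⟩ := hΘ.exists_split hn hC hX 0 h01 s r (by
    have : s ≫ X.seq.map' 0 1 ≫ r = t ≫ inv t := by
      rw [hs, hr]
      refine Eq.trans ?_ (congrArg (· ≫ inv t) ht.symm)
      simp only [Category.assoc]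
    exact this.trans (IsIso.hom_inv_id t))
  have hd : ¬InDisk 0 n := by simp only [InDisk]; omega
  have hd' : ¬InDisk 0 (n + 1) := by simp only [InDisk]; omega
  have hm : n ≤ n + 1 := by omega
  have hm' : n + 1 ≤ n + 1 := le_rfl
  let e₀ : W.seq.obj' n ≅ X.seq.obj' n := ⟨app' ι n hm, app' q n hm, hιq _ _, hqι _ _ hd⟩
  let e₁ : W.seq.obj' (n + 1) ≅ X.seq.obj' (n + 1) :=
    ⟨app' ι (n + 1) hm', app' q (n + 1) hm', hιq _ _, hqι _ _ hd'⟩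
  let e : Arrow.mk (W.seq.map' n (n + 1)) ≅ Arrow.mk (X.seq.map' n (n + 1)) :=
    Arrow.isoMk e₀ e₁ (ComposableArrows.naturality' ι n (n + 1)).symm
  refine ⟨W, hW, ⟨e ≪≫ i⟩,
    ⟨⟨app' ι 0 h00 ≫ κ.hom ≫ p', y' ≫ κ.inv ≫ app' q 0 h00, ?_, ?_⟩⟩⟩
  · have h₆ := eq_sub_of_add_eq' h₅
    simp only [Category.assoc]
    rw [← Category.assoc p', h₆, Preadditive.sub_comp, Preadditive.comp_sub, Preadditive.comp_sub,
      Category.id_comp, κ.hom_inv_id_assoc, hιq, Category.assoc, ← Category.assoc y, ← hs, hsq,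
      comp_zero, comp_zero, comp_zero, sub_zero]
  · have hsp : s ≫ κ.hom ≫ p' = 0 := by
      rw [hs, Category.assoc, κ.inv_hom_id_assoc, h₃]
    have h₆ := eq_sub_of_add_eq hq
    simp only [Category.assoc]
    rw [← Category.assoc (app' q _ _), h₆, Preadditive.sub_comp, Preadditive.comp_sub,
      Preadditive.comp_sub, Category.id_comp, κ.inv_hom_id_assoc, h₂]
    simp only [Category.assoc, hsp, comp_zero, sub_zero]

end IsAngulation

end Composition

/-! ### Transport of the composition results to the full subcategory. -/

section Admissible

variable {C : Type u} [Category.{v} C] [Preadditive C] [HasFiniteBiproducts C] {S : C ⥤ C}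
  [S.IsEquivalence] [S.Additive] {n : ℕ} {Θ : Set (SigmaSeq S n)} {A : ObjectProperty C}

namespace IsAngulation

variable (hΘ : IsAngulation Θ) (hn : 1 ≤ n) (hC : IsKrullSchmidt C)
  (hA : IsAdditiveSubcategory A) (hext : IsExtensionClosed Θ A)

include hΘ hn hC hA hext

lemma isAdmissibleMono_comp {V₀ V₁ V₂ : A.FullSubcategory} (f : V₀ ⟶ V₁) (g : V₁ ⟶ V₂)
    (hf : IsAdmissibleMono (conflations Θ A) f) (hg : IsAdmissibleMono (conflations Θ A) g) :
    IsAdmissibleMono (conflations Θ A) (f ≫ g) := by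
  obtain ⟨P, ⟨δ, hP⟩, ⟨i⟩⟩ := hf
  obtain ⟨Q, ⟨δ', hQ⟩, ⟨j⟩⟩ := hg
  obtain ⟨α, β, hαβ⟩ := exists_iso_of_arrow_iso i
  obtain ⟨α', β', hαβ'⟩ := exists_iso_of_arrow_iso j
  obtain ⟨W, hW, hWA, ⟨k⟩⟩ := hΘ.exists_mono_comp hn hC hA hext hP hQ
    (fun l => (P.obj l).property) (fun l => (Q.obj l).property) (A.ι.mapIso (β ≪≫ α'.symm))
  obtain ⟨a, b, hab⟩ := exists_iso_of_arrow_iso k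
  have h : P.map' 0 1 ≫ (β ≪≫ α'.symm).hom ≫ Q.map' 0 1 ≫ β'.hom = α.hom ≫ f ≫ g := by
    rw [hαβ', Iso.trans_hom, Iso.symm_hom, Category.assoc, α'.inv_hom_id_assoc, reassoc_of% hαβ]
  let W' : ComposableArrows A.FullSubcategory (n + 1) := A.lift W.seq hWA
  obtain ⟨a', b', hab'⟩ : ∃ (a' : W'.obj' 0 ≅ P.obj' 0) (b' : W'.obj' 1 ≅ Q.obj' 1),
      W'.map' 0 1 ≫ b'.hom =
        a'.hom ≫ P.map' 0 1 ≫ (β ≪≫ α'.symm).hom ≫ Q.map' 0 1 :=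
    ⟨A.isoMk a, A.isoMk b, InducedCategory.hom_ext hab⟩
  have hw : (a' ≪≫ α).hom ≫ f ≫ g = W'.map' 0 1 ≫ (b' ≪≫ β').hom := by
    rw [Iso.trans_hom, Iso.trans_hom, Category.assoc, ← h, reassoc_of% hab']
  exact ⟨W', ⟨W.δ, hW⟩, ⟨Arrow.isoMk _ _ hw⟩⟩

lemma isAdmissibleEpi_comp {V₀ V₁ V₂ : A.FullSubcategory} (f : V₀ ⟶ V₁) (g : V₁ ⟶ V₂)
    (hf : IsAdmissibleEpi (conflations Θ A) f) (hg : IsAdmissibleEpi (conflations Θ A) g) :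
    IsAdmissibleEpi (conflations Θ A) (f ≫ g) := by
  obtain ⟨P, ⟨δ, hP⟩, ⟨i⟩⟩ := hf
  obtain ⟨Q, ⟨δ', hQ⟩, ⟨j⟩⟩ := hg
  obtain ⟨α, β, hαβ⟩ := exists_iso_of_arrow_iso i
  obtain ⟨α', β', hαβ'⟩ := exists_iso_of_arrow_iso j
  obtain ⟨W, hW, hWA, ⟨k⟩⟩ := hΘ.exists_epi_comp hn hC hA hext hP hQ
    (fun l => (P.obj l).property) (fun l => (Q.obj l).property) (A.ι.mapIso (β ≪≫ α'.symm))
  obtain ⟨a, b, hab⟩ := exists_iso_of_arrow_iso k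
  have h : P.map' n (n + 1) ≫ (β ≪≫ α'.symm).hom ≫ Q.map' n (n + 1) ≫ β'.hom =
      α.hom ≫ f ≫ g := by
    rw [hαβ', Iso.trans_hom, Iso.symm_hom, Category.assoc, α'.inv_hom_id_assoc, reassoc_of% hαβ]
  let W' : ComposableArrows A.FullSubcategory (n + 1) := A.lift W.seq hWA
  obtain ⟨a', b', hab'⟩ : ∃ (a' : W'.obj' n ≅ P.obj' n) (b' : W'.obj' (n + 1) ≅ Q.obj' (n + 1)),
      W'.map' n (n + 1) ≫ b'.hom =
        a'.hom ≫ P.map' n (n + 1) ≫ (β ≪≫ α'.symm).hom ≫ Q.map' n (n + 1) :=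
    ⟨A.isoMk a, A.isoMk b, InducedCategory.hom_ext hab⟩
  have hw : (a' ≪≫ α).hom ≫ f ≫ g = W'.map' n (n + 1) ≫ (b' ≪≫ β').hom := by
    rw [Iso.trans_hom, Iso.trans_hom, Category.assoc, ← h, reassoc_of% hab']
  exact ⟨W', ⟨W.δ, hW⟩, ⟨Arrow.isoMk _ _ hw⟩⟩

end IsAngulation

end Admissible

end HigherAngulated

open HigherAngulated in
theorem theorem3p6 {C : Type u} [Category.{v} C] [Preadditive C] [HasFiniteBiproducts C]
    (hC : IsKrullSchmidt C)
    (S : C ⥤ C) [S.IsEquivalence]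
    (n : ℕ) (hn : 1 ≤ n)
    (Θ : Set (SigmaSeq S n)) (hΘ : IsAngulation Θ)
    (A : ObjectProperty C) (hA : IsAdditiveSubcategory A)
    (hext : IsExtensionClosed Θ A)
    (hvan : ∀ {X Y : C}, A X → A Y → ∀ f : S.obj X ⟶ Y, f = 0) :
    IsNExactCategory hn (conflations Θ A) := by
  have : HasBinaryBiproducts C := hasBinaryBiproducts_of_finite_biproducts C
  -- Additivity of `S` is automatic: an equivalence preserves binary products.
  have : S.Additive := Functor.additive_of_preserves_binary_products S
  exact {
    hasFiniteBiproducts := hA.hasFiniteBiproducts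
    isNExact := hΘ.isNExact_of_conflations hn hvan
    weakIso := hΘ.conflations_weakIso hn hvan hC hext
    zero := hΘ.conflations_of_isZero
    mono_comp := hΘ.isAdmissibleMono_comp hn hC hA hext
    epi_comp := hΘ.isAdmissibleEpi_comp hn hC hA hext
    pushout := hΘ.exists_pushout hn hvan hA hext
    pullback := hΘ.exists_pullback hn hvan hA hext }
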